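/- Let $(\varepsilon_k)_{k\in\mathbb Z}$ be i.i.d. real random variables, $(\varepsilon'_k)_{k\in\mathbb Z}$ an independent copy of this sequence, and $G$ a real-valued measurable function on one-sided sequences. Put $\mathcal F_k=(\dots,\varepsilon_{k-1},\varepsilon_k)$ and $e_k=G(\mathcal F_k)$, and let $\mathcal F_k^*$ be $\mathcal F_k$ with $\varepsilon_0$ replaced by $\varepsilon'_0$ (so $\mathcal F_k^*=\mathcal F_k$ for $k<0$). Write $\|V\|=(\mathbb E|V|^2)^{1/2}$, and $|\cdot|$ for the Euclidean norm. Let $\rho:\mathbb R\to\mathbb R$ be convex with derivative $\psi$ (at points where $\rho$ is not differentiable, $\psi(x)$ is any subgradient of $\rho$ at $x$), and let $$\psi_1(t;\mathcal F_i)=\mathbb E[\psi(e_{i+1}+t)\mid\mathcal F_i],\qquad \psi_1^{(l)}(t;\mathcal F_i)=\partial^l\psi_1(t;\mathcal F_i)/\partial t^l ,$$ where $\psi_1(t;\cdot)$ is the function of the past obtained by integrating out the next innovation. Let $x_1,x_2,\dots\in\mathbb R^p$ be deterministic, $\Sigma_n=\sum_{i=1}^n x_ix_i'$ be nonsingular for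 all large $n$, $z_{i,n}=\Sigma_n^{-1/2}x_i$, $r_n=\max_{i\le n}|z_{i,n}|$ and $\zeta_n(q)=\sum_{i=1}^n|z_{i,n}|^q$. Assume: - (A1) $\mathbb E\psi(e_1)=0$ and $0<\|\psi(e_1)\|<\infty$. - (A2) $\varphi(t)=\mathbb E\psi(e_1+t)$ has a strictly positive derivative at $t=0$. - (A3) $m(t)=\|\psi(e_1+t)-\psi(e_1)\|$ is continuous at $t=0$ (in particular finite near $0$). - (A4) $r_n\to0$. - (A5) For some $\epsilon_0>0$, the variables $L_i=\sup_{|s|,|t|\le\epsilon_0,\,s\ne t}|\psi_1(s;\mathcal F_i)-\psi_1(t;\mathcal F_i)|/|s-t|$, $i\ge0$, are in $\mathcal L^1$. - (A6) For every $l=0,\dots,p$ there is an $\epsilon_0>0$ such that, for every $i\ge0$, $\psi_1(\cdot;\mathcal F_i)$ is almost surely of class $C^l$ in a neighbourhood of $[-\epsilon_0,\epsilon_0]$ and $\sup_{|\epsilon|\le\epsilon_0}\|\psi_1^{(l)}(\epsilon;\mathcal F_i)\|<\infty$, and $$\sum_{i=0}^\infty\sup_{|\epsilon|\le\epsilon_0}\bigl\|\mathbb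 E[\psi_1^{(l)}(\epsilon;\mathcal F_i)\mid\mathcal F_0]-\mathbb E[\psi_1^{(l)}(\epsilon;\mathcal F_i^*)\mid\mathcal F_0^*]\bigr\|<\infty .$$ Let $K_n(\theta)=\Omega_n(\theta)-\mathbb E\,\Omega_n(\theta)$ with $\Omega_n(\theta)=\sum_{i=1}^n\psi(e_i-z_{i,n}'\theta)\,z_{i,n}$, $\theta\in\mathbb R^p$, and, for $\delta>0$, $$\tau_n(\delta)=\sum_{i=1}^n|z_{i,n}|^2\bigl[m^2(|z_{i,n}|\delta)+m^2(-|z_{i,n}|\delta)\bigr].$$ Then, for every sequence of positive numbers $\delta_n$ with $\delta_n\to\infty$ and $\delta_n r_n\to0$, $$\sup_{|\theta|\le\delta_n}|K_n(\theta)-K_n(0)|=O_{\mathbb P}\Bigl[\sqrt{\tau_n(\delta_n)\log n}+\delta_n\sqrt{\zeta_n(4)}\Bigr];$$ that is, for every $\eta>0$ there is $C>0$ such that, for all sufficiently large $n$, the left-hand side exceeds $C$ times the bracket with probability at most $\eta$. -/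

import Mathlib

open MeasureTheory ProbabilityTheory Filter Topology
open scoped ENNReal NNReal MatrixOrder

noncomputable section

namespace MReg

section Errors

variable {Ω : Type*} [MeasurableSpace Ω]

/-- `(ε_k)` and `(ε'_k)`, `k ∈ ℤ`, are i.i.d. sequences of random variables, independent of each
other and with the same marginal law. -/
structure IsIIDPair (ε ε' : ℤ → Ω → ℝ) (P : Measure Ω) : Prop where
  measurable : ∀ j : ℤ ⊕ ℤ, Measurable (Sum.elim ε ε' j)
  indep : iIndepFun (Sum.elim ε ε') P
  ident : ∀ j : ℤ ⊕ ℤ, IdentDistrib (Sum.elim ε ε' j) (ε 0) P P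

/-- The shift process `F_k = (…, ε_{k-1}, ε_k)`, listed backwards in time: coordinate `j` is
`ε_{k-j}`. -/
def shift (ε : ℤ → Ω → ℝ) (k : ℤ) (ω : Ω) : ℕ → ℝ := fun j => ε (k - j) ω

/-- The coupled shift process `F_k^*`: in `F_k`, the innovation `ε_0` is replaced by `ε'_0`. -/
def shiftStar (ε ε' : ℤ → Ω → ℝ) (k : ℤ) (ω : Ω) : ℕ → ℝ :=
  fun j => if k - j = 0 then ε' 0 ω else ε (k - j) ω

/-- The causal process `e_k = G(…, ε_{k-1}, ε_k)`. -/
def err (G : (ℕ → ℝ) → ℝ) (ε : ℤ → Ω → ℝ) (k : ℤ) (ω : Ω) : ℝ := G (shift ε k ω)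

/-- The past `x` followed by one new innovation `u`. -/
def append (u : ℝ) (x : ℕ → ℝ) : ℕ → ℝ
  | 0 => u
  | j + 1 => x j

/-- The one-step-ahead predicted function `ψ_1(t; x) = E[ψ(e_{i+1} + t) | F_i = x]`, obtained by
integrating out the innovation `ε_{i+1}`, whose law is that of `ε_0`. -/
def psi1 (ψ : ℝ → ℝ) (G : (ℕ → ℝ) → ℝ) (ε : ℤ → Ω → ℝ) (P : Measure Ω) (t : ℝ)
    (x : ℕ → ℝ) : ℝ :=
  ∫ u, ψ (G (append u x) + t) ∂(P.map (ε 0))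

/-- The `l`-th derivative `ψ_1^{(l)}(t; x)` with respect to `t`. -/
def psi1Deriv (ψ : ℝ → ℝ) (G : (ℕ → ℝ) → ℝ) (ε : ℤ → Ω → ℝ) (P : Measure Ω) (l : ℕ)
    (t : ℝ) (x : ℕ → ℝ) : ℝ :=
  iteratedDeriv l (fun s => psi1 ψ G ε P s x) t

/-- `φ(t) = E ψ(e_1 + t)`. -/
def phi (ψ : ℝ → ℝ) (G : (ℕ → ℝ) → ℝ) (ε : ℤ → Ω → ℝ) (P : Measure Ω) (t : ℝ) : ℝ :=
  ∫ ω, ψ (err G ε 1 ω + t) ∂P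

/-- `m(t) = ‖ψ(e_1 + t) - ψ(e_1)‖`, the norm of `L²`, with value `∞` when the difference is not
square integrable. -/
def mFun (ψ : ℝ → ℝ) (G : (ℕ → ℝ) → ℝ) (ε : ℤ → Ω → ℝ) (P : Measure Ω) (t : ℝ) : ℝ≥0∞ :=
  eLpNorm (fun ω => ψ (err G ε 1 ω + t) - ψ (err G ε 1 ω)) 2 P

/-- `ψ` is a derivative of the convex function `ρ`: a selection of its subgradients, which is `ρ'`
wherever `ρ` is differentiable. -/
def IsSubgradient (ρ ψ : ℝ → ℝ) : Prop := ∀ x y, ρ x + ψ x * (y - x) ≤ ρ y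

/-- (A1): `ρ` is convex, `E ψ(e_1) = 0`, and `‖ψ(e_1)‖` is finite and positive. -/
structure A1 (ρ ψ : ℝ → ℝ) (G : (ℕ → ℝ) → ℝ) (ε : ℤ → Ω → ℝ) (P : Measure Ω) : Prop where
  convex : ConvexOn ℝ Set.univ ρ
  memLp : MemLp (fun ω => ψ (err G ε 1 ω)) 2 P
  mean_zero : ∫ ω, ψ (err G ε 1 ω) ∂P = 0
  norm_pos : 0 < eLpNorm (fun ω => ψ (err G ε 1 ω)) 2 P

/-- (A2): `φ` has a strictly positive derivative at `0`. -/
def A2 (ψ : ℝ → ℝ) (G : (ℕ → ℝ) → ℝ) (ε : ℤ → Ω → ℝ) (P : Measure Ω) : Prop :=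
  ∃ d : ℝ, 0 < d ∧ HasDerivAt (phi ψ G ε P) d 0

/-- (A3): `m` is continuous at `0`; as `m(0) = 0`, it is in particular finite near `0`. -/
def A3 (ψ : ℝ → ℝ) (G : (ℕ → ℝ) → ℝ) (ε : ℤ → Ω → ℝ) (P : Measure Ω) : Prop :=
  ContinuousAt (mFun ψ G ε P) 0

/-- The local Lipschitz constant of `ψ_1(·; x)` on `[-ε₀, ε₀]`. -/
def lipConst (ψ : ℝ → ℝ) (G : (ℕ → ℝ) → ℝ) (ε : ℤ → Ω → ℝ) (P : Measure Ω) (ε₀ : ℝ)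
    (x : ℕ → ℝ) : ℝ≥0∞ :=
  ⨆ (s : ℝ) (t : ℝ) (_ : |s| ≤ ε₀ ∧ |t| ≤ ε₀ ∧ s ≠ t),
    ENNReal.ofReal (|psi1 ψ G ε P s x - psi1 ψ G ε P t x| / |s - t|)

/-- (A5): for some `ε₀ > 0` the Lipschitz constants `L_i` of `ψ_1(·; F_i)` on `[-ε₀, ε₀]` are
in `L¹`. -/
def A5 (ψ : ℝ → ℝ) (G : (ℕ → ℝ) → ℝ) (ε : ℤ → Ω → ℝ) (P : Measure Ω) : Prop :=
  ∃ ε₀ : ℝ, 0 < ε₀ ∧ ∀ i : ℕ,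
    AEMeasurable (fun ω => lipConst ψ G ε P ε₀ (shift ε i ω)) P ∧
    ∫⁻ ω, lipConst ψ G ε P ε₀ (shift ε i ω) ∂P < ∞

/-- (A6) of order `l`: for some `ε₀ > 0`, `ψ_1(·; F_i)` is almost surely `C^l` around `[-ε₀, ε₀]`,
its `l`-th derivative is bounded in `L²` there, and
`∑_{i ≥ 0} sup_{|t| ≤ ε₀} ‖E[ψ_1^{(l)}(t; F_i) | F_0] - E[ψ_1^{(l)}(t; F_i^*) | F_0^*]‖ < ∞`. -/
def A6 (ψ : ℝ → ℝ) (G : (ℕ → ℝ) → ℝ) (ε ε' : ℤ → Ω → ℝ) (P : Measure Ω) (l : ℕ) : Prop :=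
  ∃ ε₀ : ℝ, 0 < ε₀ ∧
    (∀ i : ℕ, ∀ᵐ ω ∂P, ∀ t : ℝ, |t| ≤ ε₀ →
      ContDiffAt ℝ l (fun s => psi1 ψ G ε P s (shift ε i ω)) t) ∧
    (∀ i : ℕ, (⨆ (t : ℝ) (_ : |t| ≤ ε₀),
      eLpNorm (fun ω => psi1Deriv ψ G ε P l t (shift ε i ω)) 2 P) < ∞) ∧
    (∑' i : ℕ, (⨆ (t : ℝ) (_ : |t| ≤ ε₀),
      eLpNorm
        (P[fun ω => psi1Deriv ψ G ε P l t (shift ε i ω) |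
            MeasurableSpace.comap (shift ε 0) inferInstance] -
          P[fun ω => psi1Deriv ψ G ε P l t (shiftStar ε ε' i ω) |
            MeasurableSpace.comap (shiftStar ε ε' 0) inferInstance]) 2 P)) < ∞

end Errors

section Design

variable {p : ℕ}

/-- `Σ_n = ∑_{i=1}^n x_i x_i'`. -/
def gram (x : ℕ → EuclideanSpace ℝ (Fin p)) (n : ℕ) : Matrix (Fin p) (Fin p) ℝ :=
  ∑ i ∈ Finset.Icc 1 n, Matrix.vecMulVec (x i) (x i)

/-- `z_{i,n} = Σ_n^{-1/2} x_i`. -/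
def zvec (x : ℕ → EuclideanSpace ℝ (Fin p)) (n i : ℕ) : EuclideanSpace ℝ (Fin p) :=
  WithLp.toLp 2 (Matrix.mulVec (CFC.sqrt (gram x n))⁻¹ (x i))

/-- `r_n = max_{i ≤ n} |z_{i,n}|`. -/
def rmax (x : ℕ → EuclideanSpace ℝ (Fin p)) (n : ℕ) : ℝ :=
  ((Finset.Icc 1 n).sup (fun i => ‖zvec x n i‖₊) : ℝ≥0)

/-- (A4): `r_n → 0`. -/
def A4 (x : ℕ → EuclideanSpace ℝ (Fin p)) : Prop := Tendsto (rmax x) atTop (𝓝 0)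

/-- `ζ_n(q) = ∑_{i=1}^n |z_{i,n}|^q`. -/
def zeta (x : ℕ → EuclideanSpace ℝ (Fin p)) (n : ℕ) (q : ℝ) : ℝ :=
  ∑ i ∈ Finset.Icc 1 n, ‖zvec x n i‖ ^ q

end Design

section MProc

variable {Ω : Type*} [MeasurableSpace Ω] {p : ℕ}

/-- `τ_n(δ) = ∑_{i=1}^n |z_{i,n}|² [m²(|z_{i,n}| δ) + m²(-|z_{i,n}| δ)]`. -/
def tau (ψ : ℝ → ℝ) (G : (ℕ → ℝ) → ℝ) (ε : ℤ → Ω → ℝ) (P : Measure Ω)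
    (x : ℕ → EuclideanSpace ℝ (Fin p)) (n : ℕ) (δ : ℝ) : ℝ :=
  ∑ i ∈ Finset.Icc 1 n, ‖zvec x n i‖ ^ 2 *
    ((mFun ψ G ε P (‖zvec x n i‖ * δ)).toReal ^ 2 +
      (mFun ψ G ε P (-(‖zvec x n i‖ * δ))).toReal ^ 2)

/-- `Ω_n(θ) = ∑_{i=1}^n ψ(e_i - z_{i,n}' θ) z_{i,n}`. -/
def score (ψ : ℝ → ℝ) (G : (ℕ → ℝ) → ℝ) (ε : ℤ → Ω → ℝ)
    (x : ℕ → EuclideanSpace ℝ (Fin p)) (n : ℕ) (θ : EuclideanSpace ℝ (Fin p)) (ω : Ω) :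
    EuclideanSpace ℝ (Fin p) :=
  ∑ i ∈ Finset.Icc 1 n, ψ (err G ε i ω - inner ℝ (zvec x n i) θ) • zvec x n i

/-- The `M`-process `K_n(θ) = Ω_n(θ) - E Ω_n(θ)`. -/
def Kn (ψ : ℝ → ℝ) (G : (ℕ → ℝ) → ℝ) (ε : ℤ → Ω → ℝ) (P : Measure Ω)
    (x : ℕ → EuclideanSpace ℝ (Fin p)) (n : ℕ) (θ : EuclideanSpace ℝ (Fin p)) (ω : Ω) :
    EuclideanSpace ℝ (Fin p) :=
  score ψ G ε x n θ ω - ∫ ω', score ψ G ε x n θ ω' ∂P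

/-- `X_n = O_P(d_n)` for `[0, ∞]`-valued `X_n`. -/
def IsBigOP (P : Measure Ω) (X : ℕ → Ω → ℝ≥0∞) (d : ℕ → ℝ) : Prop :=
  ∀ η : ℝ, 0 < η → ∃ C : ℝ, 0 < C ∧
    ∀ᶠ n in atTop, P {ω | ENNReal.ofReal (C * d n) < X n ω} ≤ ENNReal.ofReal η

end MProc

end MReg

end

/-! Condition each summand one step back. Let `resid` be ψ(e_{i+1} + t) - ψ(e_{i+1}) minus its
prediction from F_i, and `centered` (at order 0) be ψ_1(t; F_i) minus its mean. At t = -z'θ, every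
coordinate of K_n(θ) - K_n(0) is a weighted sum of `resid` terms plus a weighted sum of increments
of `centered` (`IsIIDPair.Kn_sub_apply`). The two sums are responsible for √(τ_n log n) and δ_n
√ζ_n(4) respectively.

Martingale part. For a single θ, an exponential supermartingale exp(λM - λ²V) gives a Freedman-type
bound, after truncating where a common envelope exceeds a level of order √(τ_n / log n). On the
event that the squares of the envelope, realised and predicted, add up to O(τ_n), a deviation of
order √(τ_n log n) has probability at most of order n^{-(p+1)}. This survives a union bound over a
grid of O(n^p) points (`IsIIDPair.measure_exists_abs_compSum_gt_le`). Between grid points ψ is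
monotone, so sums with nonnegative weights are bracketed by sums at modified grid values. The
bracketing gap only involves increments of ψ_1, hence is of order (δ_n/n) ∑ |z_i|² L_i = O_P(δ_n/n),
because ∑ |z_i|² = p. Cauchy–Schwarz gives ζ_n(4) ≥ p²/n, which absorbs this error.

Predictable part. Here ψ_1 is smooth and no grid is needed. The increment over a cube is an iterated
integral of mixed partial derivatives, each coordinate of θ being differentiated at most once;
integrating absolute values over the full range bounds the supremum over θ
(`enorm_sum_sub_le_oscBound`). Expectations of these integrands are controlled by
`IsIIDPair.lintegral_sum_centered_le`: the L¹ norm of ∑ a_i (h_i(F_i) - E h_i) is at most a constant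
times √∑ a_i². To see this, split h_i(F_i) into differences of its conditional expectations on
F_{i-m} and F_{i-m-1}; for fixed m these are orthogonal in i, and their norms are summable in m by
(A6) and `IsIIDPair.projNorm_le`. A derivative contributes a factor |z_i| and an integration a
factor δ_n. Since δ_n |z_i| ≤ 1 eventually, all orders are dominated by the first, which is δ_n √∑
|z_i|⁴. -/

set_option linter.unusedSectionVars false

namespace MReg

/-! ### Independence of subfamilies with disjoint index sets -/

section Independence

variable {Ω : Type*} [MeasurableSpace Ω] {P : Measure Ω}

theorem comap_pi_le_iSup {ι α : Type*} (X : ι → Ω → ℝ) (f : α → ι) :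
    MeasurableSpace.comap (fun ω a => X (f a) ω) inferInstance ≤
      ⨆ i ∈ Set.range f, MeasurableSpace.comap (X i) inferInstance := by
  have h : Measurable[⨆ i ∈ Set.range f, MeasurableSpace.comap (X i) inferInstance]
      (fun ω a => X (f a) ω) := by
    refine @measurable_pi_lambda _ _ _ (_) _ _ fun a => ?_
    have h1 : MeasurableSpace.comap (X (f a)) inferInstance ≤
        ⨆ i ∈ Set.range f, MeasurableSpace.comap (X i) inferInstance :=
      le_iSup₂_of_le (f := fun i (_ : i ∈ Set.range f) =>
        MeasurableSpace.comap (X i) inferInstance) (f a) ⟨a, rfl⟩ le_rfl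
    exact (comap_measurable (X (f a))).mono h1 le_rfl
  exact h.comap_le

theorem indepFun_reindex {ι α β : Type*} {X : ι → Ω → ℝ} (hX : ∀ i, Measurable (X i))
    (h : iIndepFun X P) (f : α → ι) (g : β → ι) (hfg : ∀ a b, f a ≠ g b) :
    IndepFun (fun ω a => X (f a) ω) (fun ω b => X (g b) ω) P := by
  have hd : Disjoint (Set.range f) (Set.range g) := by
    rw [Set.disjoint_left]
    rintro _ ⟨a, rfl⟩ ⟨b, hb⟩
    exact hfg a b hb.symm
  have h1 := indep_iSup_of_disjoint (fun i => (hX i).comap_le) h hd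
  exact indep_of_indep_of_le_left (indep_of_indep_of_le_right h1 (comap_pi_le_iSup X g))
    (comap_pi_le_iSup X f)

theorem indepFun_single_reindex {ι β : Type*} {X : ι → Ω → ℝ} (hX : ∀ i, Measurable (X i))
    (h : iIndepFun X P) (i : ι) (g : β → ι) (hfg : ∀ b, i ≠ g b) :
    IndepFun (X i) (fun ω b => X (g b) ω) P :=
  (indepFun_reindex hX h (fun _ : Unit => i) g fun _ b => hfg b).comp
    (φ := fun x : Unit → ℝ => x ()) (ψ := fun y => y) (measurable_pi_apply ()) measurable_id

end Independence

/-! ### One-sided pasts, stationarity, and integrating out one innovation -/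

/-- The law of one innovation. -/
noncomputable abbrev innov {Ω : Type*} [MeasurableSpace Ω] (ε : ℤ → Ω → ℝ) (P : Measure Ω) : Measure ℝ :=
  P.map (ε 0)

/-- The law of the one-sided sequence of innovations. -/
noncomputable abbrev past {Ω : Type*} [MeasurableSpace Ω] (ε : ℤ → Ω → ℝ) (P : Measure Ω) :
    Measure (ℕ → ℝ) := P.map (shift ε 0)

/-- Forgetting the `m` most recent coordinates. -/
def drop (m : ℕ) (x : ℕ → ℝ) : ℕ → ℝ := fun j => x (j + m)

theorem measurable_drop (m : ℕ) : Measurable (drop m) :=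
  measurable_pi_lambda _ fun j => measurable_pi_apply (j + m)

theorem measurable_append : Measurable (fun q : ℝ × (ℕ → ℝ) => append q.1 q.2) := by
  refine measurable_pi_lambda _ fun j => ?_
  cases j with
  | zero => exact measurable_fst
  | succ j => exact (measurable_pi_apply j).comp measurable_snd

section Shift

variable {Ω : Type*} [MeasurableSpace Ω] {P : Measure Ω} {ε ε' : ℤ → Ω → ℝ}

theorem drop_shift (m : ℕ) (k : ℤ) (ω : Ω) : drop m (shift ε k ω) = shift ε (k - m) ω := by
  funext j
  simp only [drop, shift]
  congr 1
  push_cast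
  ring

theorem append_shift (k : ℤ) (ω : Ω) : append (ε (k + 1) ω) (shift ε k ω) = shift ε (k + 1) ω := by
  funext j
  cases j with
  | zero => simp [append, shift]
  | succ j =>
    simp only [append, shift]
    congr 1
    push_cast
    ring

theorem append_shiftStar (ω : Ω) : append (ε' 0 ω) (shift ε (-1) ω) = shiftStar ε ε' 0 ω := by
  funext j
  cases j with
  | zero => simp [append, shiftStar]
  | succ j =>
    have : ¬ ((0 : ℤ) - ((j + 1 : ℕ) : ℤ) = 0) := by push_cast; omega
    simp only [append, shift, shiftStar, this, if_false]
    congr 1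
    push_cast
    ring

namespace IsIIDPair

theorem measurable_left (h : IsIIDPair ε ε' P) (k : ℤ) : Measurable (ε k) := h.measurable (Sum.inl k)

theorem measurable_right (h : IsIIDPair ε ε' P) (k : ℤ) : Measurable (ε' k) :=
  h.measurable (Sum.inr k)

theorem measurable_shift (h : IsIIDPair ε ε' P) (k : ℤ) : Measurable (shift ε k) :=
  measurable_pi_lambda _ fun _ => h.measurable_left _

theorem map_left (h : IsIIDPair ε ε' P) (k : ℤ) : P.map (ε k) = innov ε P :=
  (h.ident (Sum.inl k)).map_eq

theorem map_right (h : IsIIDPair ε ε' P) (k : ℤ) : P.map (ε' k) = innov ε P :=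
  (h.ident (Sum.inr k)).map_eq

/-- The right side is free of k, which is the stationarity used throughout; the product form itself
is what the tail argument needs. -/
theorem map_shift_eq_infinitePi (h : IsIIDPair ε ε' P) (k : ℤ) :
    P.map (shift ε k) = Measure.infinitePi fun _ : ℕ => innov ε P := by
  have hinj : Function.Injective (fun j : ℕ => (Sum.inl (k - j) : ℤ ⊕ ℤ)) := by
    intro a b hab
    simp only [Sum.inl.injEq] at hab
    omega
  have h1 := h.indep.precomp hinj
  have h2 := h1.map_fun_eq_infinitePi_map (fun j => h.measurable _)
  have h3 : (fun j : ℕ => P.map (Sum.elim ε ε' (Sum.inl (k - j)))) = fun _ => innov ε P := by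
    funext j
    exact h.map_left _
  refine h2.trans ?_
  exact congrArg _ h3

theorem map_shift (h : IsIIDPair ε ε' P) (k : ℤ) : P.map (shift ε k) = past ε P := by
  rw [h.map_shift_eq_infinitePi, past, h.map_shift_eq_infinitePi]

theorem measurePreserving_shift (h : IsIIDPair ε ε' P) (k : ℤ) :
    MeasurePreserving (shift ε k) P (past ε P) := ⟨h.measurable_shift k, h.map_shift k⟩

theorem isProbabilityMeasure_innov [IsProbabilityMeasure P] (h : IsIIDPair ε ε' P) :
    IsProbabilityMeasure (innov ε P) :=
  Measure.isProbabilityMeasure_map (h.measurable_left 0).aemeasurable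

theorem isProbabilityMeasure_past [IsProbabilityMeasure P] (h : IsIIDPair ε ε' P) :
    IsProbabilityMeasure (past ε P) :=
  Measure.isProbabilityMeasure_map (h.measurable_shift 0).aemeasurable

theorem indepFun_left_shift (h : IsIIDPair ε ε' P) {j k : ℤ} (hjk : k < j) :
    IndepFun (ε j) (shift ε k) P :=
  indepFun_single_reindex h.measurable h.indep (Sum.inl j) (fun i : ℕ => Sum.inl (k - i)) (by
    intro b hb
    simp only [Sum.inl.injEq] at hb
    omega)

theorem indepFun_right_shift (h : IsIIDPair ε ε' P) (j k : ℤ) :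
    IndepFun (ε' j) (shift ε k) P :=
  indepFun_single_reindex h.measurable h.indep (Sum.inr j) (fun i : ℕ => Sum.inl (k - i)) (by
    simp)

theorem map_prod_shift [IsProbabilityMeasure P] (h : IsIIDPair ε ε' P) (k : ℤ) :
    P.map (fun ω => (ε (k + 1) ω, shift ε k ω)) = (innov ε P).prod (past ε P) := by
  rw [(h.indepFun_left_shift (by omega)).map_prod_eq_prod_map_map
    (h.measurable_left _).aemeasurable (h.measurable_shift _).aemeasurable, h.map_left,
    h.map_shift]

theorem map_prod_right_shift [IsProbabilityMeasure P] (h : IsIIDPair ε ε' P) (j k : ℤ) :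
    P.map (fun ω => (ε' j ω, shift ε k ω)) = (innov ε P).prod (past ε P) := by
  rw [(h.indepFun_right_shift j k).map_prod_eq_prod_map_map
    (h.measurable_right _).aemeasurable (h.measurable_shift _).aemeasurable, h.map_right,
    h.map_shift]

/-- Integrating out the newest innovation. -/
theorem lintegral_prod_shift [IsProbabilityMeasure P] (h : IsIIDPair ε ε' P) (k : ℤ)
    {f : ℝ × (ℕ → ℝ) → ℝ≥0∞} (hf : Measurable f) :
    ∫⁻ ω, f (ε (k + 1) ω, shift ε k ω) ∂P =
      ∫⁻ ω, ∫⁻ u, f (u, shift ε k ω) ∂(innov ε P) ∂P := by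
  have := h.isProbabilityMeasure_innov
  have := h.isProbabilityMeasure_past
  have hm : Measurable (fun ω => (ε (k + 1) ω, shift ε k ω)) :=
    (h.measurable_left _).prodMk (h.measurable_shift _)
  rw [← lintegral_map hf hm, h.map_prod_shift, lintegral_prod_symm' _ hf, ← h.map_shift k,
    lintegral_map hf.lintegral_prod_left' (h.measurable_shift k)]

theorem lintegral_shift_succ [IsProbabilityMeasure P] (h : IsIIDPair ε ε' P) (k : ℤ)
    {f : (ℕ → ℝ) → ℝ≥0∞} (hf : Measurable f) :
    ∫⁻ ω, f (shift ε (k + 1) ω) ∂P =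
      ∫⁻ ω, ∫⁻ u, f (append u (shift ε k ω)) ∂(innov ε P) ∂P := by
  have h1 := h.lintegral_prod_shift k (hf.comp measurable_append)
  simp only [Function.comp, append_shift] at h1
  exact h1

end IsIIDPair

end Shift

section Subgradient

variable {ρ ψ : ℝ → ℝ}

/-- Add the subgradient inequalities at a and at b. Monotonicity is all that the later arguments
take from ρ; it also makes ψ measurable. -/
theorem IsSubgradient.monotone (h : IsSubgradient ρ ψ) : Monotone ψ := by
  intro a b hab
  rcases hab.eq_or_lt with rfl | hlt
  · exact le_rfl
  · have h1 := h a b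
    have h2 := h b a
    nlinarith

end Subgradient

/-! ### Conditional expectations and orthogonality in L² -/

section CondExp

variable {Ω : Type*} {mΩ : MeasurableSpace Ω} {P : Measure Ω}

theorem eLpNorm_two_sq (f : Ω → ℝ) : eLpNorm f 2 P ^ 2 = ∫⁻ ω, ‖f ω‖ₑ ^ 2 ∂P := by
  have h := eLpNorm_nnreal_pow_eq_lintegral (f := f) (μ := P) (p := 2) two_ne_zero
  simpa using h

theorem enorm_sq_eq_ofReal (x : ℝ) : ‖x‖ₑ ^ 2 = ENNReal.ofReal (x ^ 2) := by
  rw [Real.enorm_eq_ofReal_abs, ← ENNReal.ofReal_pow (abs_nonneg x), sq_abs]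

theorem eLpNorm_two_sq_eq_ofReal {f : Ω → ℝ} (hf : MemLp f 2 P) :
    eLpNorm f 2 P ^ 2 = ENNReal.ofReal (∫ ω, f ω ^ 2 ∂P) := by
  rw [eLpNorm_two_sq, ofReal_integral_eq_lintegral_ofReal hf.integrable_sq
    (Eventually.of_forall fun _ => sq_nonneg _)]
  simp_rw [enorm_sq_eq_ofReal]

/-- Set integrals over preimages agree with those downstairs. This lets projections be estimated on
sequence space and transported along `shift ε k`. -/
theorem condExp_comp_measurePreserving {S : Type*} {m mS : MeasurableSpace S} {ν : Measure S}
    [IsProbabilityMeasure P] [IsProbabilityMeasure ν] {f : Ω → S} (hf : MeasurePreserving f P ν)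
    (hm : m ≤ mS) {h : S → ℝ} (hh : Integrable h ν) :
    P[h ∘ f | m.comap f] =ᵐ[P] ν[h | m] ∘ f := by
  have hle : m.comap f ≤ mΩ := (MeasurableSpace.comap_mono hm).trans hf.measurable.comap_le
  have hc : Integrable (ν[h | m] ∘ f) P := hf.integrable_comp_of_integrable integrable_condExp
  refine (ae_eq_condExp_of_forall_setIntegral_eq hle (hf.integrable_comp_of_integrable hh)
    (fun _ _ _ => hc.integrableOn) ?_ ?_).symm
  · rintro _ ⟨t, ht, rfl⟩ -
    have h1 : ∀ g : S → ℝ, Integrable g ν →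
        ∫ x in f ⁻¹' t, (g ∘ f) x ∂P = ∫ y in t, g y ∂ν := by
      intro g hg
      have := hg.aestronglyMeasurable
      rw [← hf.map_eq] at this ⊢
      exact (setIntegral_map (hm _ ht) this hf.measurable.aemeasurable).symm
    rw [h1 _ integrable_condExp, h1 _ hh, setIntegral_condExp hm hh ht]
  · exact (stronglyMeasurable_condExp.comp_measurable
      (comap_measurable f)).aestronglyMeasurable

/-- Conditioning on a variable that is independent of the one to be integrated out. -/
theorem condExp_prod_of_map_eq_prod {S T : Type*} [MeasurableSpace S] [MeasurableSpace T]
    [IsProbabilityMeasure P] {μ : Measure T} {ν : Measure S} [IsProbabilityMeasure μ]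
    [IsProbabilityMeasure ν] {U : Ω → T} {X : Ω → S} (hU : Measurable U) (hX : Measurable X)
    (hmap : P.map (fun ω => (U ω, X ω)) = μ.prod ν) {f : T × S → ℝ} (hf : StronglyMeasurable f)
    (hint : Integrable (fun ω => f (U ω, X ω)) P) :
    P[fun ω => f (U ω, X ω) | MeasurableSpace.comap X inferInstance] =ᵐ[P]
      fun ω => ∫ u, f (u, X ω) ∂μ := by
  have hUX : Measurable fun ω => (U ω, X ω) := hU.prodMk hX
  have hfp : Integrable f (μ.prod ν) := by
    rw [← hmap]
    exact (integrable_map_measure (hf.aestronglyMeasurable) hUX.aemeasurable).2 hint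
  have hXm : P.map X = ν := by
    have : P.map X = (P.map (fun ω => (U ω, X ω))).map Prod.snd := by
      rw [Measure.map_map measurable_snd hUX]; rfl
    rw [this, hmap, Measure.map_snd_prod]; simp
  have hκ : StronglyMeasurable fun x => ∫ u, f (u, x) ∂μ :=
    hf.integral_prod_left'
  have hκi : Integrable (fun ω => ∫ u, f (u, X ω) ∂μ) P := by
    have := hfp.integral_prod_right
    rw [← hXm] at this
    exact (integrable_map_measure hκ.aestronglyMeasurable hX.aemeasurable).1 this
  refine (ae_eq_condExp_of_forall_setIntegral_eq hX.comap_le hint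
    (fun _ _ _ => hκi.integrableOn) ?_ ?_).symm
  · rintro _ ⟨t, ht, rfl⟩ -
    have e1 : ∫ ω in X ⁻¹' t, (∫ u, f (u, X ω) ∂μ) ∂P = ∫ x in t, ∫ u, f (u, x) ∂μ ∂ν := by
      rw [← hXm, setIntegral_map ht hκ.aestronglyMeasurable hX.aemeasurable]
    have e2 : ∫ ω in X ⁻¹' t, f (U ω, X ω) ∂P = ∫ q in Set.univ ×ˢ t, f q ∂(μ.prod ν) := by
      rw [← hmap, setIntegral_map (MeasurableSet.univ.prod ht) hf.aestronglyMeasurable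
        hUX.aemeasurable]
      congr 2
      ext ω
      simp
    rw [e1, e2, ← Measure.prod_restrict, Measure.restrict_univ, integral_prod_symm]
    have := hfp.integrableOn (s := Set.univ ×ˢ t)
    rwa [IntegrableOn, ← Measure.prod_restrict, Measure.restrict_univ] at this
  · exact (hκ.comp_measurable (comap_measurable X)).aestronglyMeasurable

theorem integral_mul_eq_zero_of_condExp_eq_zero [IsProbabilityMeasure P] {m : MeasurableSpace Ω}
    (hm : m ≤ mΩ) {f g : Ω → ℝ} (hf : MemLp f 2 P) (hg : MemLp g 2 P)
    (hfm : StronglyMeasurable[m] f) (h0 : P[g | m] =ᵐ[P] 0) : ∫ ω, f ω * g ω ∂P = 0 := by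
  have hfg : Integrable (f * g) P := hf.integrable_mul hg
  have h1 := condExp_mul_of_stronglyMeasurable_left hfm hfg (hg.integrable one_le_two)
  have h2 : P[f * g | m] =ᵐ[P] 0 := by
    filter_upwards [h1, h0] with ω a b
    rw [a, Pi.mul_apply, b]; simp
  calc ∫ ω, f ω * g ω ∂P = ∫ ω, (P[f * g | m]) ω ∂P := (integral_condExp hm).symm
    _ = 0 := by rw [integral_congr_ae h2]; simp

/-- Pythagoras for martingale differences. -/
theorem eLpNorm_sum_martingaleDiff_sq [IsProbabilityMeasure P] {m : ℕ → MeasurableSpace Ω}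
    (hm : ∀ i, m i ≤ mΩ) (hmono : Monotone m) {Q : ℕ → Ω → ℝ} (hQ : ∀ i, MemLp (Q i) 2 P)
    (hQm : ∀ i, StronglyMeasurable[m (i + 1)] (Q i)) (h0 : ∀ i, P[Q i | m i] =ᵐ[P] 0) (n : ℕ) :
    eLpNorm (fun ω => ∑ i ∈ Finset.range n, Q i ω) 2 P ^ 2 =
      ∑ i ∈ Finset.range n, eLpNorm (Q i) 2 P ^ 2 := by
  have hS : ∀ n, MemLp (fun ω => ∑ i ∈ Finset.range n, Q i ω) 2 P := fun n =>
    memLp_finsetSum _ fun i _ => hQ i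
  have hSm : ∀ n, StronglyMeasurable[m n] (fun ω => ∑ i ∈ Finset.range n, Q i ω) := fun n =>
    Finset.stronglyMeasurable_fun_sum _ fun i hi =>
      (hQm i).mono (hmono (Finset.mem_range.1 hi))
  induction n with
  | zero => simp
  | succ n ih =>
    rw [Finset.sum_range_succ, ← ih, eLpNorm_two_sq_eq_ofReal (hS (n + 1)),
      eLpNorm_two_sq_eq_ofReal (hS n), eLpNorm_two_sq_eq_ofReal (hQ n),
      ← ENNReal.ofReal_add (integral_nonneg fun _ => sq_nonneg _)
        (integral_nonneg fun _ => sq_nonneg _)]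
    congr 1
    -- The cross term vanishes: the partial sum is known at time `n`, where `Q n` has conditional
    -- mean zero.
    have hx := integral_mul_eq_zero_of_condExp_eq_zero (hm n) (hS n) (hQ n) (hSm n) (h0 n)
    have hxi : Integrable (fun ω => (∑ i ∈ Finset.range n, Q i ω) * Q n ω) P :=
      (hS n).integrable_mul (hQ n)
    have e : ∀ ω, (∑ i ∈ Finset.range (n + 1), Q i ω) ^ 2 =
        (∑ i ∈ Finset.range n, Q i ω) ^ 2 + Q n ω ^ 2 +
          2 * ((∑ i ∈ Finset.range n, Q i ω) * Q n ω) := by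
      intro ω
      rw [Finset.sum_range_succ]; ring
    simp_rw [e]
    have i1 : Integrable (fun ω => (∑ i ∈ Finset.range n, Q i ω) ^ 2 + Q n ω ^ 2) P :=
      (hS n).integrable_sq.add (hQ n).integrable_sq
    rw [integral_add i1 (hxi.const_mul 2), integral_add (hS n).integrable_sq (hQ n).integrable_sq, integral_const_mul, hx]
    ring

end CondExp

/-! ### Triviality of the remote past in L¹ -/

section Tail

/-- An L¹ form of the zero–one law. By Lévy's upward theorem `h` is L¹-close to its conditional
expectation on finitely many recent coordinates. That approximation is independent of the
coordinates beyond, so conditioning it on them leaves a constant. -/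
theorem tendsto_condExp_drop {μ : Measure ℝ} [IsProbabilityMeasure μ] {h : (ℕ → ℝ) → ℝ}
    (hm : Measurable h) (hi : Integrable h (Measure.infinitePi fun _ : ℕ => μ)) :
    Tendsto (fun M => eLpNorm ((Measure.infinitePi fun _ : ℕ => μ)[h |
      MeasurableSpace.comap (drop M) inferInstance] -
        fun _ => ∫ x, h x ∂(Measure.infinitePi fun _ : ℕ => μ)) 1
          (Measure.infinitePi fun _ : ℕ => μ)) atTop (𝓝 0) := by
  set ν : Measure (ℕ → ℝ) := Measure.infinitePi fun _ : ℕ => μ with hν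
  have hind : iIndepFun (fun (i : ℕ) (x : ℕ → ℝ) => x i) ν :=
    iIndepFun_infinitePi (X := fun (_ : ℕ) (x : ℝ) => x) (fun _ => measurable_id)
  let E : Filtration ℕ (inferInstance : MeasurableSpace (ℕ → ℝ)) :=
    Filtration.piLE (X := fun _ : ℕ => ℝ)
  have hsup : (⨆ n, E n) = (inferInstance : MeasurableSpace (ℕ → ℝ)) := by
    refine le_antisymm (iSup_le fun n => E.le n) ?_
    have : Measurable[⨆ n, E n] (fun x : ℕ → ℝ => x) := by
      refine @measurable_pi_lambda _ _ _ (_) _ _ fun j => ?_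
      have h1 : Measurable[E j] (fun x : ℕ → ℝ => x j) := by
        have h2 : (fun x : ℕ → ℝ => x j) =
            (fun y : (Set.Iic j → ℝ) => y ⟨j, le_refl j⟩) ∘ (Preorder.restrictLe j) := rfl
        rw [h2]
        exact (measurable_pi_apply _).comp (comap_measurable _)
      exact h1.mono (le_iSup E j) le_rfl
    exact (MeasurableSpace.comap_id (m := MeasurableSpace.pi)).symm.trans_le this.comap_le
  have hlev := hi.tendsto_eLpNorm_condExp (ℱ := E) (by
    rw [hsup]; exact hm.stronglyMeasurable)
  have hindep : ∀ N M, N < M → Indep (E N) (MeasurableSpace.comap (drop M) inferInstance) ν := by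
    intro N M hNM
    exact indepFun_reindex (fun i => measurable_pi_apply i) hind
      (fun a : Set.Iic N => (a : ℕ)) (fun j : ℕ => j + M) (by
        rintro ⟨a, ha⟩ b hab
        simp only [Set.mem_Iic] at ha
        simp only at hab
        omega)
  rw [ENNReal.tendsto_atTop_zero] at hlev ⊢
  intro η hη
  obtain ⟨N, hN⟩ := hlev (η / 2) (ENNReal.half_pos hη.ne')
  have hN := hN N le_rfl
  -- `E N` involves the coordinates up to and including `N`, and `drop M` those from `M` on, so `M >
  -- N` is needed.
  refine ⟨N + 1, fun M hM => ?_⟩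
  let D : MeasurableSpace (ℕ → ℝ) := MeasurableSpace.comap (drop M) inferInstance
  have hDle : D ≤ MeasurableSpace.pi := (measurable_drop M).comap_le
  have : IsProbabilityMeasure ν := by rw [hν]; infer_instance
  set f := ν[h | E N] with hf
  have h1 : ν[f | D] =ᵐ[ν] fun _ => ∫ x, f x ∂ν :=
    condExp_indep_eq (E.le N) hDle stronglyMeasurable_condExp (hindep N M (by omega))
  have h2 : ∫ x, f x ∂ν = ∫ x, h x ∂ν := integral_condExp (E.le N)
  have h3 : ν[f - h | D] =ᵐ[ν] ν[f | D] - ν[h | D] := condExp_sub integrable_condExp hi D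
  have h4 : (ν[h | D] - fun _ => ∫ x, h x ∂ν) =ᵐ[ν] -ν[f - h | D] := by
    filter_upwards [h1, h3] with x a b
    simp only [Pi.sub_apply, Pi.neg_apply, b, a, h2]
    ring
  rw [eLpNorm_congr_ae h4, eLpNorm_neg]
  calc _ ≤ eLpNorm (f - h) 1 ν := eLpNorm_condExp_le_eLpNorm _ le_rfl
    _ ≤ η / 2 := hN
    _ ≤ η := ENNReal.half_le_self

end Tail

/-! ### Projection decomposition of weighted sums of functionals of the past -/

/-- The `σ`-algebra of events that do not depend on the `m` most recent coordinates. -/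
@[reducible] def remote (m : ℕ) : MeasurableSpace (ℕ → ℝ) :=
  MeasurableSpace.comap (drop m) inferInstance

theorem remote_le (m : ℕ) : remote m ≤ MeasurableSpace.pi := (measurable_drop m).comap_le

theorem drop_add (m k : ℕ) (x : ℕ → ℝ) : drop m (drop k x) = drop (m + k) x := by
  funext j
  simp only [drop]
  congr 1
  ring

theorem remote_antitone : Antitone remote := by
  intro a b hab
  obtain ⟨c, rfl⟩ := Nat.exists_eq_add_of_le hab
  have : drop (a + c) = drop c ∘ drop a := by
    funext x
    rw [Function.comp_apply, drop_add, add_comm]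
  rw [remote, remote, this, ← MeasurableSpace.comap_comp]
  exact MeasurableSpace.comap_mono (measurable_drop c).comap_le

theorem remote_zero : remote 0 = MeasurableSpace.pi := by
  have : drop 0 = fun x => x := by funext x; funext j; simp [drop]
  rw [remote, this]
  exact MeasurableSpace.comap_id

section Projection

variable {Ω : Type*} [MeasurableSpace Ω] {P : Measure Ω} {ε ε' : ℤ → Ω → ℝ}

theorem comap_remote_shift (k : ℤ) (m : ℕ) : (remote m).comap (shift ε k) =
    MeasurableSpace.comap (shift ε (k - m)) inferInstance := by
  rw [remote, MeasurableSpace.comap_comp]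
  congr 1
  funext ω
  exact drop_shift m k ω

/-- The norm of the `m`-th projection of a functional of the past. -/
noncomputable def projNorm (ε : ℤ → Ω → ℝ) (P : Measure Ω) (h : (ℕ → ℝ) → ℝ) (m : ℕ) : ℝ≥0∞ :=
  eLpNorm ((past ε P)[h | remote m] - (past ε P)[h | remote (m + 1)]) 2 (past ε P)

theorem IsIIDPair.lintegral_shift_comp (hε : IsIIDPair ε ε' P) (k : ℤ) {f : (ℕ → ℝ) → ℝ≥0∞}
    (hf : AEMeasurable f (past ε P)) :
    ∫⁻ ω, f (shift ε k ω) ∂P = ∫⁻ x, f x ∂(past ε P) := by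
  rw [← hε.map_shift k] at hf ⊢
  exact (lintegral_map' hf (hε.measurable_shift k).aemeasurable).symm

theorem IsIIDPair.tendsto_condExp_remote [IsProbabilityMeasure P] (hε : IsIIDPair ε ε' P)
    {h : (ℕ → ℝ) → ℝ} (hm : Measurable h) (hi : Integrable h (past ε P)) :
    Tendsto (fun M => eLpNorm ((past ε P)[h | remote M] - fun _ => ∫ x, h x ∂(past ε P)) 1
      (past ε P)) atTop (𝓝 0) := by
  have := hε.isProbabilityMeasure_innov
  have e : past ε P = Measure.infinitePi fun _ : ℕ => innov ε P := hε.map_shift_eq_infinitePi 0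
  rw [e] at hi ⊢
  exact tendsto_condExp_drop hm hi

/-- At a fixed lag m the i-th summand is known at time i - m and centred given time i - m - 1. The
summands are thus martingale differences, and Pythagoras yields √∑ a_i² where the triangle
inequality would give ∑ |a_i|. -/
theorem IsIIDPair.eLpNorm_sum_projection_le [IsProbabilityMeasure P] (hε : IsIIDPair ε ε' P)
    (n m : ℕ) {h : ℕ → (ℕ → ℝ) → ℝ} (h2 : ∀ i, MemLp (h i) 2 (past ε P)) {θ : ℝ≥0∞}
    (hθ : ∀ i, projNorm ε P (h i) m ≤ θ) (a : ℕ → ℝ) :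
    eLpNorm (fun ω => ∑ i ∈ Finset.range n, a i *
      ((past ε P)[h i | remote m] - (past ε P)[h i | remote (m + 1)]) (shift ε i ω)) 2 P ≤
      θ * ENNReal.ofReal (√(∑ i ∈ Finset.range n, a i ^ 2)) := by
  have := hε.isProbabilityMeasure_past
  set q : ℕ → (ℕ → ℝ) → ℝ := fun i =>
    (past ε P)[h i | remote m] - (past ε P)[h i | remote (m + 1)] with hq
  have hq2 : ∀ i, MemLp (q i) 2 (past ε P) := fun i =>
    ((h2 i).condExp one_le_two).sub ((h2 i).condExp one_le_two)
  have hqm : ∀ i, StronglyMeasurable[remote m] (q i) := fun i =>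
    stronglyMeasurable_condExp.sub
      (stronglyMeasurable_condExp.mono (remote_antitone (Nat.le_succ m)))
  have hq0 : ∀ i, (past ε P)[q i | remote (m + 1)] =ᵐ[past ε P] 0 := by
    intro i
    have e1 := condExp_sub (μ := past ε P) (m := remote (m + 1))
      (integrable_condExp (μ := past ε P) (f := h i) (m := remote m))
      (integrable_condExp (μ := past ε P) (f := h i) (m := remote (m + 1)))
    have e2 : (past ε P)[(past ε P)[h i | remote m] | remote (m + 1)] =ᵐ[past ε P]
        (past ε P)[h i | remote (m + 1)] :=
      condExp_condExp_of_le (remote_antitone (Nat.le_succ m)) (remote_le m)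
    have e3 : (past ε P)[(past ε P)[h i | remote (m + 1)] | remote (m + 1)] =ᵐ[past ε P]
        (past ε P)[h i | remote (m + 1)] :=
      condExp_condExp_of_le le_rfl (remote_le (m + 1))
    filter_upwards [e1, e2, e3] with x b1 b2 b3
    rw [b1, Pi.sub_apply, b2, b3, sub_self]; rfl
  -- The offset m + 1 makes the i-th summand known at `F (i + 1)` and centred given `F i`.
  let F : ℕ → MeasurableSpace Ω := fun i =>
    MeasurableSpace.comap (shift ε ((i : ℤ) - (m + 1 : ℕ))) inferInstance
  have hF : ∀ i, F i = (remote (m + 1)).comap (shift ε i) := fun i =>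
    (comap_remote_shift _ _).symm
  have hF' : ∀ i, F (i + 1) = (remote m).comap (shift ε i) := by
    intro i
    rw [comap_remote_shift]
    simp only [F]
    congr 2
    push_cast
    ring
  have hpres := fun i : ℕ => hε.measurePreserving_shift (i : ℤ)
  have hmono : Monotone F := by
    refine monotone_nat_of_le_succ fun i => ?_
    rw [hF', hF]
    exact MeasurableSpace.comap_mono (remote_antitone (Nat.le_succ m))
  let Q : ℕ → Ω → ℝ := fun i => a i • (q i ∘ shift ε i)
  have hQ : ∀ i, MemLp (Q i) 2 P := fun i =>
    ((hq2 i).comp_measurePreserving (hpres i)).const_smul (a i)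
  have hpy := eLpNorm_sum_martingaleDiff_sq (P := P) (m := F)
    (fun i => (hε.measurable_shift _).comap_le) hmono hQ
    (fun i => by
      rw [hF']
      exact ((hqm i).comp_measurable (comap_measurable (shift ε i))).const_smul (a i))
    (fun i => by
      rw [hF]
      have e1 := condExp_comp_measurePreserving (hpres i) (remote_le (m + 1))
        ((hq2 i).integrable one_le_two)
      have e2 := condExp_smul (μ := P) (a i) (q i ∘ shift ε i)
        ((remote (m + 1)).comap (shift ε i))
      have e3 := (hpres i).quasiMeasurePreserving.ae_eq_comp (hq0 i)
      filter_upwards [e1, e2, e3] with ω b1 b2 b3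
      rw [b2, Pi.smul_apply, b1, b3]; simp) n
  have hbd : ∀ i, eLpNorm (Q i) 2 P ^ 2 ≤ θ ^ 2 * ENNReal.ofReal (a i ^ 2) := by
    intro i
    have : eLpNorm (Q i) 2 P = ‖a i‖ₑ * eLpNorm (q i) 2 (past ε P) := by
      rw [eLpNorm_const_smul, eLpNorm_comp_measurePreserving (hq2 i).1 (hpres i)]
    rw [this, mul_pow, mul_comm, enorm_sq_eq_ofReal]
    gcongr
    exact hθ i
  have hfin : eLpNorm (fun ω => ∑ i ∈ Finset.range n, Q i ω) 2 P ^ 2 ≤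
      (θ * ENNReal.ofReal (√(∑ i ∈ Finset.range n, a i ^ 2))) ^ 2 := by
    have hs : 0 ≤ ∑ i ∈ Finset.range n, a i ^ 2 := Finset.sum_nonneg fun i _ => sq_nonneg _
    rw [hpy, mul_pow, ← ENNReal.ofReal_pow (Real.sqrt_nonneg _), Real.sq_sqrt hs,
      ENNReal.ofReal_sum_of_nonneg fun i _ => sq_nonneg _, Finset.mul_sum]
    exact Finset.sum_le_sum fun i _ => hbd i
  have := (ENNReal.pow_le_pow_left_iff two_ne_zero).1 hfin
  simpa only [Q, Pi.smul_apply, smul_eq_mul, Function.comp] using this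

/-- Telescope `h i - E h i` over the lags below M. The projections are bounded lag by lag; the
remainder is a conditional expectation on the remote past minus the mean, shown to vanish in L¹ as M
→ ∞. This is why the whole bound is stated in L¹. -/
theorem IsIIDPair.lintegral_sum_centered_le [IsProbabilityMeasure P] (hε : IsIIDPair ε ε' P)
    (n : ℕ) {h : ℕ → (ℕ → ℝ) → ℝ} (hm : ∀ i, Measurable (h i))
    (h2 : ∀ i, MemLp (h i) 2 (past ε P)) {θ : ℕ → ℝ≥0∞}
    (hθ : ∀ i m, projNorm ε P (h i) m ≤ θ m) (a : ℕ → ℝ) :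
    ∫⁻ ω, ‖∑ i ∈ Finset.range n, a i * (h i (shift ε i ω) - ∫ x, h i x ∂(past ε P))‖ₑ ∂P ≤
      (∑' m, θ m) * ENNReal.ofReal (√(∑ i ∈ Finset.range n, a i ^ 2)) := by
  have := hε.isProbabilityMeasure_past
  have hint := fun i => (h2 i).integrable one_le_two
  set A := ENNReal.ofReal (√(∑ i ∈ Finset.range n, a i ^ 2)) with hA
  set r : ℕ → ℕ → ℝ≥0∞ := fun M i => eLpNorm ((past ε P)[h i | remote M] -
    fun _ => ∫ x, h i x ∂(past ε P)) 1 (past ε P) with hr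
  have hpres := fun i : ℕ => hε.measurePreserving_shift (i : ℤ)
  have key : ∀ M : ℕ,
      ∫⁻ ω, ‖∑ i ∈ Finset.range n, a i * (h i (shift ε i ω) - ∫ x, h i x ∂(past ε P))‖ₑ ∂P ≤
        (∑' m, θ m) * A + ∑ i ∈ Finset.range n, ‖a i‖ₑ * r M i := by
    intro M
    let Qs : ℕ → Ω → ℝ := fun m ω => ∑ i ∈ Finset.range n, a i *
      ((past ε P)[h i | remote m] - (past ε P)[h i | remote (m + 1)]) (shift ε i ω)
    let g : ℕ → (ℕ → ℝ) → ℝ := fun i => (past ε P)[h i | remote M] -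
      fun _ => ∫ x, h i x ∂(past ε P)
    let R : ℕ → Ω → ℝ := fun i ω => g i (shift ε i ω)
    have hmeas : ∀ k i, Measurable ((past ε P)[h i | remote k]) := fun k i =>
      (stronglyMeasurable_condExp.mono (remote_le k)).measurable
    have hQsm : ∀ m, Measurable (Qs m) := fun m =>
      Finset.measurable_fun_sum _ fun i _ =>
        (((hmeas _ _).sub (hmeas _ _)).comp (hε.measurable_shift i)).const_mul (a i)
    have hgm : ∀ i, Measurable (g i) := fun i => (hmeas M i).sub measurable_const
    have hRm : ∀ i, Measurable (R i) := fun i => (hgm i).comp (hε.measurable_shift i)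
    have hpt : ∀ᵐ ω ∂P,
        ‖∑ i ∈ Finset.range n, a i * (h i (shift ε i ω) - ∫ x, h i x ∂(past ε P))‖ₑ ≤
          ∑ m ∈ Finset.range M, ‖Qs m ω‖ₑ + ∑ i ∈ Finset.range n, ‖a i‖ₑ * ‖R i ω‖ₑ := by
      have h0 : ∀ i, (past ε P)[h i | remote 0] = h i := fun i => by
        rw [remote_zero]
        exact condExp_of_stronglyMeasurable le_rfl (hm i).stronglyMeasurable (hint i)
      refine Eventually.of_forall fun ω => ?_
      have e : ∑ i ∈ Finset.range n, a i * (h i (shift ε i ω) - ∫ x, h i x ∂(past ε P)) =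
          ∑ m ∈ Finset.range M, Qs m ω + ∑ i ∈ Finset.range n, a i * R i ω := by
        rw [Finset.sum_comm, ← Finset.sum_add_distrib]
        refine Finset.sum_congr rfl fun i _ => ?_
        rw [← Finset.mul_sum, ← mul_add]
        simp only [Pi.sub_apply, R, g]
        rw [Finset.sum_range_sub' (fun m => ((past ε P)[h i | remote m]) (shift ε i ω)), h0]
        ring
      rw [e]
      refine (enorm_add_le _ _).trans (add_le_add (enorm_sum_le _ _) ?_)
      refine (enorm_sum_le _ _).trans (Finset.sum_le_sum fun i _ => ?_)
      rw [enorm_mul]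
    calc _ ≤ ∫⁻ ω, ∑ m ∈ Finset.range M, ‖Qs m ω‖ₑ +
          ∑ i ∈ Finset.range n, ‖a i‖ₑ * ‖R i ω‖ₑ ∂P := lintegral_mono_ae hpt
      _ = ∑ m ∈ Finset.range M, ∫⁻ ω, ‖Qs m ω‖ₑ ∂P +
          ∑ i ∈ Finset.range n, ‖a i‖ₑ * ∫⁻ ω, ‖R i ω‖ₑ ∂P := by
        rw [lintegral_add_left (Finset.measurable_fun_sum _ fun m _ => (hQsm m).enorm),
          lintegral_finsetSum _ fun m _ => (hQsm m).enorm,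
          lintegral_finsetSum _ fun i _ => (hRm i).enorm.const_mul _]
        congr 1
        exact Finset.sum_congr rfl fun i _ => lintegral_const_mul _ (hRm i).enorm
      _ ≤ (∑' m, θ m) * A + ∑ i ∈ Finset.range n, ‖a i‖ₑ * r M i := by
        refine add_le_add ?_ (Finset.sum_le_sum fun i _ => ?_)
        · refine (Finset.sum_le_sum (g := fun m => θ m * A) fun m _ => ?_).trans ?_
          · rw [← eLpNorm_one_eq_lintegral_enorm]
            exact (eLpNorm_le_eLpNorm_of_exponent_le one_le_two
              (hQsm m).aestronglyMeasurable).trans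
              (hε.eLpNorm_sum_projection_le n m h2 (fun i => hθ i m) a)
          · rw [← Finset.sum_mul]
            gcongr
            exact ENNReal.sum_le_tsum _
        · refine mul_le_mul_right (le_of_eq ?_) _
          rw [hε.lintegral_shift_comp i (f := fun x => ‖g i x‖ₑ) (hgm i).enorm.aemeasurable,
            ← eLpNorm_one_eq_lintegral_enorm]
  have hlim : Tendsto (fun M => (∑' m, θ m) * A + ∑ i ∈ Finset.range n, ‖a i‖ₑ * r M i) atTop
      (𝓝 ((∑' m, θ m) * A + ∑ i ∈ Finset.range n, ‖a i‖ₑ * 0)) := by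
    refine tendsto_const_nhds.add (tendsto_finsetSum _ fun i _ => ?_)
    exact ENNReal.Tendsto.const_mul (hε.tendsto_condExp_remote (hm i) (hint i))
      (Or.inr (by simp))
  simp only [mul_zero, Finset.sum_const_zero, add_zero] at hlim
  exact ge_of_tendsto' hlim key

/-- The projection is controlled by the distance to any functional of the coupled past. -/
theorem IsIIDPair.projNorm_le [IsProbabilityMeasure P] (hε : IsIIDPair ε ε' P)
    {h : (ℕ → ℝ) → ℝ} (hi : Integrable h (past ε P)) (m : ℕ) {W : Ω → ℝ}
    (hWm : StronglyMeasurable[MeasurableSpace.comap (shiftStar ε ε' 0) inferInstance] W)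
    (hWi : Integrable W P) :
    projNorm ε P h m ≤ 2 * eLpNorm (P[h ∘ shift ε m |
      MeasurableSpace.comap (shift ε 0) inferInstance] - W) 2 P := by
  have := hε.isProbabilityMeasure_past
  have := hε.isProbabilityMeasure_innov
  have hpres := hε.measurePreserving_shift (m : ℤ)
  let F : ℤ → MeasurableSpace Ω := fun k => MeasurableSpace.comap (shift ε k) inferInstance
  have hF0 : F 0 = (remote m).comap (shift ε m) := by
    simp only [F]; rw [comap_remote_shift, sub_self]
  have hF1 : F (-1) = (remote (m + 1)).comap (shift ε m) := by
    rw [comap_remote_shift]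
    simp only [F]
    congr 2
    push_cast
    ring
  have hF01 : F (-1) ≤ F 0 := by
    rw [hF0, hF1]
    exact MeasurableSpace.comap_mono (remote_antitone (Nat.le_succ m))
  have hF0le := (hε.measurable_shift 0).comap_le
  set Y := h ∘ shift ε m with hY
  have hYi : Integrable Y P := hpres.integrable_comp_of_integrable hi
  set U := P[Y | F 0] with hU
  have hUi : Integrable U P := integrable_condExp
  obtain ⟨w, hw, rfl⟩ := hWm.exists_eq_measurable_comp
  -- The coupled past is F_{-1} together with `ε' 0`, which is independent of `F 0`. Integrating `ε'
  -- 0` out leaves a function of F_{-1} alone.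
  have hκ : P[w ∘ shiftStar ε ε' 0 | F 0] =ᵐ[P]
      fun ω => ∫ u, w (append u (shift ε (-1) ω)) ∂(innov ε P) := by
    have e0 : w ∘ shiftStar ε ε' 0 = fun ω => w (append (ε' 0 ω) (drop 1 (shift ε 0 ω))) := by
      funext ω
      rw [drop_shift, Function.comp_apply, ← append_shiftStar]
      simp
    have e1 := condExp_prod_of_map_eq_prod (hε.measurable_right 0) (hε.measurable_shift 0)
      (hε.map_prod_right_shift 0 0)
      (f := fun q => w (append q.1 (drop 1 q.2)))
      (hw.comp_measurable (measurable_append.comp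
        (measurable_fst.prodMk ((measurable_drop 1).comp measurable_snd)))) (by
        rw [e0] at hWi; exact hWi)
    rw [e0]
    refine e1.trans (Eventually.of_forall fun ω => ?_)
    simp only [drop_shift]
    simp
  have hκm : StronglyMeasurable[F (-1)]
      fun ω => ∫ u, w (append u (shift ε (-1) ω)) ∂(innov ε P) := by
    have : StronglyMeasurable fun x => ∫ u, w (append u x) ∂(innov ε P) :=
      (hw.comp_measurable measurable_append).integral_prod_left'
    exact this.comp_measurable (comap_measurable (shift ε (-1)))
  have hκi := (integrable_congr hκ).1 integrable_condExp
  have hWW : P[P[w ∘ shiftStar ε ε' 0 | F 0] | F (-1)] =ᵐ[P] P[w ∘ shiftStar ε ε' 0 | F 0] := by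
    refine (condExp_congr_ae hκ).trans ?_
    rw [condExp_of_stronglyMeasurable (hF01.trans hF0le) hκm hκi]
    exact hκ.symm
  set V := P[U - w ∘ shiftStar ε ε' 0 | F 0] with hV
  have hV1 : V =ᵐ[P] U - P[w ∘ shiftStar ε ε' 0 | F 0] := by
    refine (condExp_sub hUi hWi (F 0)).trans ?_
    rw [condExp_of_stronglyMeasurable hF0le stronglyMeasurable_condExp hUi]
  have hV2 : P[V | F (-1)] =ᵐ[P] P[U | F (-1)] - P[w ∘ shiftStar ε ε' 0 | F 0] := by
    refine (condExp_congr_ae hV1).trans ((condExp_sub hUi integrable_condExp (F (-1))).trans ?_)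
    filter_upwards [hWW] with ω b
    rw [Pi.sub_apply, Pi.sub_apply, b]
  -- The conditional expectation of W on `F 0` is unchanged by conditioning on `F (-1)`, so it
  -- cancels and only the projection of `U` remains. The factor 2 comes from the two terms of this
  -- difference.
  have hproj : (V - P[V | F (-1)] : Ω → ℝ) =ᵐ[P]
      ((past ε P)[h | remote m] - (past ε P)[h | remote (m + 1)]) ∘ shift ε m := by
    have e1 : U =ᵐ[P] (past ε P)[h | remote m] ∘ shift ε m := by
      rw [hU, hF0]
      exact condExp_comp_measurePreserving hpres (remote_le m) hi
    have e2 : P[U | F (-1)] =ᵐ[P] (past ε P)[h | remote (m + 1)] ∘ shift ε m := by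
      refine (condExp_condExp_of_le hF01 hF0le).trans ?_
      rw [hF1]
      exact condExp_comp_measurePreserving hpres (remote_le (m + 1)) hi
    filter_upwards [hV1, hV2, e1, e2] with ω b1 b2 b3 b4
    simp only [Pi.sub_apply, Function.comp_apply] at b1 b2 b3 b4 ⊢
    rw [b1, b2, b3, b4]
    ring
  have hmeasq : AEStronglyMeasurable ((past ε P)[h | remote m] - (past ε P)[h | remote (m + 1)])
      (past ε P) := (integrable_condExp.sub integrable_condExp).1
  calc projNorm ε P h m = eLpNorm (V - P[V | F (-1)]) 2 P := by
        rw [projNorm, eLpNorm_congr_ae hproj, eLpNorm_comp_measurePreserving hmeasq hpres]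
    _ ≤ eLpNorm V 2 P + eLpNorm (P[V | F (-1)]) 2 P :=
        eLpNorm_sub_le integrable_condExp.1 integrable_condExp.1 one_le_two
    _ ≤ eLpNorm V 2 P + eLpNorm V 2 P := by
        gcongr
        exact eLpNorm_condExp_le_eLpNorm _ one_le_two
    _ = 2 * eLpNorm V 2 P := by ring
    _ ≤ _ := by
        gcongr
        exact eLpNorm_condExp_le_eLpNorm _ one_le_two

end Projection

/-! ### Measurable versions of iterated derivatives -/

section Version

/-- Iterated limits of difference quotients in the first variable: a version of the iterated
partial derivatives which is always measurable. -/
noncomputable def diffVersion {S : Type*} (f : ℝ × S → ℝ) : ℕ → ℝ × S → ℝ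
  | 0 => f
  | l + 1 => fun q => limUnder atTop fun n : ℕ =>
      ((n : ℝ) + 1) * (diffVersion f l (q.1 + 1 / ((n : ℝ) + 1), q.2) - diffVersion f l q)

theorem measurable_diffVersion {S : Type*} [MeasurableSpace S] {f : ℝ × S → ℝ}
    (hf : Measurable f) (l : ℕ) : Measurable (diffVersion f l) := by
  induction l with
  | zero => exact hf
  | succ l ih =>
    refine (StronglyMeasurable.limUnder (l := atTop) (f := fun (n : ℕ) (q : ℝ × S) =>
      ((n : ℝ) + 1) * (diffVersion f l (q.1 + 1 / ((n : ℝ) + 1), q.2) - diffVersion f l q))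
      fun n => ?_).measurable
    refine Measurable.stronglyMeasurable ?_
    exact ((ih.comp ((measurable_fst.add_const _).prodMk measurable_snd)).sub ih).const_mul _

theorem hasDerivAt_iteratedDeriv_of_contDiffAt {g : ℝ → ℝ} {p : ℕ} {r : ℝ}
    (hg : ∀ t : ℝ, |t| < r → ContDiffAt ℝ p g t) {l : ℕ} (hl : l < p) {t : ℝ} (ht : |t| < r) :
    HasDerivAt (iteratedDeriv l g) (iteratedDeriv (l + 1) g t) t := by
  have hopen : IsOpen (Set.Ioo (-r) r) := isOpen_Ioo
  have hC : ContDiffOn ℝ p g (Set.Ioo (-r) r) := fun s hs =>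
    (hg s (abs_lt.2 hs)).contDiffWithinAt
  have h1 := hC.differentiableOn_iteratedDerivWithin (m := l) (by exact_mod_cast hl)
    hopen.uniqueDiffOn
  have htm : t ∈ Set.Ioo (-r) r := abs_lt.1 ht
  have h2 : DifferentiableAt ℝ (iteratedDeriv l g) t :=
    ((h1.differentiableAt (hopen.mem_nhds htm)).congr_of_eventuallyEq
      ((iteratedDerivWithin_of_isOpen hopen).eventuallyEq_of_mem (hopen.mem_nhds htm)).symm)
  rw [iteratedDeriv_succ]
  exact h2.hasDerivAt

theorem continuousOn_iteratedDeriv_of_contDiffAt {g : ℝ → ℝ} {p : ℕ} {r : ℝ}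
    (hg : ∀ t : ℝ, |t| < r → ContDiffAt ℝ p g t) {l : ℕ} (hl : l ≤ p) :
    ContinuousOn (iteratedDeriv l g) (Set.Ioo (-r) r) := by
  have hopen : IsOpen (Set.Ioo (-r) r) := isOpen_Ioo
  have hC : ContDiffOn ℝ p g (Set.Ioo (-r) r) := fun s hs =>
    (hg s (abs_lt.2 hs)).contDiffWithinAt
  exact (hC.continuousOn_iteratedDerivWithin (m := l) (by exact_mod_cast hl)
    hopen.uniqueDiffOn).congr (iteratedDerivWithin_of_isOpen hopen).symm

theorem tendsto_diffQuot {g : ℝ → ℝ} {d t : ℝ} (h : HasDerivAt g d t) :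
    Tendsto (fun n : ℕ => ((n : ℝ) + 1) * (g (t + 1 / ((n : ℝ) + 1)) - g t)) atTop (𝓝 d) := by
  have h1 := h.tendsto_slope_zero
  have h2 : Tendsto (fun n : ℕ => 1 / ((n : ℝ) + 1)) atTop (𝓝[≠] 0) := by
    refine tendsto_nhdsWithin_iff.2 ⟨tendsto_one_div_add_atTop_nhds_zero_nat,
      Eventually.of_forall fun n => ?_⟩
    have : (0 : ℝ) < 1 / ((n : ℝ) + 1) := by positivity
    exact this.ne'
  refine (h1.comp h2).congr fun n => ?_
  simp only [Function.comp_apply, smul_eq_mul, one_div, inv_inv]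

/-- Smoothness in the first variable will be available for almost every `x` only, and elsewhere
`iteratedDeriv` has no evident measurability in `x`. At good points the limits of difference
quotients are the derivatives. The open range |t| < r keeps the nearby points t + 1/(n+1) eventually
inside it, as the induction requires. -/
theorem diffVersion_eq_iteratedDeriv {S : Type*} {f : ℝ × S → ℝ} {x : S} {p : ℕ} {r : ℝ}
    (hg : ∀ t : ℝ, |t| < r → ContDiffAt ℝ p (fun s => f (s, x)) t) {l : ℕ} (hl : l ≤ p) {t : ℝ}
    (ht : |t| < r) : diffVersion f l (t, x) = iteratedDeriv l (fun s => f (s, x)) t := by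
  induction l generalizing t with
  | zero => simp [diffVersion]
  | succ l ih =>
    have ih' := fun {s : ℝ} (hs : |s| < r) => ih (Nat.le_of_succ_le hl) hs
    refine Tendsto.limUnder_eq ((tendsto_diffQuot
      (hasDerivAt_iteratedDeriv_of_contDiffAt hg hl ht)).congr' ?_)
    have h0 : Tendsto (fun n : ℕ => |t + 1 / ((n : ℝ) + 1)|) atTop (𝓝 |t|) := by
      have := (tendsto_const_nhds (x := t)).add (tendsto_one_div_add_atTop_nhds_zero_nat (𝕜 := ℝ))
      simpa using this.abs
    filter_upwards [h0.eventually_lt_const ht] with n hn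
    rw [ih' hn, ih' ht]

end Version

/-! ### Smoothness and dependence bounds on the law of the past -/

section Psi

variable {Ω : Type*} [MeasurableSpace Ω] {P : Measure Ω} {ε ε' : ℤ → Ω → ℝ}
  {ψ : ℝ → ℝ} {G : (ℕ → ℝ) → ℝ}

theorem IsIIDPair.measurable_psi1 [IsProbabilityMeasure P] (hε : IsIIDPair ε ε' P)
    (hψ : Measurable ψ) (hG : Measurable G) :
    Measurable (fun q : ℝ × (ℕ → ℝ) => psi1 ψ G ε P q.1 q.2) := by
  have := hε.isProbabilityMeasure_innov
  have hf : Measurable fun z : ℝ × (ℝ × (ℕ → ℝ)) => ψ (G (append z.1 z.2.2) + z.2.1) := by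
    have h1 : Measurable fun z : ℝ × (ℝ × (ℕ → ℝ)) => (z.1, z.2.2) :=
      measurable_fst.prodMk (measurable_snd.comp measurable_snd)
    have h2 : Measurable fun z : ℝ × (ℝ × (ℕ → ℝ)) => z.2.1 := measurable_fst.comp measurable_snd
    exact hψ.comp ((hG.comp (measurable_append.comp h1)).add h2)
  exact (hf.stronglyMeasurable.integral_prod_left' (μ := innov ε P)).measurable

/-- The family of measurable versions of the derivatives of `psi1`. -/
noncomputable def psiVersion (ψ : ℝ → ℝ) (G : (ℕ → ℝ) → ℝ) (ε : ℤ → Ω → ℝ) (P : Measure Ω)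
    (l : ℕ) (t : ℝ) (x : ℕ → ℝ) : ℝ :=
  diffVersion (fun q : ℝ × (ℕ → ℝ) => psi1 ψ G ε P q.1 q.2) l (t, x)

/-- What the smoothness and dependence conditions give on `[-r, r]`. -/
structure SmoothPast (ψ : ℝ → ℝ) (G : (ℕ → ℝ) → ℝ) (ε : ℤ → Ω → ℝ) (P : Measure Ω) (p : ℕ)
    (r : ℝ) (B : ℝ≥0∞) (θ : ℕ → ℝ≥0∞) : Prop where
  pos : 0 < r
  bound_lt_top : B < ∞
  tsum_lt_top : ∑' m, θ m < ∞
  eLpNorm_le : ∀ l ≤ p, ∀ t : ℝ, |t| ≤ r → eLpNorm (psiVersion ψ G ε P l t) 2 (past ε P) ≤ B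
  projNorm_le : ∀ l ≤ p, ∀ t : ℝ, |t| ≤ r → ∀ m, projNorm ε P (psiVersion ψ G ε P l t) m ≤ θ m
  continuousOn : ∀ i : ℕ, ∀ᵐ ω ∂P, ∀ l ≤ p,
    ContinuousOn (fun t => psiVersion ψ G ε P l t (shift ε i ω)) (Set.Icc (-r) r)
  hasDerivAt : ∀ i : ℕ, ∀ᵐ ω ∂P, ∀ l < p, ∀ t : ℝ, |t| ≤ r →
    HasDerivAt (fun t => psiVersion ψ G ε P l t (shift ε i ω))
      (psiVersion ψ G ε P (l + 1) t (shift ε i ω)) t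

theorem psiVersion_zero (t : ℝ) (x : ℕ → ℝ) : psiVersion ψ G ε P 0 t x = psi1 ψ G ε P t x := rfl

theorem IsIIDPair.measurable_psiVersion [IsProbabilityMeasure P] (hε : IsIIDPair ε ε' P)
    (hψ : Measurable ψ) (hG : Measurable G) (l : ℕ) :
    Measurable (fun q : ℝ × (ℕ → ℝ) => psiVersion ψ G ε P l q.1 q.2) :=
  measurable_diffVersion (hε.measurable_psi1 hψ hG) l

theorem IsIIDPair.measurable_psiVersion_right [IsProbabilityMeasure P] (hε : IsIIDPair ε ε' P)
    (hψ : Measurable ψ) (hG : Measurable G) (l : ℕ) (t : ℝ) :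
    Measurable (psiVersion ψ G ε P l t) :=
  (hε.measurable_psiVersion hψ hG l).comp (measurable_const.prodMk measurable_id)

theorem exists_pos_le_forall_le {p : ℕ} {e : ℕ → ℝ} (he : ∀ l ≤ p, 0 < e l) :
    ∃ r : ℝ, 0 < r ∧ ∀ l ≤ p, r ≤ e l := by
  obtain ⟨l₀, hl₀, hmin⟩ := Finset.exists_min_image (Finset.range (p + 1)) e ⟨0, by simp⟩
  exact ⟨e l₀, he _ (Nat.lt_succ_iff.1 (Finset.mem_range.1 hl₀)),
    fun l hl => hmin l (Finset.mem_range.2 (Nat.lt_succ_iff.2 hl))⟩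

/-- The assumptions concern `psi1Deriv` along the paths; the conclusions concern its measurable
version under the law of the past. The two agree almost surely along each `shift ε i`, and
stationarity does the rest. -/
theorem IsIIDPair.exists_smoothPast [IsProbabilityMeasure P] (hε : IsIIDPair ε ε' P)
    (hψ : Measurable ψ) (hG : Measurable G) {p : ℕ}
    (h6 : ∀ l : ℕ, l ≤ p → A6 ψ G ε ε' P l) :
    ∃ r B θ, SmoothPast ψ G ε P p r B θ := by
  classical
  choose! e he hsm hbd hsum using h6
  obtain ⟨r₀, hr₀, hr₀e⟩ := exists_pos_le_forall_le he
  -- The bounds at time 0 suffice, since all times share the law of the past. Summing over `l` makes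
  -- the bound uniform in the order.
  set B : ℝ≥0∞ := ∑ l ∈ Finset.range (p + 1), ⨆ (t : ℝ) (_ : |t| ≤ e l),
      eLpNorm (fun ω => psi1Deriv ψ G ε P l t (shift ε (0 : ℕ) ω)) 2 P with hB
  let d : ℕ → ℕ → ℝ≥0∞ := fun l i => ⨆ (t : ℝ) (_ : |t| ≤ e l),
      eLpNorm
        (P[fun ω => psi1Deriv ψ G ε P l t (shift ε i ω) |
            MeasurableSpace.comap (shift ε 0) inferInstance] -
          P[fun ω => psi1Deriv ψ G ε P l t (shiftStar ε ε' i ω) |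
            MeasurableSpace.comap (shiftStar ε ε' 0) inferInstance]) 2 P
  have hmv := hε.measurable_psiVersion_right (P := P) hψ hG
  -- The top order `p` gives smoothness of every lower order on the same interval.
  have hC : ∀ i : ℕ, ∀ᵐ ω ∂P, ∀ t : ℝ, |t| < r₀ →
      ContDiffAt ℝ p (fun s => psi1 ψ G ε P s (shift ε i ω)) t := by
    intro i
    filter_upwards [hsm p le_rfl i] with ω hω t ht
    exact hω t (ht.le.trans (hr₀e p le_rfl))
  have heq : ∀ i : ℕ, ∀ᵐ ω ∂P, ∀ l ≤ p, ∀ t : ℝ, |t| < r₀ →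
      psiVersion ψ G ε P l t (shift ε i ω) = psi1Deriv ψ G ε P l t (shift ε i ω) := by
    intro i
    filter_upwards [hC i] with ω hω l hl t ht
    exact diffVersion_eq_iteratedDeriv (f := fun q : ℝ × (ℕ → ℝ) => psi1 ψ G ε P q.1 q.2)
      hω hl ht
  have hnorm : ∀ l ≤ p, ∀ t : ℝ, |t| < r₀ →
      eLpNorm (psiVersion ψ G ε P l t) 2 (past ε P) ≤ B := by
    intro l hl t ht
    have h1 : eLpNorm (psiVersion ψ G ε P l t) 2 (past ε P) =
        eLpNorm (fun ω => psi1Deriv ψ G ε P l t (shift ε (0 : ℕ) ω)) 2 P := by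
      rw [← eLpNorm_comp_measurePreserving (hmv l t).aestronglyMeasurable
        (hε.measurePreserving_shift ((0 : ℕ) : ℤ))]
      refine eLpNorm_congr_ae ?_
      filter_upwards [heq 0] with ω hω
      exact hω l hl t ht
    rw [h1]
    refine le_trans ?_ (Finset.single_le_sum (f := fun l => ⨆ (t : ℝ) (_ : |t| ≤ e l),
      eLpNorm (fun ω => psi1Deriv ψ G ε P l t (shift ε (0 : ℕ) ω)) 2 P)
      (fun _ _ => zero_le) (Finset.mem_range.2 (Nat.lt_succ_iff.2 hl)))
    exact le_iSup₂_of_le (f := fun (t : ℝ) (_ : |t| ≤ e l) =>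
      eLpNorm (fun ω => psi1Deriv ψ G ε P l t (shift ε (0 : ℕ) ω)) 2 P) t
      (ht.le.trans (hr₀e l hl)) le_rfl
  have hBtop : B < ∞ := ENNReal.sum_lt_top.2 fun l hl =>
    hbd l (Nat.lt_succ_iff.1 (Finset.mem_range.1 hl)) 0
  have hhalf : ∀ t : ℝ, |t| ≤ r₀ / 2 → |t| < r₀ := fun t ht => by linarith
  -- Halving puts the closed interval inside the open one on which version and derivative agree.
  refine ⟨r₀ / 2, B, fun m => ∑ l ∈ Finset.range (p + 1), 2 * d l m, ?_⟩
  have hproj : ∀ l ≤ p, ∀ t : ℝ, |t| ≤ r₀ / 2 → ∀ m,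
      projNorm ε P (psiVersion ψ G ε P l t) m ≤ ∑ l ∈ Finset.range (p + 1), 2 * d l m := by
    intro l hl t ht m
    have := hε.isProbabilityMeasure_past
    have hL2 : MemLp (psiVersion ψ G ε P l t) 2 (past ε P) :=
      ⟨(hmv l t).aestronglyMeasurable, (hnorm l hl t (hhalf t ht)).trans_lt hBtop⟩
    -- A conditional expectation is always measurable and integrable, so it can serve as W without
    -- any knowledge of the derivative along the coupled path.
    refine (hε.projNorm_le (hL2.integrable one_le_two) m
      (W := P[fun ω => psi1Deriv ψ G ε P l t (shiftStar ε ε' m ω) |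
            MeasurableSpace.comap (shiftStar ε ε' 0) inferInstance])
      stronglyMeasurable_condExp integrable_condExp).trans ?_
    refine le_trans ?_ (Finset.single_le_sum (f := fun l => 2 * d l m)
      (fun _ _ => zero_le) (Finset.mem_range.2 (Nat.lt_succ_iff.2 hl)))
    gcongr
    have hc : (psiVersion ψ G ε P l t ∘ shift ε m) =ᵐ[P]
        fun ω => psi1Deriv ψ G ε P l t (shift ε m ω) := by
      filter_upwards [heq m] with ω hω
      exact hω l hl t (hhalf t ht)
    have hc' := condExp_congr_ae (m := MeasurableSpace.comap (shift ε 0) inferInstance) hc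
    rw [eLpNorm_congr_ae (hc'.sub EventuallyEq.rfl)]
    exact le_iSup₂_of_le (f := fun (t : ℝ) (_ : |t| ≤ e l) => eLpNorm
        (P[fun ω => psi1Deriv ψ G ε P l t (shift ε m ω) |
            MeasurableSpace.comap (shift ε 0) inferInstance] -
          P[fun ω => psi1Deriv ψ G ε P l t (shiftStar ε ε' m ω) |
            MeasurableSpace.comap (shiftStar ε ε' 0) inferInstance]) 2 P) t
      ((hhalf t ht).le.trans (hr₀e l hl)) le_rfl
  refine ⟨by positivity, hBtop, ?_, fun l hl t ht => hnorm l hl t (hhalf t ht), hproj, ?_, ?_⟩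
  · rw [Summable.tsum_finsetSum fun _ _ => ENNReal.summable]
    refine ENNReal.sum_lt_top.2 fun l hl => ?_
    rw [ENNReal.tsum_mul_left]
    exact ENNReal.mul_lt_top (by simp) (hsum l (Nat.lt_succ_iff.1 (Finset.mem_range.1 hl)))
  · intro i
    filter_upwards [hC i, heq i] with ω hω hω' l hl
    refine ((continuousOn_iteratedDeriv_of_contDiffAt hω hl).mono ?_).congr ?_
    · intro t ht
      exact abs_lt.1 (hhalf t (abs_le.2 ht))
    · intro t ht
      exact hω' l hl t (hhalf t (abs_le.2 ht))
  · intro i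
    filter_upwards [hC i, heq i] with ω hω hω' l hl t ht
    rw [hω' (l + 1) hl t (hhalf t ht)]
    refine (hasDerivAt_iteratedDeriv_of_contDiffAt hω hl (hhalf t ht)).congr_of_eventuallyEq ?_
    have hopen : IsOpen {s : ℝ | |s| < r₀} := isOpen_lt continuous_abs continuous_const
    filter_upwards [hopen.mem_nhds (hhalf t ht)] with s hs
    exact hω' l hl.le s hs

end Psi

/-! ### Oscillation over a cube by integrating mixed partial derivatives -/

section Oscillation

/-- An iterated-integral bound for the oscillation of `u ↦ ∑ aᵢ fᵢ(sᵢ + ∑ⱼ bⱼᵢ uⱼ)` over a cube of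
half-side `κ`, obtained by integrating mixed partial derivatives. -/
noncomputable def oscBound (f : ℕ → ℕ → ℝ → ℝ) (b : ℕ → ℕ → ℝ) (n : ℕ) (κ : ℝ) :
    ℕ → ℕ → (ℕ → ℝ) → (ℕ → ℝ) → ℝ≥0∞
  | 0 => fun _ _ _ => 0
  | k + 1 => fun l a s => oscBound f b n κ k l a s + ∫⁻ v in Set.Icc (-κ) κ,
      (‖∑ i ∈ Finset.range n, a i * b k i * f (l + 1) i (s i + b k i * v)‖ₑ +
        oscBound f b n κ k (l + 1) (fun i => a i * b k i) (fun i => s i + b k i * v))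

theorem sub_eq_integral_comp {g g' : ℝ → ℝ} {r : ℝ}
    (hg : ∀ x y : ℝ, |x| ≤ r → |y| ≤ r → g y - g x = ∫ t in x..y, g' t) {c b v : ℝ}
    (hc : |c| ≤ r) (hcv : |c + b * v| ≤ r) :
    g (c + b * v) - g c = ∫ w in (0 : ℝ)..v, b * g' (c + b * w) := by
  rw [hg _ _ hc hcv, intervalIntegral.integral_const_mul,
    intervalIntegral.mul_integral_comp_add_mul]
  simp

/-- Displace one coordinate of `u` at a time. The last displacement is an integral of the next
derivative, based at `s + rest`; moving the base point back to `s` costs an oscillation of that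
derivative in one coordinate fewer, which is the induction hypothesis at order l + 1. The bound does
not involve `u`, hence controls a supremum over the cube. -/
theorem enorm_sum_sub_le_oscBound {f : ℕ → ℕ → ℝ → ℝ} {b : ℕ → ℕ → ℝ} {n p : ℕ} {κ r : ℝ}
    (hmeas : ∀ l i, Measurable (f l i))
    (hbd : ∀ l ≤ p, ∀ i < n, ∃ C, ∀ t : ℝ, |t| ≤ r → |f l i t| ≤ C)
    (hftc : ∀ l < p, ∀ i < n, ∀ x y : ℝ, |x| ≤ r → |y| ≤ r →
      f l i y - f l i x = ∫ t in x..y, f (l + 1) i t) {u : ℕ → ℝ} (hu : ∀ j, |u j| ≤ κ)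
    (k l : ℕ) (hkl : l + k ≤ p) (a s : ℕ → ℝ)
    (hs : ∀ i < n, |s i| + κ * ∑ j ∈ Finset.range k, |b j i| ≤ r) :
    ‖∑ i ∈ Finset.range n, a i *
      (f l i (s i + ∑ j ∈ Finset.range k, b j i * u j) - f l i (s i))‖ₑ ≤
        oscBound f b n κ k l a s := by
  have hκ : 0 ≤ κ := (abs_nonneg _).trans (hu 0)
  have hsum : ∀ k i, |∑ j ∈ Finset.range k, b j i * u j| ≤
      κ * ∑ j ∈ Finset.range k, |b j i| := by
    intro k i
    refine (Finset.abs_sum_le_sum_abs _ _).trans ?_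
    rw [Finset.mul_sum]
    refine Finset.sum_le_sum fun j _ => ?_
    rw [abs_mul, mul_comm]
    exact mul_le_mul_of_nonneg_right (hu j) (abs_nonneg _)
  induction k generalizing l a s with
  | zero => simp
  | succ k ih =>
    set rest : ℕ → ℝ := fun i => ∑ j ∈ Finset.range k, b j i * u j with hrest
    have hs' : ∀ i < n, |s i| + κ * |b k i| + κ * ∑ j ∈ Finset.range k, |b j i| ≤ r := by
      intro i hi
      have := hs i hi
      rw [Finset.sum_range_succ, mul_add] at this
      linarith
    have hbk : ∀ i (w : ℝ), |w| ≤ κ → |b k i * w| ≤ κ * |b k i| := by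
      intro i w hw
      rw [abs_mul, mul_comm]
      exact mul_le_mul_of_nonneg_right hw (abs_nonneg _)
    have hκb : ∀ i, 0 ≤ κ * |b k i| := fun i => mul_nonneg hκ (abs_nonneg _)
    have hrange : ∀ i < n, ∀ w : ℝ, |w| ≤ κ → |s i + rest i + b k i * w| ≤ r := by
      intro i hi w hw
      have h1 := abs_add_le (s i + rest i) (b k i * w)
      have h2 := abs_add_le (s i) (rest i)
      have h3 := hsum k i
      have h4 := hbk i w hw
      have h5 := hs' i hi
      linarith
    have hsplit : ∑ i ∈ Finset.range n, a i *
        (f l i (s i + ∑ j ∈ Finset.range (k + 1), b j i * u j) - f l i (s i)) =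
        ∑ i ∈ Finset.range n, a i * (f l i (s i + rest i) - f l i (s i)) +
        ∑ i ∈ Finset.range n, a i *
          (f l i (s i + rest i + b k i * u k) - f l i (s i + rest i)) := by
      rw [← Finset.sum_add_distrib]
      refine Finset.sum_congr rfl fun i _ => ?_
      rw [Finset.sum_range_succ, ← add_assoc]
      ring
    have hint : ∑ i ∈ Finset.range n, a i *
          (f l i (s i + rest i + b k i * u k) - f l i (s i + rest i)) =
        ∫ w in (0 : ℝ)..u k, ∑ i ∈ Finset.range n,
          a i * b k i * f (l + 1) i (s i + rest i + b k i * w) := by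
      rw [intervalIntegral.integral_finsetSum]
      · refine Finset.sum_congr rfl fun i hi => ?_
        have hi := Finset.mem_range.1 hi
        have h0 := hrange i hi 0 (by simpa using hκ)
        rw [mul_zero, add_zero] at h0
        rw [sub_eq_integral_comp (hftc l (by omega) i hi) h0 (hrange i hi _ (hu k)),
          ← intervalIntegral.integral_const_mul]
        simp_rw [mul_assoc]
      · intro i hi
        have hi := Finset.mem_range.1 hi
        obtain ⟨C, hC⟩ := hbd (l + 1) (by omega) i hi
        rw [intervalIntegrable_iff]
        refine Measure.integrableOn_of_bounded (M := |a i * b k i| * C) (by simp) ?_ ?_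
        · exact (((hmeas (l + 1) i).comp ((measurable_id.const_mul (b k i)).const_add
            (s i + rest i))).const_mul (a i * b k i)).aestronglyMeasurable
        · refine (ae_restrict_iff' measurableSet_uIoc).2 (Eventually.of_forall fun w hw => ?_)
          rw [Real.norm_eq_abs, abs_mul]
          gcongr
          refine hC _ (hrange i hi w ?_)
          refine le_trans ?_ (hu k)
          rcases le_total 0 (u k) with h | h
          · rw [Set.uIoc_of_le h] at hw
            rw [abs_of_nonneg hw.1.le, abs_of_nonneg h]; exact hw.2
          · rw [Set.uIoc_of_ge h] at hw
            rw [abs_of_nonpos hw.2, abs_of_nonpos h]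
            linarith [hw.1]
    rw [hsplit, hint, oscBound]
    refine (enorm_add_le _ _).trans (add_le_add ?_ ?_)
    · refine ih l (by omega) a s fun i hi => ?_
      linarith [hs' i hi, hκb i]
    · rw [← ofReal_norm, intervalIntegral.norm_integral_eq_norm_integral_uIoc,
        ofReal_norm]
      refine (enorm_integral_le_lintegral_enorm _).trans ?_
      -- Enlarging the range of integration removes the dependence on `u k`.
      have hsub : Set.uIoc 0 (u k) ⊆ Set.Icc (-κ) κ := by
        have := abs_le.1 (hu k)
        intro w hw
        rcases le_total 0 (u k) with h | h
        · rw [Set.uIoc_of_le h] at hw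
          exact ⟨by linarith [hw.1], by linarith [hw.2]⟩
        · rw [Set.uIoc_of_ge h] at hw
          exact ⟨by linarith [hw.1], by linarith [hw.2]⟩
      refine (lintegral_mono_set hsub).trans ?_
      refine setLIntegral_mono' measurableSet_Icc fun w hw => ?_
      have hw' : |w| ≤ κ := abs_le.2 hw
      have hih := ih (l + 1) (by omega) (fun i => a i * b k i) (fun i => s i + b k i * w)
        (fun i hi => by
          have h1 := abs_add_le (s i) (b k i * w)
          have h2 := hbk i w hw'
          have h3 := hs' i hi
          linarith)
      have e : ∑ i ∈ Finset.range n, a i * b k i * f (l + 1) i (s i + rest i + b k i * w) =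
          ∑ i ∈ Finset.range n, a i * b k i * f (l + 1) i (s i + b k i * w) +
          ∑ i ∈ Finset.range n, a i * b k i *
            (f (l + 1) i (s i + b k i * w + rest i) - f (l + 1) i (s i + b k i * w)) := by
        rw [← Finset.sum_add_distrib]
        refine Finset.sum_congr rfl fun i _ => ?_
        rw [add_right_comm (s i) (rest i)]
        ring
      rw [e]
      exact (enorm_add_le _ _).trans (add_le_add le_rfl hih)

variable {Ω : Type*} [MeasurableSpace Ω] {P : Measure Ω}

/-- The base point is kept as a variable because the recursion displaces it under the integral. -/
theorem measurable_oscBound {f : Ω → ℕ → ℕ → ℝ → ℝ} {b : ℕ → ℕ → ℝ} {n : ℕ} {κ : ℝ}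
    (hf : ∀ l i, Measurable fun q : ℝ × Ω => f q.2 l i q.1) (k l : ℕ) (a : ℕ → ℝ) :
    Measurable fun q : (ℕ → ℝ) × Ω => oscBound (f q.2) b n κ k l a q.1 := by
  induction k generalizing l a with
  | zero => exact measurable_const
  | succ k ih =>
    simp only [oscBound]
    refine (ih l a).add ?_
    have hshift : Measurable fun z : ((ℕ → ℝ) × Ω) × ℝ => fun i => z.1.1 i + b k i * z.2 :=
      measurable_pi_lambda _ fun i => ((measurable_pi_apply i).comp
        (measurable_fst.comp measurable_fst)).add (measurable_snd.const_mul (b k i))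
    have hω : Measurable fun z : ((ℕ → ℝ) × Ω) × ℝ => z.1.2 :=
      measurable_snd.comp measurable_fst
    have h1 : Measurable fun z : ((ℕ → ℝ) × Ω) × ℝ =>
        ‖∑ i ∈ Finset.range n, a i * b k i * f z.1.2 (l + 1) i (z.1.1 i + b k i * z.2)‖ₑ := by
      refine Measurable.enorm (Finset.measurable_fun_sum _ fun i _ => ?_)
      exact ((hf (l + 1) i).comp
        (((measurable_pi_apply i).comp hshift).prodMk hω)).const_mul _
    have h2 : Measurable fun z : ((ℕ → ℝ) × Ω) × ℝ =>
        oscBound (f z.1.2) b n κ k (l + 1) (fun i => a i * b k i)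
          (fun i => z.1.1 i + b k i * z.2) :=
      (ih (l + 1) fun i => a i * b k i).comp (hshift.prodMk hω)
    exact (h1.add h2).lintegral_prod_right' (ν := volume.restrict (Set.Icc (-κ) κ))

/-- The numerical constant in the moment bound for `oscBound`. -/
def oscConst : ℕ → ℝ≥0
  | 0 => 0
  | k + 1 => oscConst k + 2 * (1 + oscConst k)

/-- By Tonelli, every integrand is a weighted sum covered by `hΘ`. A derivative multiplies the
weights by at most `c i` and an integration contributes κ; as κ c_i ≤ 1, mixed derivatives cost no
more than a single one. -/
theorem lintegral_oscBound_le [IsProbabilityMeasure P] {f : Ω → ℕ → ℕ → ℝ → ℝ} {b : ℕ → ℕ → ℝ}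
    {c : ℕ → ℝ} {n p : ℕ} {κ r : ℝ} {Θ : ℝ≥0∞}
    (hf : ∀ l i, Measurable fun q : ℝ × Ω => f q.2 l i q.1)
    (hΘ : ∀ l ≤ p, ∀ a s : ℕ → ℝ, (∀ i < n, |s i| ≤ r) →
      ∫⁻ ω, ‖∑ i ∈ Finset.range n, a i * f ω l i (s i)‖ₑ ∂P ≤
        Θ * ENNReal.ofReal (√(∑ i ∈ Finset.range n, a i ^ 2)))
    (hκ : 0 ≤ κ) (hb : ∀ j i, |b j i| ≤ c i) (hκc : ∀ i < n, κ * c i ≤ 1)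
    (k l : ℕ) (hkl : l + k ≤ p) (a s : ℕ → ℝ) (hs : ∀ i < n, |s i| + κ * (k * c i) ≤ r) :
    ∫⁻ ω, oscBound (f ω) b n κ k l a s ∂P ≤
      oscConst k * (Θ * ENNReal.ofReal κ *
        ENNReal.ofReal (√(∑ i ∈ Finset.range n, (a i * c i) ^ 2))) := by
  have hc : ∀ i, 0 ≤ c i := fun i => (abs_nonneg _).trans (hb 0 i)
  induction k generalizing l a s with
  | zero => simp [oscBound]
  | succ k ih =>
    have hbc : ∀ i, (a i * b k i) ^ 2 ≤ (a i * c i) ^ 2 := by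
      intro i
      rw [mul_pow, mul_pow]
      refine mul_le_mul_of_nonneg_left ?_ (sq_nonneg _)
      exact sq_le_sq.2 ((hb k i).trans (le_abs_self _))
    have hbcc : ∀ i < n, (κ * (a i * b k i * c i)) ^ 2 ≤ (a i * c i) ^ 2 := by
      intro i hi
      have h1 : (κ * (a i * b k i * c i)) ^ 2 = (κ * c i) ^ 2 * (a i * b k i) ^ 2 := by ring
      rw [h1]
      have h2 : (κ * c i) ^ 2 ≤ 1 := by
        have := mul_nonneg hκ (hc i)
        have := hκc i hi
        nlinarith
      calc _ ≤ 1 * (a i * b k i) ^ 2 := mul_le_mul_of_nonneg_right h2 (sq_nonneg _)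
        _ ≤ _ := by rw [one_mul]; exact hbc i
    set A := ENNReal.ofReal (√(∑ i ∈ Finset.range n, (a i * c i) ^ 2)) with hA
    have hs' : ∀ i < n, |s i| + κ * c i + κ * (k * c i) ≤ r := by
      intro i hi
      have := hs i hi
      push_cast at this
      linarith
    have hcκ : ∀ i, 0 ≤ κ * c i := fun i => mul_nonneg hκ (hc i)
    have hkκ : ∀ i, 0 ≤ κ * (k * c i) := fun i =>
      mul_nonneg hκ (mul_nonneg k.cast_nonneg (hc i))
    have hsw : ∀ w : ℝ, |w| ≤ κ → ∀ i < n, |s i + b k i * w| + κ * (k * c i) ≤ r := by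
      intro w hw i hi
      have h1 := abs_add_le (s i) (b k i * w)
      have h2 : |b k i * w| ≤ κ * c i := by
        rw [abs_mul, mul_comm]
        exact mul_le_mul hw (hb k i) (abs_nonneg _) hκ
      linarith [hs' i hi]
    have hm1 : Measurable fun ω => oscBound (f ω) b n κ k l a s :=
      (measurable_oscBound (b := b) (n := n) (κ := κ) hf k l a).comp
        (measurable_const.prodMk measurable_id)
    have hinner : Measurable fun q : Ω × ℝ =>
        ‖∑ i ∈ Finset.range n, a i * b k i * f q.1 (l + 1) i (s i + b k i * q.2)‖ₑ +
        oscBound (f q.1) b n κ k (l + 1) (fun i => a i * b k i) (fun i => s i + b k i * q.2) := by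
      have hsh : Measurable fun q : Ω × ℝ => fun i => s i + b k i * q.2 :=
        measurable_pi_lambda _ fun i => (measurable_snd.const_mul (b k i)).const_add (s i)
      refine Measurable.add (Measurable.enorm (Finset.measurable_fun_sum _ fun i _ => ?_)) ?_
      · exact ((hf (l + 1) i).comp
          (((measurable_pi_apply i).comp hsh).prodMk measurable_fst)).const_mul _
      · exact (measurable_oscBound hf k (l + 1) fun i => a i * b k i).comp
          (hsh.prodMk measurable_fst)
    have hpt : ∀ w : ℝ, |w| ≤ κ → ∫⁻ ω,
        (‖∑ i ∈ Finset.range n, a i * b k i * f ω (l + 1) i (s i + b k i * w)‖ₑ +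
        oscBound (f ω) b n κ k (l + 1) (fun i => a i * b k i) (fun i => s i + b k i * w)) ∂P ≤
        (1 + oscConst k) * (Θ * A) := by
      intro w hw
      have hm2 : Measurable fun ω => ‖∑ i ∈ Finset.range n,
          a i * b k i * f ω (l + 1) i (s i + b k i * w)‖ₑ :=
        Measurable.enorm (Finset.measurable_fun_sum _ fun i _ =>
          ((hf (l + 1) i).comp (measurable_const.prodMk measurable_id)).const_mul _)
      rw [lintegral_add_left hm2, add_mul, one_mul]
      refine add_le_add ?_ ?_
      · refine (hΘ (l + 1) (by omega) (fun i => a i * b k i) (fun i => s i + b k i * w)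
          fun i hi => ?_).trans ?_
        · linarith [hsw w hw i hi, hkκ i]
        · refine mul_le_mul_right (ENNReal.ofReal_le_ofReal (Real.sqrt_le_sqrt ?_)) _
          exact Finset.sum_le_sum fun i _ => hbc i
      · refine (ih (l + 1) (by omega) (fun i => a i * b k i) (fun i => s i + b k i * w)
          (hsw w hw)).trans ?_
        rw [mul_assoc Θ]
        gcongr
        have hsq : κ * √(∑ i ∈ Finset.range n, (a i * b k i * c i) ^ 2) =
            √(∑ i ∈ Finset.range n, κ ^ 2 * (a i * b k i * c i) ^ 2) := by
          rw [← Finset.mul_sum, Real.sqrt_mul (sq_nonneg κ), Real.sqrt_sq hκ]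
        rw [← ENNReal.ofReal_mul hκ, hsq]
        refine ENNReal.ofReal_le_ofReal (Real.sqrt_le_sqrt (Finset.sum_le_sum fun i hi => ?_))
        rw [← mul_pow]
        exact hbcc i (Finset.mem_range.1 hi)
    simp only [oscBound]
    rw [lintegral_add_left hm1, lintegral_lintegral_swap hinner.aemeasurable]
    have hih := ih l (by omega) a s fun i hi => by linarith [hs' i hi, hcκ i]
    -- The length 2κ is the source of the factor 2 in `oscConst`.
    have hvol : volume (Set.Icc (-κ) κ) = 2 * ENNReal.ofReal κ := by
      rw [Real.volume_Icc, sub_neg_eq_add, ← two_mul, ENNReal.ofReal_mul two_pos.le]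
      simp
    calc _ ≤ oscConst k * (Θ * ENNReal.ofReal κ * A) +
          ∫⁻ _ in Set.Icc (-κ) κ, (1 + oscConst k) * (Θ * A) := by
          refine add_le_add hih (setLIntegral_mono' measurableSet_Icc fun w hw => ?_)
          exact hpt w (abs_le.2 hw)
      _ = oscConst (k + 1) * (Θ * ENNReal.ofReal κ * A) := by
          rw [setLIntegral_const, hvol, oscConst]
          push_cast
          ring

end Oscillation

/-! ### The centred prediction process and its derivatives -/

section Centered

variable {Ω : Type*} [MeasurableSpace Ω] {P : Measure Ω} {ε ε' : ℤ → Ω → ℝ}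
  {ψ : ℝ → ℝ} {G : (ℕ → ℝ) → ℝ} {p : ℕ} {r : ℝ} {B : ℝ≥0∞} {θ : ℕ → ℝ≥0∞}

/-- The centered derivative processes. -/
noncomputable def centered (ψ : ℝ → ℝ) (G : (ℕ → ℝ) → ℝ) (ε : ℤ → Ω → ℝ) (P : Measure Ω)
    (ω : Ω) (l i : ℕ) (t : ℝ) : ℝ :=
  psiVersion ψ G ε P l t (shift ε i ω) - ∫ x, psiVersion ψ G ε P l t x ∂(past ε P)

theorem IsIIDPair.integral_shift_comp (hε : IsIIDPair ε ε' P) (k : ℤ) {f : (ℕ → ℝ) → ℝ}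
    (hf : Measurable f) : ∫ ω, f (shift ε k ω) ∂P = ∫ x, f x ∂(past ε P) := by
  rw [← hε.map_shift k]
  exact (integral_map (hε.measurable_shift k).aemeasurable hf.aestronglyMeasurable).symm

theorem SmoothPast.memLp [IsProbabilityMeasure P] (hε : IsIIDPair ε ε' P)
    (hψ : Measurable ψ) (hG : Measurable G) (h : SmoothPast ψ G ε P p r B θ) {l : ℕ}
    (hl : l ≤ p) {t : ℝ} (ht : |t| ≤ r) : MemLp (psiVersion ψ G ε P l t) 2 (past ε P) :=
  ⟨(hε.measurable_psiVersion_right hψ hG l t).aestronglyMeasurable,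
    (h.eLpNorm_le l hl t ht).trans_lt h.bound_lt_top⟩

theorem SmoothPast.lintegral_centered_le [IsProbabilityMeasure P] (hε : IsIIDPair ε ε' P)
    (hψ : Measurable ψ) (hG : Measurable G) (h : SmoothPast ψ G ε P p r B θ) {n l : ℕ}
    (hl : l ≤ p) (a s : ℕ → ℝ) (hs : ∀ i < n, |s i| ≤ r) :
    ∫⁻ ω, ‖∑ i ∈ Finset.range n, a i * centered ψ G ε P ω l i (s i)‖ₑ ∂P ≤
        (∑' m, θ m) * ENNReal.ofReal (√(∑ i ∈ Finset.range n, a i ^ 2)) := by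
  -- The bound to be applied asks for all indices, while only the first `n` base points are known to
  -- lie in [-r, r].
  let s' : ℕ → ℝ := fun i => if i < n then s i else 0
  have hs' : ∀ i, |s' i| ≤ r := by
    intro i
    by_cases hi : i < n
    · simp only [s', hi, if_true]; exact hs i hi
    · simp only [s', hi, if_false, abs_zero]; exact h.pos.le
  have key := hε.lintegral_sum_centered_le n (h := fun i => psiVersion ψ G ε P l (s' i))
    (fun i => hε.measurable_psiVersion_right hψ hG l _)
    (fun i => h.memLp hε hψ hG hl (hs' i)) (fun i m => h.projNorm_le l hl _ (hs' i) m) a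
  refine le_of_eq_of_le (lintegral_congr fun ω => ?_) key
  congr 1
  refine Finset.sum_congr rfl fun i hi => ?_
  have : s' i = s i := if_pos (Finset.mem_range.1 hi)
  rw [this, centered]

theorem IsIIDPair.measurable_centered [IsProbabilityMeasure P] (hε : IsIIDPair ε ε' P)
    (hψ : Measurable ψ) (hG : Measurable G) (l i : ℕ) :
    Measurable fun q : ℝ × Ω => centered ψ G ε P q.2 l i q.1 := by
  have := hε.isProbabilityMeasure_past
  have h0 := hε.measurable_psiVersion (P := P) hψ hG l
  refine Measurable.sub ?_ ?_
  · exact h0.comp (measurable_fst.prodMk ((hε.measurable_shift i).comp measurable_snd))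
  · have : Measurable fun t => ∫ x, psiVersion ψ G ε P l t x ∂(past ε P) :=
      (h0.stronglyMeasurable.integral_prod_right' (ν := past ε P)).measurable
    exact this.comp measurable_fst

theorem SmoothPast.abs_mean_le [IsProbabilityMeasure P] (hε : IsIIDPair ε ε' P)
    (hψ : Measurable ψ) (hG : Measurable G) (h : SmoothPast ψ G ε P p r B θ) {l : ℕ}
    (hl : l ≤ p) {t : ℝ} (ht : |t| ≤ r) :
    |∫ x, psiVersion ψ G ε P l t x ∂(past ε P)| ≤ B.toReal := by
  have := hε.isProbabilityMeasure_past
  have h1 : ‖∫ x, psiVersion ψ G ε P l t x ∂(past ε P)‖ₑ ≤ B := by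
    refine (enorm_integral_le_lintegral_enorm _).trans ?_
    rw [← eLpNorm_one_eq_lintegral_enorm]
    exact (eLpNorm_le_eLpNorm_of_exponent_le one_le_two
      (h.memLp hε hψ hG hl ht).1).trans (h.eLpNorm_le l hl t ht)
  rw [← Real.norm_eq_abs, ← toReal_enorm]
  exact ENNReal.toReal_mono h.bound_lt_top.ne h1

theorem SmoothPast.exists_bound [IsProbabilityMeasure P] (hε : IsIIDPair ε ε' P)
    (hψ : Measurable ψ) (hG : Measurable G) (h : SmoothPast ψ G ε P p r B θ) (i : ℕ) :
    ∀ᵐ ω ∂P, ∀ l ≤ p, ∃ C, ∀ t : ℝ, |t| ≤ r → |centered ψ G ε P ω l i t| ≤ C := by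
  filter_upwards [h.continuousOn i] with ω hω l hl
  obtain ⟨C, hC⟩ := isCompact_Icc.exists_bound_of_continuousOn (hω l hl)
  refine ⟨C + B.toReal, fun t ht => ?_⟩
  have h1 := hC t (abs_le.1 ht)
  have h2 := h.abs_mean_le hε hψ hG hl ht
  rw [Real.norm_eq_abs] at h1
  exact (abs_sub _ _).trans (add_le_add h1 h2)

theorem mem_uIcc_abs_le {x y t r : ℝ} (hx : |x| ≤ r) (hy : |y| ≤ r) (ht : t ∈ Set.uIcc x y) :
    |t| ≤ r := by
  have h1 := abs_le.1 hx
  have h2 := abs_le.1 hy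
  have : Set.uIcc x y ⊆ Set.Icc (-r) r := Set.uIcc_subset_Icc h1 h2
  exact abs_le.2 (this ht)

theorem SmoothPast.sub_eq_integral (h : SmoothPast ψ G ε P p r B θ) (i : ℕ) :
    ∀ᵐ ω ∂P, ∀ l < p, ∀ x y : ℝ, |x| ≤ r → |y| ≤ r →
      IntervalIntegrable (fun t => psiVersion ψ G ε P (l + 1) t (shift ε i ω)) volume x y ∧
      psiVersion ψ G ε P l y (shift ε i ω) - psiVersion ψ G ε P l x (shift ε i ω) =
        ∫ t in x..y, psiVersion ψ G ε P (l + 1) t (shift ε i ω) := by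
  filter_upwards [h.continuousOn i, h.hasDerivAt i] with ω hc hd l hl x y hx hy
  have hi : IntervalIntegrable (fun t => psiVersion ψ G ε P (l + 1) t (shift ε i ω))
      volume x y :=
    ((hc (l + 1) hl).mono fun t ht => abs_le.1 (mem_uIcc_abs_le hx hy ht)).intervalIntegrable
  refine ⟨hi, (intervalIntegral.integral_eq_sub_of_hasDerivAt
    (f := fun t => psiVersion ψ G ε P l t (shift ε i ω)) (fun t ht => ?_) hi).symm⟩
  exact hd l hl t (mem_uIcc_abs_le hx hy ht)

theorem SmoothPast.integrable_prod [IsProbabilityMeasure P] (hε : IsIIDPair ε ε' P)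
    (hψ : Measurable ψ) (hG : Measurable G) (h : SmoothPast ψ G ε P p r B θ) {l : ℕ}
    (hl : l ≤ p) {x y : ℝ} (hx : |x| ≤ r) (hy : |y| ≤ r) :
    Integrable (Function.uncurry fun (t : ℝ) (ω : Ω) => psiVersion ψ G ε P l t (shift ε (0 : ℕ) ω))
      ((volume.restrict (Set.uIoc x y)).prod P) := by
  have := hε.isProbabilityMeasure_past
  have hjm : Measurable (Function.uncurry fun (t : ℝ) (ω : Ω) =>
      psiVersion ψ G ε P l t (shift ε (0 : ℕ) ω)) :=
    (hε.measurable_psiVersion (P := P) hψ hG l).comp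
      (measurable_fst.prodMk ((hε.measurable_shift _).comp measurable_snd))
  refine ⟨hjm.aestronglyMeasurable, ?_⟩
  rw [HasFiniteIntegral, lintegral_prod _ hjm.enorm.aemeasurable]
  refine lt_of_le_of_lt (b := ∫⁻ _ in Set.uIoc x y, B) ?_ ?_
  · refine setLIntegral_mono' measurableSet_uIoc fun t ht => ?_
    have ht' : |t| ≤ r := mem_uIcc_abs_le hx hy (Set.uIoc_subset_uIcc ht)
    have h1 := hε.lintegral_shift_comp ((0 : ℕ) : ℤ)
      (f := fun z => ‖psiVersion ψ G ε P l t z‖ₑ)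
      (hε.measurable_psiVersion_right hψ hG l t).enorm.aemeasurable
    refine h1.trans_le ?_
    rw [← eLpNorm_one_eq_lintegral_enorm]
    exact (eLpNorm_le_eLpNorm_of_exponent_le one_le_two
      (h.memLp hε hψ hG hl ht').1).trans (h.eLpNorm_le l hl t ht')
  · rw [setLIntegral_const]
    exact ENNReal.mul_lt_top h.bound_lt_top (by simp)

/-- Fubini, justified by the uniform L² bound, carries the fundamental theorem of calculus from the
paths to their mean and avoids differentiating under the expectation. -/
theorem SmoothPast.mean_sub_eq_integral [IsProbabilityMeasure P] (hε : IsIIDPair ε ε' P)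
    (hψ : Measurable ψ) (hG : Measurable G) (h : SmoothPast ψ G ε P p r B θ) {l : ℕ}
    (hl : l < p) {x y : ℝ} (hx : |x| ≤ r) (hy : |y| ≤ r) :
    IntervalIntegrable (fun t => ∫ z, psiVersion ψ G ε P (l + 1) t z ∂(past ε P)) volume x y ∧
    ∫ z, psiVersion ψ G ε P l y z ∂(past ε P) - ∫ z, psiVersion ψ G ε P l x z ∂(past ε P) =
      ∫ t in x..y, ∫ z, psiVersion ψ G ε P (l + 1) t z ∂(past ε P) := by
  have := hε.isProbabilityMeasure_past
  have hcomp : ∀ l t, ∫ z, psiVersion ψ G ε P l t z ∂(past ε P) =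
      ∫ ω, psiVersion ψ G ε P l t (shift ε (0 : ℕ) ω) ∂P := fun l t =>
    (hε.integral_shift_comp _ (hε.measurable_psiVersion_right hψ hG l t)).symm
  have hint : ∀ {t : ℝ}, |t| ≤ r →
      Integrable (fun ω => psiVersion ψ G ε P l t (shift ε (0 : ℕ) ω)) P := fun ht =>
    (hε.measurePreserving_shift _).integrable_comp_of_integrable
      ((h.memLp hε hψ hG hl.le ht).integrable one_le_two)
  have hprod := h.integrable_prod hε hψ hG (l := l + 1) hl hx hy
  simp_rw [hcomp]
  constructor
  · rw [intervalIntegrable_iff]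
    exact hprod.integral_prod_left
  · rw [intervalIntegral_integral_swap hprod, ← integral_sub (hint hy) (hint hx)]
    refine integral_congr_ae ?_
    filter_upwards [h.sub_eq_integral 0] with ω hω
    exact (hω l hl x y hx hy).2

theorem SmoothPast.centered_sub_eq_integral [IsProbabilityMeasure P] (hε : IsIIDPair ε ε' P)
    (hψ : Measurable ψ) (hG : Measurable G) (h : SmoothPast ψ G ε P p r B θ) (i : ℕ) :
    ∀ᵐ ω ∂P, ∀ l < p, ∀ x y : ℝ, |x| ≤ r → |y| ≤ r →
      centered ψ G ε P ω l i y - centered ψ G ε P ω l i x =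
        ∫ t in x..y, centered ψ G ε P ω (l + 1) i t := by
  filter_upwards [h.sub_eq_integral i] with ω hω l hl x y hx hy
  obtain ⟨h1, h2⟩ := hω l hl x y hx hy
  obtain ⟨h3, h4⟩ := h.mean_sub_eq_integral hε hψ hG hl hx hy
  simp only [centered]
  rw [intervalIntegral.integral_sub h1 h3, ← h2, ← h4]
  ring

end Centered

/-! ### An exponential supermartingale and the resulting deviation bound -/

section Exponential

theorem exp_le_one_add_add_sq {x : ℝ} (hx : |x| ≤ 1) : Real.exp x ≤ 1 + x + x ^ 2 := by
  have := (abs_le.1 (Real.abs_exp_sub_one_sub_id_le hx)).2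
  linarith

/-- Integrate exp x ≤ 1 + x + x², valid on [-1, 1], and use 1 + y ≤ exp y. The exponent on the right
is exactly the compensator subtracted in `expoPath`. -/
theorem lintegral_exp_mul_le {μ : Measure ℝ} [IsProbabilityMeasure μ] {f : ℝ → ℝ}
    (hf : Measurable f) {A lam : ℝ} (hA : ∀ u, |f u| ≤ A) (hlam : |lam| * A ≤ 1) :
    ∫⁻ u, ENNReal.ofReal (Real.exp (lam * f u)) ∂μ ≤
      ENNReal.ofReal (Real.exp (lam * ∫ u, f u ∂μ + lam ^ 2 * ∫ u, f u ^ 2 ∂μ)) := by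
  have hi : Integrable f μ := .of_bound hf.aestronglyMeasurable A (Eventually.of_forall hA)
  have hi2 : Integrable (fun u => f u ^ 2) μ :=
    .of_bound (hf.pow_const 2).aestronglyMeasurable (A ^ 2) (Eventually.of_forall fun u => by
      rw [Real.norm_eq_abs, abs_pow]
      exact pow_le_pow_left₀ (abs_nonneg _) (hA u) 2)
  have hb : ∀ u, |lam * f u| ≤ 1 := fun u => by
    rw [abs_mul]
    exact (mul_le_mul_of_nonneg_left (hA u) (abs_nonneg _)).trans hlam
  have hg : Integrable (fun u => 1 + lam * f u + lam ^ 2 * f u ^ 2) μ :=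
    ((integrable_const _).add (hi.const_mul _)).add (hi2.const_mul _)
  have hpos : ∀ u, 0 ≤ 1 + lam * f u + lam ^ 2 * f u ^ 2 := fun u => by
    have := (Real.exp_pos _).le.trans (exp_le_one_add_add_sq (hb u))
    rwa [mul_pow] at this
  calc _ ≤ ∫⁻ u, ENNReal.ofReal (1 + lam * f u + lam ^ 2 * f u ^ 2) ∂μ := by
        refine lintegral_mono fun u => ENNReal.ofReal_le_ofReal ?_
        have := exp_le_one_add_add_sq (hb u)
        rwa [mul_pow] at this
    _ = ENNReal.ofReal (∫ u, (1 + lam * f u + lam ^ 2 * f u ^ 2) ∂μ) :=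
        (ofReal_integral_eq_lintegral_ofReal hg (Eventually.of_forall hpos)).symm
    _ ≤ _ := by
        refine ENNReal.ofReal_le_ofReal ?_
        have e1 : ∫ u, (1 + lam * f u + lam ^ 2 * f u ^ 2) ∂μ =
            1 + lam * ∫ u, f u ∂μ + lam ^ 2 * ∫ u, f u ^ 2 ∂μ := by
          have i1 : Integrable (fun u => 1 + lam * f u) μ :=
            (integrable_const _).add (hi.const_mul _)
          rw [integral_add i1 (hi2.const_mul _),
            integral_add (integrable_const _) (hi.const_mul _), integral_const_mul,
            integral_const_mul]
          simp
        rw [e1]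
        have := Real.add_one_le_exp (lam * ∫ u, f u ∂μ + lam ^ 2 * ∫ u, f u ^ 2 ∂μ)
        linarith

variable {Ω : Type*} [MeasurableSpace Ω] {P : Measure Ω} {ε ε' : ℤ → Ω → ℝ}

/-- The sum of the functionals `η i` of the past, each compensated by its prediction one step
ahead. -/
noncomputable def compSum (ε : ℤ → Ω → ℝ) (P : Measure Ω) (η : ℕ → (ℕ → ℝ) → ℝ) (n : ℕ)
    (ω : Ω) : ℝ :=
  ∑ i ∈ Finset.range n, (η i (shift ε ((i : ℤ) + 1) ω) -
    ∫ u, η i (append u (shift ε i ω)) ∂(innov ε P))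

/-- The predictable quadratic variation attached to the functionals `η i`. -/
noncomputable def predVar (ε : ℤ → Ω → ℝ) (P : Measure Ω) (η : ℕ → (ℕ → ℝ) → ℝ) (n : ℕ)
    (ω : Ω) : ℝ :=
  ∑ i ∈ Finset.range n, ∫ u, η i (append u (shift ε i ω)) ^ 2 ∂(innov ε P)

theorem IsIIDPair.measurable_integral_append [IsProbabilityMeasure P] (hε : IsIIDPair ε ε' P)
    {f : (ℕ → ℝ) → ℝ} (hf : Measurable f) :
    Measurable fun x => ∫ u, f (append u x) ∂(innov ε P) := by
  have := hε.isProbabilityMeasure_innov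
  exact ((hf.comp measurable_append).stronglyMeasurable.integral_prod_left').measurable

/-- The exponential supermartingale as a functional of the past. -/
noncomputable def expoPath (ε : ℤ → Ω → ℝ) (P : Measure Ω) (η : ℕ → (ℕ → ℝ) → ℝ) (lam : ℝ) :
    ℕ → (ℕ → ℝ) → ℝ
  | 0 => fun _ => 0
  | n + 1 => fun y => expoPath ε P η lam n (drop 1 y) + lam * η n y -
      (lam * ∫ u, η n (append u (drop 1 y)) ∂(innov ε P) +
        lam ^ 2 * ∫ u, η n (append u (drop 1 y)) ^ 2 ∂(innov ε P))

theorem drop_one_append (u : ℝ) (x : ℕ → ℝ) : drop 1 (append u x) = x := rfl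

theorem drop_one_shift (k : ℤ) (ω : Ω) : drop 1 (shift ε (k + 1) ω) = shift ε k ω := by
  rw [drop_shift]
  simp

theorem expoPath_shift (η : ℕ → (ℕ → ℝ) → ℝ) (lam : ℝ) (n : ℕ) (ω : Ω) :
    expoPath ε P η lam n (shift ε n ω) =
      lam * compSum ε P η n ω - lam ^ 2 * predVar ε P η n ω := by
  induction n with
  | zero => simp [expoPath, compSum, predVar]
  | succ n ih =>
    have : ((n + 1 : ℕ) : ℤ) = (n : ℤ) + 1 := by push_cast; ring
    simp only [expoPath]
    rw [this, drop_one_shift, ih, compSum, compSum, predVar, predVar,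
      Finset.sum_range_succ, Finset.sum_range_succ]
    ring

theorem IsIIDPair.measurable_expoPath [IsProbabilityMeasure P] (hε : IsIIDPair ε ε' P)
    {η : ℕ → (ℕ → ℝ) → ℝ} (hη : ∀ i, Measurable (η i)) (lam : ℝ) (n : ℕ) :
    Measurable (expoPath ε P η lam n) := by
  induction n with
  | zero => exact measurable_const
  | succ n ih =>
    have hd := measurable_drop 1
    refine ((ih.comp hd).add ((hη n).const_mul lam)).sub (Measurable.add ?_ ?_)
    · exact ((hε.measurable_integral_append (hη n)).comp hd).const_mul lam
    · exact ((hε.measurable_integral_append ((hη n).pow_const 2)).comp hd).const_mul _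

/-- Integrating out the newest innovation produces a factor cancelled by the compensator, so the
expectation does not increase with `n`. -/
theorem IsIIDPair.lintegral_exp_expoPath_le [IsProbabilityMeasure P] (hε : IsIIDPair ε ε' P)
    {η : ℕ → (ℕ → ℝ) → ℝ} (hη : ∀ i, Measurable (η i)) {A lam : ℝ} (hA : ∀ i y, |η i y| ≤ A)
    (hlam : |lam| * A ≤ 1) (n : ℕ) :
    ∫⁻ ω, ENNReal.ofReal (Real.exp (expoPath ε P η lam n (shift ε n ω))) ∂P ≤ 1 := by
  have := hε.isProbabilityMeasure_innov
  induction n with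
  | zero => simp [expoPath]
  | succ n ih =>
    have hcast : ((n + 1 : ℕ) : ℤ) = (n : ℤ) + 1 := by push_cast; ring
    have hm : Measurable fun y => ENNReal.ofReal (Real.exp (expoPath ε P η lam (n + 1) y)) :=
      (Real.measurable_exp.comp (hε.measurable_expoPath hη lam (n + 1))).ennreal_ofReal
    rw [hcast, hε.lintegral_shift_succ n hm]
    refine (lintegral_mono fun ω => ?_).trans ih
    have e : ∀ u x, ENNReal.ofReal (Real.exp (expoPath ε P η lam (n + 1) (append u x))) =
        ENNReal.ofReal (Real.exp (expoPath ε P η lam n x -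
          (lam * ∫ u, η n (append u x) ∂(innov ε P) +
            lam ^ 2 * ∫ u, η n (append u x) ^ 2 ∂(innov ε P)))) *
          ENNReal.ofReal (Real.exp (lam * η n (append u x))) := by
      intro u x
      rw [← ENNReal.ofReal_mul (Real.exp_pos _).le, ← Real.exp_add]
      simp only [expoPath, drop_one_append]
      congr 2
      ring
    simp_rw [e]
    have hma : Measurable fun u => η n (append u (shift ε n ω)) :=
      (hη n).comp (measurable_append.comp (measurable_id.prodMk measurable_const))
    have hme : Measurable fun u =>
        ENNReal.ofReal (Real.exp (lam * η n (append u (shift ε n ω)))) :=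
      (Real.measurable_exp.comp (hma.const_mul lam)).ennreal_ofReal
    rw [lintegral_const_mul _ hme]
    refine (mul_le_mul_right (lintegral_exp_mul_le hma (fun u => hA n _) hlam) _).trans
      (le_of_eq ?_)
    rw [← ENNReal.ofReal_mul (Real.exp_pos _).le, ← Real.exp_add]
    congr 2
    ring

/-- Markov's inequality for the exponential supermartingale. The predictable variation is restricted
on the event itself and need not be bounded almost surely. -/
theorem IsIIDPair.measure_compSum_ge_le [IsProbabilityMeasure P] (hε : IsIIDPair ε ε' P)
    {η : ℕ → (ℕ → ℝ) → ℝ} (hη : ∀ i, Measurable (η i)) {A lam : ℝ} (hA : ∀ i y, |η i y| ≤ A)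
    (hlam0 : 0 ≤ lam) (hlam : lam * A ≤ 1) (n : ℕ) (K q : ℝ) :
    P {ω | K ≤ compSum ε P η n ω ∧ predVar ε P η n ω ≤ q} ≤
      ENNReal.ofReal (Real.exp (-(lam * K) + lam ^ 2 * q)) := by
  have h1 := hε.lintegral_exp_expoPath_le hη hA (by rwa [abs_of_nonneg hlam0]) n
  set E := ENNReal.ofReal (Real.exp (lam * K - lam ^ 2 * q)) with hE
  have hm : Measurable fun ω =>
      ENNReal.ofReal (Real.exp (expoPath ε P η lam n (shift ε n ω))) :=
    (Real.measurable_exp.comp ((hε.measurable_expoPath hη lam n).comp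
      (hε.measurable_shift n))).ennreal_ofReal
  have h2 := (mul_meas_ge_le_lintegral hm E).trans h1
  have hsub : {ω | K ≤ compSum ε P η n ω ∧ predVar ε P η n ω ≤ q} ⊆
      {ω | E ≤ ENNReal.ofReal (Real.exp (expoPath ε P η lam n (shift ε n ω)))} := by
    rintro ω ⟨ha, hb⟩
    refine ENNReal.ofReal_le_ofReal (Real.exp_le_exp.2 ?_)
    rw [expoPath_shift]
    have := mul_le_mul_of_nonneg_left ha hlam0
    have := mul_le_mul_of_nonneg_left hb (sq_nonneg lam)
    linarith
  have hE0 : E ≠ 0 := by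
    rw [hE, Ne, ENNReal.ofReal_eq_zero, not_le]
    exact Real.exp_pos _
  calc _ ≤ P {ω | E ≤ ENNReal.ofReal (Real.exp (expoPath ε P η lam n (shift ε n ω)))} :=
        measure_mono hsub
    _ ≤ 1 / E := by
        rw [ENNReal.le_div_iff_mul_le (Or.inl hE0) (Or.inl ENNReal.ofReal_ne_top), mul_comm]
        exact h2
    _ = _ := by
        rw [hE, one_div, ← ENNReal.ofReal_inv_of_pos (Real.exp_pos _), ← Real.exp_neg]
        congr 2
        ring

theorem compSum_neg (η : ℕ → (ℕ → ℝ) → ℝ) (n : ℕ) (ω : Ω) :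
    compSum ε P (fun i y => -η i y) n ω = -compSum ε P η n ω := by
  simp only [compSum, ← Finset.sum_neg_distrib, integral_neg]
  exact Finset.sum_congr rfl fun i _ => by ring

theorem IsIIDPair.measure_abs_compSum_ge_le [IsProbabilityMeasure P] (hε : IsIIDPair ε ε' P)
    {η : ℕ → (ℕ → ℝ) → ℝ} (hη : ∀ i, Measurable (η i)) {A lam : ℝ} (hA : ∀ i y, |η i y| ≤ A)
    (hlam0 : 0 ≤ lam) (hlam : lam * A ≤ 1) (n : ℕ) (K q : ℝ) :
    P {ω | K ≤ |compSum ε P η n ω| ∧ predVar ε P η n ω ≤ q} ≤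
      2 * ENNReal.ofReal (Real.exp (-(lam * K) + lam ^ 2 * q)) := by
  have h1 := hε.measure_compSum_ge_le hη hA hlam0 hlam n K q
  have h2 := hε.measure_compSum_ge_le (η := fun i y => -η i y) (fun i => (hη i).neg)
    (fun i y => by rw [abs_neg]; exact hA i y) hlam0 hlam n K q
  have hsub : {ω | K ≤ |compSum ε P η n ω| ∧ predVar ε P η n ω ≤ q} ⊆
      {ω | K ≤ compSum ε P η n ω ∧ predVar ε P η n ω ≤ q} ∪
      {ω | K ≤ compSum ε P (fun i y => -η i y) n ω ∧
        predVar ε P (fun i y => -η i y) n ω ≤ q} := by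
    rintro ω ⟨ha, hb⟩
    rcases le_abs.1 ha with h | h
    · exact Or.inl ⟨h, hb⟩
    · refine Or.inr ⟨by rwa [compSum_neg], ?_⟩
      simpa only [predVar, neg_sq] using hb
  refine (measure_mono hsub).trans ((measure_union_le _ _).trans ?_)
  rw [two_mul]
  exact add_le_add h1 h2

end Exponential

/-! ### Truncation by an envelope and a finite maximal inequality -/

section Truncation

variable {Ω : Type*} [MeasurableSpace Ω] {P : Measure Ω} {ε ε' : ℤ → Ω → ℝ}

/-- Truncation of `η` where its envelope `D` exceeds `A`. -/
noncomputable def truncate (η D : ℕ → (ℕ → ℝ) → ℝ) (A : ℝ) (i : ℕ) (y : ℕ → ℝ) : ℝ :=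
  open Classical in if D i y ≤ A then η i y else 0

theorem measurable_truncate {η D : ℕ → (ℕ → ℝ) → ℝ} (hη : ∀ i, Measurable (η i))
    (hD : ∀ i, Measurable (D i)) (A : ℝ) (i : ℕ) : Measurable (truncate η D A i) :=
  Measurable.ite (measurableSet_le (hD i) measurable_const) (hη i) measurable_const

theorem abs_truncate_le {η D : ℕ → (ℕ → ℝ) → ℝ} {A : ℝ} (hA : 0 ≤ A)
    (hηD : ∀ i y, |η i y| ≤ D i y) (i : ℕ) (y : ℕ → ℝ) : |truncate η D A i y| ≤ A := by
  unfold truncate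
  split_ifs with h
  · exact (hηD i y).trans h
  · simpa using hA

theorem abs_truncate_le_envelope {η D : ℕ → (ℕ → ℝ) → ℝ} (A : ℝ)
    (hηD : ∀ i y, |η i y| ≤ D i y) (i : ℕ) (y : ℕ → ℝ) : |truncate η D A i y| ≤ D i y := by
  unfold truncate
  split_ifs with h
  · exact hηD i y
  · simpa using (abs_nonneg _).trans (hηD i y)

/-- Where the truncation acts, D > A, hence |η| ≤ D ≤ D²/A. -/
theorem abs_sub_truncate_le {η D : ℕ → (ℕ → ℝ) → ℝ} {A : ℝ} (hA : 0 < A)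
    (hηD : ∀ i y, |η i y| ≤ D i y) (i : ℕ) (y : ℕ → ℝ) :
    |η i y - truncate η D A i y| ≤ D i y ^ 2 / A := by
  unfold truncate
  split_ifs with h
  · rw [sub_self, abs_zero]; positivity
  · rw [sub_zero, le_div_iff₀ hA]
    have h0 := (abs_nonneg _).trans (hηD i y)
    have h1 := hηD i y
    rw [not_le] at h
    nlinarith [abs_nonneg (η i y)]

/-- Realised plus predicted sum of squares of the envelope. -/
noncomputable def envVar (ε : ℤ → Ω → ℝ) (P : Measure Ω) (D : ℕ → (ℕ → ℝ) → ℝ) (n : ℕ)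
    (ω : Ω) : ℝ≥0∞ :=
  ∑ i ∈ Finset.range n, (ENNReal.ofReal (D i (shift ε ((i : ℤ) + 1) ω) ^ 2) +
    ∫⁻ u, ENNReal.ofReal (D i (append u (shift ε i ω)) ^ 2) ∂(innov ε P))

theorem measurable_append_left {D : (ℕ → ℝ) → ℝ} (hD : Measurable D) (x : ℕ → ℝ) :
    Measurable fun u => D (append u x) :=
  hD.comp (measurable_append.comp (measurable_id.prodMk measurable_const))

theorem integrable_sq_of_envVar_lt_top {D : ℕ → (ℕ → ℝ) → ℝ} (hD : ∀ i, Measurable (D i))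
    {n : ℕ} {ω : Ω} (h : envVar ε P D n ω < ∞) {i : ℕ} (hi : i < n) :
    Integrable (fun u => D i (append u (shift ε i ω)) ^ 2) (innov ε P) := by
  refine ⟨((measurable_append_left (hD i) _).pow_const 2).aestronglyMeasurable, ?_⟩
  rw [hasFiniteIntegral_iff_ofReal (Eventually.of_forall fun _ => sq_nonneg _)]
  have h1 := ENNReal.sum_lt_top.1 h i (Finset.mem_range.2 hi)
  exact (ENNReal.add_lt_top.1 h1).2

theorem envVar_eq_ofReal {D : ℕ → (ℕ → ℝ) → ℝ} (hD : ∀ i, Measurable (D i)) {n : ℕ} {ω : Ω}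
    (h : envVar ε P D n ω < ∞) : envVar ε P D n ω = ENNReal.ofReal
      (∑ i ∈ Finset.range n, (D i (shift ε ((i : ℤ) + 1) ω) ^ 2 +
        ∫ u, D i (append u (shift ε i ω)) ^ 2 ∂(innov ε P))) := by
  rw [ENNReal.ofReal_sum_of_nonneg fun i _ => add_nonneg (sq_nonneg _)
    (integral_nonneg fun _ => sq_nonneg _)]
  refine Finset.sum_congr rfl fun i hi => ?_
  rw [ENNReal.ofReal_add (sq_nonneg _) (integral_nonneg fun _ => sq_nonneg _),
    ofReal_integral_eq_lintegral_ofReal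
      (integrable_sq_of_envVar_lt_top hD h (Finset.mem_range.1 hi))
      (Eventually.of_forall fun _ => sq_nonneg _)]

theorem IsIIDPair.integrable_envelope [IsProbabilityMeasure P] (hε : IsIIDPair ε ε' P)
    {D : ℕ → (ℕ → ℝ) → ℝ} (hD : ∀ i, Measurable (D i))
    {n : ℕ} {ω : Ω} (h : envVar ε P D n ω < ∞) {i : ℕ} (hi : i < n) :
    Integrable (fun u => D i (append u (shift ε i ω))) (innov ε P) := by
  have := hε.isProbabilityMeasure_innov
  have h2 : MemLp (fun u => D i (append u (shift ε i ω))) 2 (innov ε P) :=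
    (memLp_two_iff_integrable_sq (measurable_append_left (hD i) _).aestronglyMeasurable).2
      (integrable_sq_of_envVar_lt_top hD h hi)
  exact h2.integrable one_le_two

/-- Truncation changes both the realised terms and their predictions, each by at most the
corresponding square of the envelope over A. This is why `envVar` adds the two kinds of squares; its
predicted half also dominates the predictable variation. -/
theorem IsIIDPair.abs_compSum_sub_truncate_le [IsProbabilityMeasure P] (hε : IsIIDPair ε ε' P)
    {η D : ℕ → (ℕ → ℝ) → ℝ} (hη : ∀ i, Measurable (η i)) (hD : ∀ i, Measurable (D i))
    (hηD : ∀ i y, |η i y| ≤ D i y) {A q : ℝ} (hA : 0 < A) {n : ℕ} {ω : Ω} (hq : 0 ≤ q)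
    (h : envVar ε P D n ω ≤ ENNReal.ofReal q) :
    |compSum ε P η n ω - compSum ε P (truncate η D A) n ω| ≤ q / A ∧
      predVar ε P (truncate η D A) n ω ≤ q := by
  have := hε.isProbabilityMeasure_innov
  have hlt : envVar ε P D n ω < ∞ := h.trans_lt ENNReal.ofReal_lt_top
  rw [envVar_eq_ofReal hD hlt, ENNReal.ofReal_le_ofReal_iff hq] at h
  have hDi := fun {i} (hi : i < n) => hε.integrable_envelope hD hlt hi
  have hD2 := fun {i} (hi : i < n) => integrable_sq_of_envVar_lt_top hD hlt hi
  have hmt := measurable_truncate hη hD A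
  have hηi : ∀ {i}, i < n → Integrable (fun u => η i (append u (shift ε i ω))) (innov ε P) :=
    fun {i} hi => (hDi hi).mono' (measurable_append_left (hη i) _).aestronglyMeasurable
      (Eventually.of_forall fun u => hηD i _)
  have hti : ∀ {i}, i < n →
      Integrable (fun u => truncate η D A i (append u (shift ε i ω))) (innov ε P) :=
    fun {i} hi => (hDi hi).mono' (measurable_append_left (hmt i) _).aestronglyMeasurable
      (Eventually.of_forall fun u => abs_truncate_le_envelope A hηD i _)
  constructor
  · refine le_trans ?_ (div_le_div_of_nonneg_right h hA.le)
    rw [compSum, compSum, ← Finset.sum_sub_distrib, Finset.sum_div]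
    refine (Finset.abs_sum_le_sum_abs _ _).trans (Finset.sum_le_sum fun i hi => ?_)
    have hi := Finset.mem_range.1 hi
    have e : η i (shift ε ((i : ℤ) + 1) ω) - ∫ u, η i (append u (shift ε i ω)) ∂(innov ε P) -
        (truncate η D A i (shift ε ((i : ℤ) + 1) ω) -
          ∫ u, truncate η D A i (append u (shift ε i ω)) ∂(innov ε P)) =
        (η i (shift ε ((i : ℤ) + 1) ω) - truncate η D A i (shift ε ((i : ℤ) + 1) ω)) -
        ∫ u, (η i (append u (shift ε i ω)) - truncate η D A i (append u (shift ε i ω)))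
          ∂(innov ε P) := by
      rw [integral_sub (hηi hi) (hti hi)]; ring
    rw [e, add_div]
    refine (abs_sub _ _).trans (add_le_add (abs_sub_truncate_le hA hηD i _) ?_)
    refine (abs_integral_le_integral_abs).trans ?_
    rw [← integral_div]
    refine integral_mono ((hηi hi).sub (hti hi)).abs ((hD2 hi).div_const A) fun u => ?_
    exact abs_sub_truncate_le hA hηD i _
  · refine le_trans (Finset.sum_le_sum fun i hi => ?_) h
    have hi := Finset.mem_range.1 hi
    refine le_add_of_nonneg_of_le (sq_nonneg _) ?_
    have hsq : ∀ u, truncate η D A i (append u (shift ε i ω)) ^ 2 ≤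
        D i (append u (shift ε i ω)) ^ 2 := fun u =>
      sq_le_sq.2 ((abs_truncate_le_envelope A hηD i _).trans (le_abs_self _))
    refine integral_mono ((hD2 hi).mono'
      ((measurable_append_left (hmt i) _).pow_const 2).aestronglyMeasurable
      (Eventually.of_forall fun u => ?_)) (hD2 hi) hsq
    rw [Real.norm_eq_abs, abs_of_nonneg (sq_nonneg _)]
    exact hsq u

theorem IsIIDPair.lintegral_envVar [IsProbabilityMeasure P] (hε : IsIIDPair ε ε' P)
    {D : ℕ → (ℕ → ℝ) → ℝ} (hD : ∀ i, Measurable (D i)) (n : ℕ) :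
    ∫⁻ ω, envVar ε P D n ω ∂P =
      2 * ∑ i ∈ Finset.range n, ∫⁻ y, ENNReal.ofReal (D i y ^ 2) ∂(past ε P) := by
  have := hε.isProbabilityMeasure_innov
  have hm : ∀ i, Measurable fun y => ENNReal.ofReal (D i y ^ 2) := fun i =>
    ((hD i).pow_const 2).ennreal_ofReal
  have h1 : ∀ i : ℕ, Measurable fun ω => ENNReal.ofReal (D i (shift ε ((i : ℤ) + 1) ω) ^ 2) :=
    fun i => (hm i).comp (hε.measurable_shift _)
  have h2 : ∀ i : ℕ, Measurable fun ω =>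
      ∫⁻ u, ENNReal.ofReal (D i (append u (shift ε i ω)) ^ 2) ∂(innov ε P) := fun i =>
    (((hm i).comp measurable_append).lintegral_prod_left').comp (hε.measurable_shift i)
  have h3 : ∀ i : ℕ, Measurable fun ω => ENNReal.ofReal (D i (shift ε ((i : ℤ) + 1) ω) ^ 2) +
      ∫⁻ u, ENNReal.ofReal (D i (append u (shift ε i ω)) ^ 2) ∂(innov ε P) := fun i =>
    (h1 i).add (h2 i)
  simp only [envVar]
  rw [lintegral_finsetSum _ fun i _ => h3 i, Finset.mul_sum]
  refine Finset.sum_congr rfl fun i _ => ?_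
  rw [lintegral_add_left (h1 i), ← hε.lintegral_shift_succ i (hm i),
    hε.lintegral_shift_comp _ (hm i).aemeasurable, two_mul]

theorem IsIIDPair.measurable_envVar [IsProbabilityMeasure P] (hε : IsIIDPair ε ε' P)
    {D : ℕ → (ℕ → ℝ) → ℝ} (hD : ∀ i, Measurable (D i)) (n : ℕ) :
    Measurable (envVar ε P D n) := by
  have := hε.isProbabilityMeasure_innov
  have hm : ∀ i, Measurable fun y => ENNReal.ofReal (D i y ^ 2) := fun i =>
    ((hD i).pow_const 2).ennreal_ofReal
  have h1 : ∀ i : ℕ, Measurable fun ω => ENNReal.ofReal (D i (shift ε ((i : ℤ) + 1) ω) ^ 2) :=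
    fun i => (hm i).comp (hε.measurable_shift _)
  have h2 : ∀ i : ℕ, Measurable fun ω =>
      ∫⁻ u, ENNReal.ofReal (D i (append u (shift ε i ω)) ^ 2) ∂(innov ε P) := fun i =>
    (((hm i).comp measurable_append).lintegral_prod_left').comp (hε.measurable_shift i)
  exact Finset.measurable_fun_sum _ fun i _ => (h1 i).add (h2 i)

/-- A maximal inequality over a finite family of compensated sums with a common envelope. -/
theorem IsIIDPair.measure_exists_abs_compSum_gt_le [IsProbabilityMeasure P]
    (hε : IsIIDPair ε ε' P) {J : Type*} [Fintype J] {η : J → ℕ → (ℕ → ℝ) → ℝ}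
    {D : ℕ → (ℕ → ℝ) → ℝ} (hη : ∀ j i, Measurable (η j i)) (hD : ∀ i, Measurable (D i))
    (hηD : ∀ j i y, |η j i y| ≤ D i y) {A q : ℝ} (hA : 0 < A) (hq : 0 ≤ q) (n : ℕ) (K : ℝ) :
    P {ω | envVar ε P D n ω ≤ ENNReal.ofReal q ∧ ∃ j, K + q / A < |compSum ε P (η j) n ω|} ≤
      Fintype.card J * (2 * ENNReal.ofReal (Real.exp (-(K / A) + q / A ^ 2))) := by
  have hsub : {ω | envVar ε P D n ω ≤ ENNReal.ofReal q ∧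
      ∃ j, K + q / A < |compSum ε P (η j) n ω|} ⊆
      ⋃ j ∈ (Finset.univ : Finset J), {ω | K ≤ |compSum ε P (truncate (η j) D A) n ω| ∧
        predVar ε P (truncate (η j) D A) n ω ≤ q} := by
    rintro ω ⟨h1, j, h2⟩
    obtain ⟨h3, h4⟩ := hε.abs_compSum_sub_truncate_le (hη j) hD (hηD j) hA hq h1
    simp only [Set.mem_iUnion]
    refine ⟨j, Finset.mem_univ j, ?_, h4⟩
    have := abs_sub_abs_le_abs_sub (compSum ε P (η j) n ω)
      (compSum ε P (truncate (η j) D A) n ω)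
    linarith
  refine (measure_mono hsub).trans ((measure_biUnion_finset_le _ _).trans ?_)
  -- The exponential parameter is λ = 1/A, the largest allowed by λA ≤ 1.
  refine (Finset.sum_le_sum fun j _ => hε.measure_abs_compSum_ge_le
    (measurable_truncate (hη j) hD A) (abs_truncate_le hA.le (hηD j)) (inv_nonneg.2 hA.le)
    (inv_mul_cancel₀ hA.ne').le n K q).trans (le_of_eq ?_)
  rw [Finset.sum_const, Finset.card_univ, nsmul_eq_mul]
  congr 4
  field_simp

end Truncation

/-! ### Identities and bounds for the normalised design -/

section DesignBounds

variable {p : ℕ} {x : ℕ → EuclideanSpace ℝ (Fin p)} {n : ℕ}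

theorem sum_Icc_one_eq_sum_range {M : Type*} [AddCommMonoid M] (f : ℕ → M) (n : ℕ) :
    ∑ i ∈ Finset.Icc 1 n, f i = ∑ i ∈ Finset.range n, f (i + 1) := by
  rw [Finset.range_eq_Ico, Finset.sum_Ico_add' f 0 n 1]
  rfl

theorem gram_nonneg (x : ℕ → EuclideanSpace ℝ (Fin p)) (n : ℕ) : 0 ≤ gram x n := by
  rw [Matrix.nonneg_iff_posSemidef]
  refine Matrix.posSemidef_sum _ fun i _ => ?_
  have := Matrix.posSemidef_vecMulVec_self_star (R := ℝ) (fun k => x i k)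
  simpa using this

/-- The sum is the trace of Σ^{-1/2} Σ Σ^{-1/2}, the identity matrix. -/
theorem sum_norm_zvec_sq (hx : IsUnit (gram x n).det) :
    ∑ i ∈ Finset.range n, ‖zvec x n (i + 1)‖ ^ 2 = p := by
  rw [← sum_Icc_one_eq_sum_range (fun i => ‖zvec x n i‖ ^ 2)]
  set S := CFC.sqrt (gram x n) with hS
  have hSS : S * S = gram x n := CFC.sqrt_mul_sqrt_self _ (gram_nonneg x n)
  have hSd : IsUnit S.det := by
    rw [← hSS, Matrix.det_mul] at hx
    exact isUnit_of_mul_isUnit_left hx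
  have hST : S.transpose = S := by
    have h0 : (0 : Matrix (Fin p) (Fin p) ℝ) ≤ S := CFC.sqrt_nonneg _
    have := (Matrix.nonneg_iff_posSemidef.1 h0).1
    rwa [Matrix.IsHermitian, Matrix.conjTranspose_eq_transpose_of_trivial] at this
  have hz : ∀ i, ‖zvec x n i‖ ^ 2 =
      (S⁻¹ * Matrix.vecMulVec (x i) (x i) * S⁻¹).trace := by
    intro i
    have e : S⁻¹ * Matrix.vecMulVec (x i) (x i) * S⁻¹ =
        Matrix.vecMulVec (Matrix.mulVec S⁻¹ (x i)) (Matrix.mulVec S⁻¹ (x i)) := by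
      rw [Matrix.mul_vecMulVec, Matrix.vecMulVec_mul]
      congr 1
      rw [← Matrix.mulVec_transpose, Matrix.transpose_nonsing_inv, hST]
    rw [e, Matrix.trace_vecMulVec, EuclideanSpace.norm_sq_eq]
    simp only [zvec, dotProduct, Real.norm_eq_abs, sq_abs, ← hS]
    exact Finset.sum_congr rfl fun k _ => by rw [sq]
  simp_rw [hz]
  rw [← Matrix.trace_sum, ← Finset.sum_mul, ← Finset.mul_sum]
  change (S⁻¹ * gram x n * S⁻¹).trace = p
  rw [← hSS, ← Matrix.mul_assoc, Matrix.nonsing_inv_mul _ hSd, Matrix.one_mul,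
    Matrix.mul_nonsing_inv _ hSd, Matrix.trace_one, Fintype.card_fin]

theorem zeta_four_eq (x : ℕ → EuclideanSpace ℝ (Fin p)) (n : ℕ) :
    zeta x n 4 = ∑ i ∈ Finset.range n, ‖zvec x n (i + 1)‖ ^ 4 := by
  rw [zeta, sum_Icc_one_eq_sum_range (fun i => ‖zvec x n i‖ ^ (4 : ℝ))]
  refine Finset.sum_congr rfl fun i _ => ?_
  exact_mod_cast Real.rpow_natCast _ 4

theorem sq_le_mul_zeta_four (hx : IsUnit (gram x n).det) : (p : ℝ) ^ 2 ≤ n * zeta x n 4 := by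
  rw [zeta_four_eq, ← sum_norm_zvec_sq hx]
  refine sq_sum_le_card_mul_sum_sq.trans (le_of_eq ?_)
  rw [Finset.card_range]
  congr 1
  exact Finset.sum_congr rfl fun i _ => by ring

theorem norm_zvec_le_rmax {i : ℕ} (hi : i < n) : ‖zvec x n (i + 1)‖ ≤ rmax x n := by
  have : ‖zvec x n (i + 1)‖₊ ≤ (Finset.Icc 1 n).sup (fun i => ‖zvec x n i‖₊) :=
    Finset.le_sup (f := fun i => ‖zvec x n i‖₊) (Finset.mem_Icc.2 ⟨by omega, by omega⟩)
  exact_mod_cast this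

/-- From Cauchy–Schwarz applied to ∑ |z_i|² = p. This lower bound on the rate absorbs the grid mesh
and the regularisation of τ. -/
theorem one_div_sqrt_le (hp : 0 < p) (hn : 0 < n) (hx : IsUnit (gram x n).det) :
    1 / √n ≤ √(zeta x n 4) := by
  have h1 := sq_le_mul_zeta_four hx
  have hp1 : (1 : ℝ) ≤ p := by exact_mod_cast hp
  have hn0 : (0 : ℝ) < n := by exact_mod_cast hn
  rw [← Real.sqrt_one, ← Real.sqrt_div' _ hn0.le]
  refine Real.sqrt_le_sqrt ?_
  rw [div_le_iff₀ hn0]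
  nlinarith

end DesignBounds

/-! ### A measurable local Lipschitz constant -/

section Lipschitz

variable {Ω : Type*} [MeasurableSpace Ω] {P : Measure Ω} {ε ε' : ℤ → Ω → ℝ}
  {ψ : ℝ → ℝ} {G : (ℕ → ℝ) → ℝ}

/-- The Lipschitz constant of `psi1` along the rational points of `[-r, r]`. -/
noncomputable def ratLip (ψ : ℝ → ℝ) (G : (ℕ → ℝ) → ℝ) (ε : ℤ → Ω → ℝ) (P : Measure Ω) (r : ℝ)
    (x : ℕ → ℝ) : ℝ≥0∞ :=
  ⨆ (s : ℚ) (t : ℚ) (_ : |(s : ℝ)| ≤ r ∧ |(t : ℝ)| ≤ r ∧ (s : ℝ) ≠ t),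
    ENNReal.ofReal (|psi1 ψ G ε P s x - psi1 ψ G ε P t x| / |(s : ℝ) - t|)

theorem IsIIDPair.measurable_ratLip [IsProbabilityMeasure P] (hε : IsIIDPair ε ε' P)
    (hψ : Measurable ψ) (hG : Measurable G) (r : ℝ) : Measurable (ratLip ψ G ε P r) := by
  have h : ∀ t : ℝ, Measurable fun x => psi1 ψ G ε P t x := fun t =>
    (hε.measurable_psi1 hψ hG).comp (measurable_const.prodMk measurable_id)
  refine Measurable.iSup fun s => Measurable.iSup fun t => Measurable.iSup_Prop _ ?_
  exact (((h s).sub (h t)).abs.div_const _).ennreal_ofReal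

theorem ratLip_le_lipConst {r r' : ℝ} (hr : r ≤ r') (x : ℕ → ℝ) :
    ratLip ψ G ε P r x ≤ lipConst ψ G ε P r' x := by
  refine iSup_le fun s => iSup_le fun t => iSup_le fun h => ?_
  refine le_iSup_of_le (s : ℝ) (le_iSup_of_le (t : ℝ) (le_iSup_of_le ?_ le_rfl))
  exact ⟨h.1.trans hr, h.2.1.trans hr, h.2.2⟩

theorem closure_Ioo_inter_range_ratCast {a b : ℝ} (hab : a ≠ b) :
    closure (Set.Ioo a b ∩ Set.range ((↑) : ℚ → ℝ)) = Set.Icc a b := by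
  refine Set.Subset.antisymm ?_ ?_
  · rw [← closure_Ioo hab]
    exact closure_mono Set.inter_subset_left
  · rw [← closure_Ioo hab]
    exact closure_minimal (Rat.denseRange_cast.open_subset_closure_inter isOpen_Ioo)
      isClosed_closure

/-- Continuity extends the Lipschitz bound from rational points to the whole interval, so nothing is
lost by the countable supremum that makes `ratLip` measurable. -/
theorem abs_psi1_sub_le_ratLip {r : ℝ} (hr : 0 < r) {x : ℕ → ℝ}
    (hc : ContinuousOn (fun t => psi1 ψ G ε P t x) (Set.Icc (-r) r))
    (hfin : ratLip ψ G ε P r x < ∞) {s t : ℝ} (hs : |s| ≤ r) (ht : |t| ≤ r) :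
    |psi1 ψ G ε P s x - psi1 ψ G ε P t x| ≤ (ratLip ψ G ε P r x).toReal * |s - t| := by
  have hcl := closure_Ioo_inter_range_ratCast (a := -r) (b := r) (by linarith)
  have hL : LipschitzOnWith (ratLip ψ G ε P r x).toNNReal (fun t => psi1 ψ G ε P t x)
      (Set.Ioo (-r) r ∩ Set.range ((↑) : ℚ → ℝ)) := by
    refine LipschitzOnWith.of_dist_le_mul ?_
    rintro _ ⟨hs, s, rfl⟩ _ ⟨ht, t, rfl⟩
    by_cases hst : (s : ℝ) = t
    · simp [hst]
    rw [Real.dist_eq, Real.dist_eq, ← div_le_iff₀ (abs_pos.2 (sub_ne_zero.2 hst))]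
    change _ ≤ (ratLip ψ G ε P r x).toReal
    refine (ENNReal.ofReal_le_iff_le_toReal hfin.ne).1 ?_
    refine le_iSup_of_le s (le_iSup_of_le t (le_iSup_of_le ⟨?_, ?_, hst⟩ le_rfl))
    · exact (abs_lt.2 hs).le
    · exact (abs_lt.2 ht).le
  have h2 := hL.closure (by rwa [hcl])
  rw [hcl] at h2
  have := h2.dist_le_mul s (abs_le.1 hs) t (abs_le.1 ht)
  rwa [Real.dist_eq, Real.dist_eq] at this

end Lipschitz

/-! ### Grid and monotone bracketing for the martingale part -/

section Bracketing

variable {Ω : Type*} [MeasurableSpace Ω] {P : Measure Ω} {ε ε' : ℤ → Ω → ℝ}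
  {ψ : ℝ → ℝ} {G : (ℕ → ℝ) → ℝ} {p : ℕ}

/-- The weighted increment of the score as a functional of the past. -/
def incr (ψ : ℝ → ℝ) (G : (ℕ → ℝ) → ℝ) (w t : ℕ → ℝ) (i : ℕ) (y : ℕ → ℝ) : ℝ :=
  w i * (ψ (G y + t i) - ψ (G y))

/-- An envelope of the increments with weights at most `c` and displacements at most `d`. -/
def envelope (ψ : ℝ → ℝ) (G : (ℕ → ℝ) → ℝ) (c d : ℕ → ℝ) (i : ℕ) (y : ℕ → ℝ) : ℝ :=
  c i * (|ψ (G y + d i) - ψ (G y)| + |ψ (G y + -d i) - ψ (G y)|)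

theorem measurable_incr (hψ : Measurable ψ) (hG : Measurable G) (w t : ℕ → ℝ) (i : ℕ) :
    Measurable (incr ψ G w t i) :=
  ((hψ.comp (hG.add_const _)).sub (hψ.comp hG)).const_mul _

theorem measurable_envelope (hψ : Measurable ψ) (hG : Measurable G) (c d : ℕ → ℝ) (i : ℕ) :
    Measurable (envelope ψ G c d i) :=
  ((((hψ.comp (hG.add_const _)).sub (hψ.comp hG)).abs).add
    (((hψ.comp (hG.add_const _)).sub (hψ.comp hG)).abs)).const_mul _

theorem abs_incr_le_envelope (hψ : Monotone ψ) {w t c d : ℕ → ℝ} {i : ℕ} (hw : |w i| ≤ c i)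
    (ht : |t i| ≤ d i) (y : ℕ → ℝ) : |incr ψ G w t i y| ≤ envelope ψ G c d i y := by
  have hc : 0 ≤ c i := (abs_nonneg _).trans hw
  rw [incr, envelope, abs_mul]
  refine mul_le_mul hw ?_ (abs_nonneg _) hc
  obtain ⟨h1, h2⟩ := abs_le.1 ht
  have h3 : ψ (G y + t i) ≤ ψ (G y + d i) := hψ (by linarith)
  have h4 : ψ (G y + -d i) ≤ ψ (G y + t i) := hψ (by linarith)
  have h5 := le_abs_self (ψ (G y + d i) - ψ (G y))
  have h6 := neg_abs_le (ψ (G y + -d i) - ψ (G y))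
  have h7 := abs_nonneg (ψ (G y + d i) - ψ (G y))
  have h8 := abs_nonneg (ψ (G y + -d i) - ψ (G y))
  exact abs_le.2 ⟨by linarith, by linarith⟩

/-- The increment of the score minus its one-step-ahead prediction. -/
noncomputable def resid (ψ : ℝ → ℝ) (G : (ℕ → ℝ) → ℝ) (ε : ℤ → Ω → ℝ) (P : Measure Ω) (ω : Ω)
    (i : ℕ) (t : ℝ) : ℝ :=
  ψ (G (shift ε ((i : ℤ) + 1) ω) + t) - ψ (G (shift ε ((i : ℤ) + 1) ω)) -
    (psi1 ψ G ε P t (shift ε i ω) - psi1 ψ G ε P 0 (shift ε i ω))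

theorem compSum_incr {n : ℕ} {r : ℝ} (hr : 0 ≤ r) {ω : Ω}
    (hint : ∀ i < n, ∀ t : ℝ, |t| ≤ r →
      Integrable (fun u => ψ (G (append u (shift ε i ω)) + t)) (innov ε P))
    (w : ℕ → ℝ) {t : ℕ → ℝ} (ht : ∀ i < n, |t i| ≤ r) :
    compSum ε P (incr ψ G w t) n ω = ∑ i ∈ Finset.range n, w i * resid ψ G ε P ω i (t i) := by
  refine Finset.sum_congr rfl fun i hi => ?_
  have hi := Finset.mem_range.1 hi
  have h0 : Integrable (fun u => ψ (G (append u (shift ε i ω)))) (innov ε P) := by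
    simpa using hint i hi 0 (by simpa using hr)
  have e : ∫ u, incr ψ G w t i (append u (shift ε i ω)) ∂(innov ε P) =
      w i * (psi1 ψ G ε P (t i) (shift ε i ω) - psi1 ψ G ε P 0 (shift ε i ω)) := by
    simp only [incr, psi1, add_zero]
    rw [integral_const_mul, integral_sub (hint i hi _ (ht i hi)) h0]
  rw [e, incr, resid]
  ring

/-- With nonnegative weights and monotone ψ, the score terms at `q` lie between those at `tm` and
`tp`. Only the predictions are left to compare, and these are Lipschitz. The sign condition on the
weights is why the design is split into positive and negative parts. -/
theorem abs_sum_resid_le_of_bracket (hψ : Monotone ψ) {n : ℕ} {r M : ℝ} {ω : Ω}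
    {w tm q tp L g : ℕ → ℝ} (hw : ∀ i, 0 ≤ w i)
    (htm : ∀ i < n, |tm i| ≤ r) (hq : ∀ i < n, |q i| ≤ r) (htp : ∀ i < n, |tp i| ≤ r)
    (hL0 : ∀ i, 0 ≤ L i)
    (hL : ∀ i < n, ∀ s t : ℝ, |s| ≤ r → |t| ≤ r →
      |psi1 ψ G ε P s (shift ε i ω) - psi1 ψ G ε P t (shift ε i ω)| ≤ L i * |s - t|)
    (h1 : ∀ i < n, tm i ≤ q i) (h2 : ∀ i < n, q i ≤ tp i) (h1g : ∀ i < n, q i - tm i ≤ g i)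
    (h2g : ∀ i < n, tp i - q i ≤ g i)
    (hMm : |∑ i ∈ Finset.range n, w i * resid ψ G ε P ω i (tm i)| ≤ M)
    (hMp : |∑ i ∈ Finset.range n, w i * resid ψ G ε P ω i (tp i)| ≤ M) :
    |∑ i ∈ Finset.range n, w i * resid ψ G ε P ω i (q i)| ≤
      M + ∑ i ∈ Finset.range n, w i * (L i * g i) := by
  have hup : ∑ i ∈ Finset.range n, w i * resid ψ G ε P ω i (q i) ≤
      ∑ i ∈ Finset.range n, w i * resid ψ G ε P ω i (tp i) +
        ∑ i ∈ Finset.range n, w i * (L i * g i) := by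
    rw [← Finset.sum_add_distrib]
    refine Finset.sum_le_sum fun i hi => ?_
    have hi := Finset.mem_range.1 hi
    rw [← mul_add]
    refine mul_le_mul_of_nonneg_left ?_ (hw i)
    have a1 := (le_abs_self _).trans (hL i hi _ _ (htp i hi) (hq i hi))
    have a2 : ψ (G (shift ε ((i : ℤ) + 1) ω) + q i) ≤ ψ (G (shift ε ((i : ℤ) + 1) ω) + tp i) :=
      hψ (by linarith [h2 i hi])
    have a3 : L i * |tp i - q i| ≤ L i * g i := by
      rw [abs_of_nonneg (sub_nonneg.2 (h2 i hi))]
      exact mul_le_mul_of_nonneg_left (h2g i hi) (hL0 i)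
    simp only [resid]
    linarith
  have hlo : ∑ i ∈ Finset.range n, w i * resid ψ G ε P ω i (tm i) ≤
      ∑ i ∈ Finset.range n, w i * resid ψ G ε P ω i (q i) +
        ∑ i ∈ Finset.range n, w i * (L i * g i) := by
    rw [← Finset.sum_add_distrib]
    refine Finset.sum_le_sum fun i hi => ?_
    have hi := Finset.mem_range.1 hi
    rw [← mul_add]
    refine mul_le_mul_of_nonneg_left ?_ (hw i)
    have a1 := (le_abs_self _).trans (hL i hi _ _ (hq i hi) (htm i hi))
    have a2 : ψ (G (shift ε ((i : ℤ) + 1) ω) + tm i) ≤ ψ (G (shift ε ((i : ℤ) + 1) ω) + q i) :=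
      hψ (by linarith [h1 i hi])
    have a3 : L i * |q i - tm i| ≤ L i * g i := by
      rw [abs_of_nonneg (sub_nonneg.2 (h1 i hi))]
      exact mul_le_mul_of_nonneg_left (h1g i hi) (hL0 i)
    simp only [resid]
    linarith
  have := abs_le.1 hMm
  have := abs_le.1 hMp
  exact abs_le.2 ⟨by linarith, by linarith⟩

/-- Truncation of a real number to `[-d, d]`. -/
noncomputable def clip (d a : ℝ) : ℝ := max (-d) (min d a)

/-- Clipped brackets stay where the envelope and the local assumptions apply. Since the bracketed
value itself lies in [-d, d], clipping preserves the order and does not widen the gap. -/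
theorem abs_clip_le {d : ℝ} (hd : 0 ≤ d) (a : ℝ) : |clip d a| ≤ d :=
  abs_le.2 ⟨le_max_left _ _, max_le (by linarith) (min_le_left _ _)⟩

theorem le_clip {d a q : ℝ} (hq : |q| ≤ d) (h : q ≤ a) : q ≤ clip d a :=
  le_max_of_le_right (le_min (abs_le.1 hq).2 h)

theorem clip_le {d a q : ℝ} (hq : |q| ≤ d) (h : a ≤ q) : clip d a ≤ q :=
  max_le (abs_le.1 hq).1 ((min_le_right _ _).trans h)

theorem clip_sub_le {d a q : ℝ} (hq : |q| ≤ d) (h : q ≤ a) : clip d a - q ≤ a - q := by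
  have : clip d a ≤ a := max_le ((abs_le.1 hq).1.trans h) (min_le_right _ _)
  linarith

theorem sub_clip_le {d a q : ℝ} (hq : |q| ≤ d) (h : a ≤ q) : q - clip d a ≤ q - a := by
  have h2 : a ≤ clip d a := le_max_of_le_right (le_min (h.trans (abs_le.1 hq).2) le_rfl)
  linarith

/-- The points of a regular grid with mesh `δ / N` in the cube of half-side `δ`. -/
noncomputable def gridPoint (δ : ℝ) (N : ℕ) (j : Fin p → Fin (2 * N + 1)) :
    EuclideanSpace ℝ (Fin p) :=
  WithLp.toLp 2 fun k => (((j k : ℕ) : ℝ) - N) * (δ / N)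

theorem exists_gridPoint_near {δ : ℝ} (hδ : 0 < δ) {N : ℕ} (hN : 0 < N)
    {θ : EuclideanSpace ℝ (Fin p)} (hθ : ‖θ‖ ≤ δ) :
    ∃ j : Fin p → Fin (2 * N + 1), ∀ k, |θ k - gridPoint δ N j k| ≤ δ / N := by
  have hN0 : (0 : ℝ) < N := by exact_mod_cast hN
  have key : ∀ k : Fin p, ∃ j : Fin (2 * N + 1),
      |θ k - (((j : ℕ) : ℝ) - N) * (δ / N)| ≤ δ / N := by
    intro k
    have hk : |θ k| ≤ δ := by
      rw [← Real.norm_eq_abs]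
      exact (PiLp.norm_apply_le θ k).trans hθ
    obtain ⟨h1, h2⟩ := abs_le.1 hk
    -- The coordinate rescaled to [0, 2N]; its integer part is the grid index.
    set v : ℝ := (θ k + δ) * (N / δ) with hv
    have hv0 : 0 ≤ v := mul_nonneg (by linarith) (by positivity)
    have hv1 : v ≤ 2 * N := by
      have : v ≤ (2 * δ) * (N / δ) := mul_le_mul_of_nonneg_right (by linarith) (by positivity)
      refine this.trans (le_of_eq ?_)
      field_simp
    have hfl : ⌊v⌋₊ < 2 * N + 1 := by
      have h3 : ((⌊v⌋₊ : ℕ) : ℝ) ≤ (2 * N : ℕ) := (Nat.floor_le hv0).trans (by exact_mod_cast hv1)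
      have h4 : ⌊v⌋₊ ≤ 2 * N := by exact_mod_cast h3
      omega
    refine ⟨⟨⌊v⌋₊, hfl⟩, ?_⟩
    have e : θ k - (((⌊v⌋₊ : ℕ) : ℝ) - N) * (δ / N) = (v - ⌊v⌋₊) * (δ / N) := by
      rw [hv]
      field_simp
      ring
    rw [e, abs_mul, abs_of_pos (div_pos hδ hN0)]
    have h5 : |v - ⌊v⌋₊| ≤ 1 := by
      have := Nat.floor_le hv0
      have := Nat.lt_floor_add_one v
      exact abs_le.2 ⟨by linarith, by linarith⟩
    calc _ ≤ 1 * (δ / N) := mul_le_mul_of_nonneg_right h5 (by positivity)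
      _ = _ := one_mul _
  choose j hj using key
  exact ⟨j, hj⟩

theorem inner_eq_sum_mul (z θ : EuclideanSpace ℝ (Fin p)) :
    inner ℝ z θ = ∑ k, z k * θ k := by
  rw [PiLp.inner_apply]
  exact Finset.sum_congr rfl fun k _ => by simp [mul_comm]

theorem abs_inner_le_of_coord_le {z v : EuclideanSpace ℝ (Fin p)} {h : ℝ} (hv : ∀ k, |v k| ≤ h) :
    |inner ℝ z v| ≤ ‖z‖ * (p * h) := by
  rw [inner_eq_sum_mul]
  refine (Finset.abs_sum_le_sum_abs _ _).trans ?_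
  refine (Finset.sum_le_card_nsmul _ _ (‖z‖ * h) fun k _ => ?_).trans (le_of_eq ?_)
  · rw [abs_mul]
    refine mul_le_mul ?_ (hv k) (abs_nonneg _) (norm_nonneg _)
    rw [← Real.norm_eq_abs]
    exact PiLp.norm_apply_le z k
  · rw [Finset.card_univ, Fintype.card_fin, nsmul_eq_mul]
    ring

/-- The positive or negative part of the `k`-th coordinate of the design. -/
def partWeight (z : ℕ → EuclideanSpace ℝ (Fin p)) (k : Fin p) (b : Bool) (i : ℕ) : ℝ :=
  if b then max (z i k) 0 else max (-z i k) 0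

/-- Upper or lower bracket around the linear form at a grid point. -/
noncomputable def bracketPoint (z : ℕ → EuclideanSpace ℝ (Fin p)) (δ : ℝ) (N : ℕ)
    (j : Fin p → Fin (2 * N + 1)) (b : Bool) (i : ℕ) : ℝ :=
  clip (‖z i‖ * δ) (-inner ℝ (z i) (gridPoint δ N j) +
    (if b then 1 else -1) * (‖z i‖ * (p * (δ / N))))

theorem partWeight_nonneg (z : ℕ → EuclideanSpace ℝ (Fin p)) (k : Fin p) (b : Bool) (i : ℕ) :
    0 ≤ partWeight z k b i := by
  unfold partWeight
  split_ifs <;> exact le_max_right _ _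

theorem partWeight_le (z : ℕ → EuclideanSpace ℝ (Fin p)) (k : Fin p) (b : Bool) (i : ℕ) :
    partWeight z k b i ≤ ‖z i‖ := by
  have h := PiLp.norm_apply_le (z i) k
  rw [Real.norm_eq_abs] at h
  unfold partWeight
  split_ifs
  · exact max_le ((le_abs_self _).trans h) (norm_nonneg _)
  · exact max_le ((neg_le_abs _).trans h) (norm_nonneg _)

theorem partWeight_sub (z : ℕ → EuclideanSpace ℝ (Fin p)) (k : Fin p) (i : ℕ) :
    partWeight z k true i - partWeight z k false i = z i k := by
  simp only [partWeight, if_true, Bool.false_eq_true, if_false]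
  rcases le_total 0 (z i k) with h | h
  · rw [max_eq_left h, max_eq_right (by linarith)]; ring
  · rw [max_eq_right h, max_eq_left (by linarith)]; ring

theorem abs_sum_coord_resid_le (hψ : Monotone ψ) {n : ℕ} {r M δ : ℝ} (hδ : 0 < δ) {N : ℕ}
    (hN : 0 < N) {ω : Ω} {z : ℕ → EuclideanSpace ℝ (Fin p)} {L : ℕ → ℝ}
    (hzr : ∀ i < n, ‖z i‖ * δ ≤ r)
    (hint : ∀ i < n, ∀ t : ℝ, |t| ≤ r →
      Integrable (fun u => ψ (G (append u (shift ε i ω)) + t)) (innov ε P))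
    (hL0 : ∀ i, 0 ≤ L i)
    (hL : ∀ i < n, ∀ s t : ℝ, |s| ≤ r → |t| ≤ r →
      |psi1 ψ G ε P s (shift ε i ω) - psi1 ψ G ε P t (shift ε i ω)| ≤ L i * |s - t|)
    (hr : 0 ≤ r)
    (hM : ∀ j k b b', |compSum ε P
      (incr ψ G (partWeight z k b) (bracketPoint z δ N j b')) n ω| ≤ M)
    {θ : EuclideanSpace ℝ (Fin p)} (hθ : ‖θ‖ ≤ δ) (k : Fin p) :
    |∑ i ∈ Finset.range n, z i k * resid ψ G ε P ω i (-inner ℝ (z i) θ)| ≤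
      2 * M + 4 * (p * (δ / N)) * ∑ i ∈ Finset.range n, ‖z i‖ ^ 2 * L i := by
  obtain ⟨j, hj⟩ := exists_gridPoint_near hδ hN hθ
  set h : ℝ := p * (δ / N) with hh
  have hd : ∀ i, 0 ≤ ‖z i‖ * δ := fun i => mul_nonneg (norm_nonneg _) hδ.le
  have hq : ∀ i, |-inner ℝ (z i) θ| ≤ ‖z i‖ * δ := fun i => by
    rw [abs_neg]
    exact (abs_real_inner_le_norm _ _).trans (mul_le_mul_of_nonneg_left hθ (norm_nonneg _))
  have hnear : ∀ i, |inner ℝ (z i) θ - inner ℝ (z i) (gridPoint δ N j)| ≤ ‖z i‖ * h := fun i => by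
    rw [← inner_sub_right]
    exact abs_inner_le_of_coord_le fun k => hj k
  have hbr : ∀ b' i, i < n → |bracketPoint z δ N j b' i| ≤ r := fun b' i hi =>
    (abs_clip_le (hd i) _).trans (hzr i hi)
  have hM' : ∀ b b', |∑ i ∈ Finset.range n,
      partWeight z k b i * resid ψ G ε P ω i (bracketPoint z δ N j b' i)| ≤ M := by
    intro b b'
    rw [← compSum_incr hr hint _ (hbr b')]
    exact hM j k b b'
  have hpart : ∀ b, |∑ i ∈ Finset.range n,
      partWeight z k b i * resid ψ G ε P ω i (-inner ℝ (z i) θ)| ≤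
      M + 2 * h * ∑ i ∈ Finset.range n, ‖z i‖ ^ 2 * L i := by
    intro b
    have hlo : ∀ i, -inner ℝ (z i) (gridPoint δ N j) + -1 * (‖z i‖ * h) ≤
        -inner ℝ (z i) θ := fun i => by linarith [(abs_le.1 (hnear i)).2]
    have hup : ∀ i, -inner ℝ (z i) θ ≤
        -inner ℝ (z i) (gridPoint δ N j) + 1 * (‖z i‖ * h) := fun i => by
      linarith [(abs_le.1 (hnear i)).1]
    -- The gap 2‖z i‖h has one share for the distance to the grid point and one for the margin that
    -- guarantees the ordering. Adding the two sign parts later gives the factor 4.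
    have h1 := abs_sum_resid_le_of_bracket (P := P) (ε := ε) (G := G) hψ (n := n) (r := r) (M := M)
      (ω := ω) (w := partWeight z k b) (tm := bracketPoint z δ N j false)
      (q := fun i => -inner ℝ (z i) θ) (tp := bracketPoint z δ N j true) (L := L)
      (g := fun i => 2 * (‖z i‖ * h)) (partWeight_nonneg z k b) (hbr false)
      (fun i hi => (hq i).trans (hzr i hi)) (hbr true) hL0 hL
      (fun i _ => clip_le (hq i) (by simpa using hlo i))
      (fun i _ => le_clip (hq i) (by simpa using hup i))
      (fun i _ => (sub_clip_le (hq i) (by simpa using hlo i)).trans (by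
        have := (abs_le.1 (hnear i)).1
        simp only [Bool.false_eq_true, if_false]
        linarith))
      (fun i _ => (clip_sub_le (hq i) (by simpa using hup i)).trans (by
        have := (abs_le.1 (hnear i)).2
        simp only [if_true]
        linarith)) (hM' b false) (hM' b true)
    refine h1.trans (add_le_add le_rfl ?_)
    rw [Finset.mul_sum]
    refine Finset.sum_le_sum fun i _ => ?_
    have hnn : 0 ≤ L i * (2 * (‖z i‖ * h)) := by
      have := hL0 i
      positivity
    calc _ ≤ ‖z i‖ * (L i * (2 * (‖z i‖ * h))) :=
          mul_le_mul_of_nonneg_right (partWeight_le z k b i) hnn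
      _ = _ := by ring
  have e : ∑ i ∈ Finset.range n, z i k * resid ψ G ε P ω i (-inner ℝ (z i) θ) =
      ∑ i ∈ Finset.range n, partWeight z k true i * resid ψ G ε P ω i (-inner ℝ (z i) θ) -
      ∑ i ∈ Finset.range n, partWeight z k false i * resid ψ G ε P ω i (-inner ℝ (z i) θ) := by
    rw [← Finset.sum_sub_distrib]
    exact Finset.sum_congr rfl fun i _ => by rw [← sub_mul, partWeight_sub]
  rw [e]
  refine (abs_sub _ _).trans ((add_le_add (hpart true) (hpart false)).trans (le_of_eq ?_))
  ring

end Bracketing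

variable {Ω : Type*} [MeasurableSpace Ω] {P : Measure Ω} {ε ε' : ℤ → Ω → ℝ}
  {ψ : ℝ → ℝ} {G : (ℕ → ℝ) → ℝ} {p : ℕ}

/-! ### Integrability of the score and moments of the envelope -/

section Moments

theorem SmoothPast.mono {r r' : ℝ} {B : ℝ≥0∞} {θ : ℕ → ℝ≥0∞} (h : SmoothPast ψ G ε P p r B θ)
    (hr' : 0 < r') (hle : r' ≤ r) : SmoothPast ψ G ε P p r' B θ where
  pos := hr'
  bound_lt_top := h.bound_lt_top
  tsum_lt_top := h.tsum_lt_top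
  eLpNorm_le l hl t ht := h.eLpNorm_le l hl t (ht.trans hle)
  projNorm_le l hl t ht := h.projNorm_le l hl t (ht.trans hle)
  continuousOn i := by
    filter_upwards [h.continuousOn i] with ω hω l hl
    exact (hω l hl).mono (Set.Icc_subset_Icc (by linarith) hle)
  hasDerivAt i := by
    filter_upwards [h.hasDerivAt i] with ω hω l hl t ht
    exact hω l hl t (ht.trans hle)

theorem IsIIDPair.mFun_eq (hε : IsIIDPair ε ε' P) (hψ : Measurable ψ) (hG : Measurable G)
    (t : ℝ) : mFun ψ G ε P t = eLpNorm (fun y => ψ (G y + t) - ψ (G y)) 2 (past ε P) := by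
  have hm : Measurable fun y => ψ (G y + t) - ψ (G y) :=
    (hψ.comp (hG.add_const _)).sub (hψ.comp hG)
  rw [← eLpNorm_comp_measurePreserving hm.aestronglyMeasurable (hε.measurePreserving_shift 1)]
  rfl

theorem A3.exists_lt_top (h3 : A3 ψ G ε P) :
    ∃ r : ℝ, 0 < r ∧ ∀ t : ℝ, |t| ≤ r → mFun ψ G ε P t < ∞ := by
  have h0 : mFun ψ G ε P 0 = 0 := by simp [mFun]
  have h1 : ∀ᶠ t in 𝓝 (0 : ℝ), mFun ψ G ε P t < ∞ := by
    have := h3.tendsto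
    rw [h0] at this
    exact this.eventually_lt_const ENNReal.zero_lt_top
  obtain ⟨r, hr, hb⟩ := Metric.eventually_nhds_iff.1 h1
  refine ⟨r / 2, by positivity, fun t ht => hb ?_⟩
  rw [Real.dist_eq, sub_zero]
  linarith

theorem IsIIDPair.memLp_score [IsProbabilityMeasure P] (hε : IsIIDPair ε ε' P)
    (hψ : Measurable ψ) (hG : Measurable G) (h1 : MemLp (fun ω => ψ (err G ε 1 ω)) 2 P) {t : ℝ}
    (ht : mFun ψ G ε P t < ∞) : MemLp (fun y => ψ (G y + t)) 2 (past ε P) := by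
  have hm : Measurable fun y => ψ (G y + t) - ψ (G y) :=
    (hψ.comp (hG.add_const _)).sub (hψ.comp hG)
  have h2 : MemLp (fun y => ψ (G y + t) - ψ (G y)) 2 (past ε P) :=
    ⟨hm.aestronglyMeasurable, by rwa [← hε.mFun_eq hψ hG]⟩
  have h3 : MemLp (fun y => ψ (G y)) 2 (past ε P) := by
    have hc : Measurable fun y => ψ (G y) := hψ.comp hG
    refine ⟨hc.aestronglyMeasurable, ?_⟩
    rw [← eLpNorm_comp_measurePreserving hc.aestronglyMeasurable (hε.measurePreserving_shift 1)]
    exact h1.2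
  have := h2.add h3
  refine this.congr_norm (hψ.comp (hG.add_const _)).aestronglyMeasurable
    (Eventually.of_forall fun y => ?_)
  simp

/-- The tower property. It identifies the mean subtracted in K_n with the one subtracted in
`centered`. -/
theorem IsIIDPair.integral_score_eq [IsProbabilityMeasure P] (hε : IsIIDPair ε ε' P)
    (hψ : Measurable ψ) (hG : Measurable G) {t : ℝ}
    (hi : Integrable (fun y => ψ (G y + t)) (past ε P)) (k : ℤ) :
    ∫ ω, ψ (G (shift ε k ω) + t) ∂P = ∫ x, psi1 ψ G ε P t x ∂(past ε P) := by
  have := hε.isProbabilityMeasure_innov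
  have := hε.isProbabilityMeasure_past
  have hm : Measurable fun y => ψ (G y + t) := hψ.comp (hG.add_const _)
  have hma : Measurable fun q : ℝ × (ℕ → ℝ) => ψ (G (append q.1 q.2) + t) :=
    hm.comp measurable_append
  have hpair : Measurable fun ω => (ε (0 + 1) ω, shift ε 0 ω) :=
    (hε.measurable_left _).prodMk (hε.measurable_shift _)
  have hi1 : Integrable (fun ω => ψ (G (shift ε (0 + 1) ω) + t)) P :=
    (hε.measurePreserving_shift (0 + 1)).integrable_comp_of_integrable hi
  simp_rw [← append_shift] at hi1
  have hi2 : Integrable (fun q : ℝ × (ℕ → ℝ) => ψ (G (append q.1 q.2) + t))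
      ((innov ε P).prod (past ε P)) := by
    rw [← hε.map_prod_shift 0]
    exact (integrable_map_measure hma.aestronglyMeasurable hpair.aemeasurable).2 hi1
  rw [hε.integral_shift_comp k hm, ← hε.integral_shift_comp (0 + 1) hm]
  simp_rw [← append_shift]
  have e : ∫ ω, ψ (G (append (ε (0 + 1) ω) (shift ε 0 ω)) + t) ∂P =
      ∫ q, ψ (G (append q.1 q.2) + t) ∂((innov ε P).prod (past ε P)) := by
    rw [← hε.map_prod_shift 0, integral_map hpair.aemeasurable hma.aestronglyMeasurable]
  rw [e, integral_prod_symm _ hi2]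
  rfl

/-- By monotonicity the values at |t| ≤ r are dominated by those at r and -r, so a single null set
serves all `t`. -/
theorem IsIIDPair.ae_integrable_append [IsProbabilityMeasure P] (hε : IsIIDPair ε ε' P)
    (hψ : Monotone ψ) (hG : Measurable G) {r : ℝ}
    (hi : ∀ t : ℝ, |t| ≤ r → Integrable (fun y => ψ (G y + t)) (past ε P)) (hr : 0 ≤ r) (i : ℕ) :
    ∀ᵐ ω ∂P, ∀ t : ℝ, |t| ≤ r →
      Integrable (fun u => ψ (G (append u (shift ε i ω)) + t)) (innov ε P) := by
  have hm : ∀ t : ℝ, Measurable fun y => ψ (G y + t) := fun t =>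
    hψ.measurable.comp (hG.add_const _)
  have key : ∀ t : ℝ, |t| ≤ r → ∀ᵐ ω ∂P,
      Integrable (fun u => ψ (G (append u (shift ε i ω)) + t)) (innov ε P) := by
    intro t ht
    have := hε.isProbabilityMeasure_innov
    have hme : Measurable fun y => ‖ψ (G y + t)‖ₑ := (hm t).enorm
    have hfin : ∫⁻ ω, ∫⁻ u, ‖ψ (G (append u (shift ε i ω)) + t)‖ₑ ∂(innov ε P) ∂P ≠ ∞ := by
      rw [← hε.lintegral_shift_succ i hme, hε.lintegral_shift_comp _ hme.aemeasurable]
      exact (hi t ht).2.ne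
    have hmeas : Measurable fun ω =>
        ∫⁻ u, ‖ψ (G (append u (shift ε i ω)) + t)‖ₑ ∂(innov ε P) :=
      ((hme.comp measurable_append).lintegral_prod_left').comp (hε.measurable_shift i)
    filter_upwards [ae_lt_top hmeas hfin] with ω hω
    exact ⟨(measurable_append_left (hm t) _).aestronglyMeasurable, hω⟩
  filter_upwards [key r (by rw [abs_of_nonneg hr]), key (-r) (by rw [abs_neg, abs_of_nonneg hr])]
    with ω h1 h2 t ht
  refine (h1.abs.add h2.abs).mono' (measurable_append_left (hm t) _).aestronglyMeasurable
    (Eventually.of_forall fun u => ?_)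
  obtain ⟨a, b⟩ := abs_le.1 ht
  have a1 : ψ (G (append u (shift ε i ω)) + t) ≤ ψ (G (append u (shift ε i ω)) + r) :=
    hψ (by linarith)
  have a2 : ψ (G (append u (shift ε i ω)) + -r) ≤ ψ (G (append u (shift ε i ω)) + t) :=
    hψ (by linarith)
  have a3 := le_abs_self (ψ (G (append u (shift ε i ω)) + r))
  have a4 := neg_abs_le (ψ (G (append u (shift ε i ω)) + -r))
  have a5 := abs_nonneg (ψ (G (append u (shift ε i ω)) + r))
  have a6 := abs_nonneg (ψ (G (append u (shift ε i ω)) + -r))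
  rw [Real.norm_eq_abs]
  exact abs_le.2 ⟨by simp only [Pi.add_apply]; linarith, by simp only [Pi.add_apply]; linarith⟩

theorem IsIIDPair.lintegral_envelope_sq_le (hε : IsIIDPair ε ε' P) (hψ : Measurable ψ)
    (hG : Measurable G) {c d : ℕ → ℝ} {i : ℕ} (h1 : mFun ψ G ε P (d i) < ∞)
    (h2 : mFun ψ G ε P (-d i) < ∞) :
    ∫⁻ y, ENNReal.ofReal (envelope ψ G c d i y ^ 2) ∂(past ε P) ≤
      ENNReal.ofReal (2 * (c i ^ 2 * ((mFun ψ G ε P (d i)).toReal ^ 2 +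
        (mFun ψ G ε P (-d i)).toReal ^ 2))) := by
  have hm : ∀ t : ℝ, Measurable fun y => ENNReal.ofReal ((ψ (G y + t) - ψ (G y)) ^ 2) := fun t =>
    (((hψ.comp (hG.add_const _)).sub (hψ.comp hG)).pow_const 2).ennreal_ofReal
  have hsq : ∀ t : ℝ, mFun ψ G ε P t < ∞ →
      ∫⁻ y, ENNReal.ofReal ((ψ (G y + t) - ψ (G y)) ^ 2) ∂(past ε P) =
        ENNReal.ofReal ((mFun ψ G ε P t).toReal ^ 2) := by
    intro t ht
    rw [ENNReal.ofReal_pow ENNReal.toReal_nonneg, ENNReal.ofReal_toReal ht.ne,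
      hε.mFun_eq hψ hG, eLpNorm_two_sq]
    simp_rw [enorm_sq_eq_ofReal]
  calc _ ≤ ∫⁻ y, ENNReal.ofReal (2 * c i ^ 2) *
        (ENNReal.ofReal ((ψ (G y + d i) - ψ (G y)) ^ 2) +
          ENNReal.ofReal ((ψ (G y + -d i) - ψ (G y)) ^ 2)) ∂(past ε P) := by
        refine lintegral_mono fun y => ?_
        rw [← ENNReal.ofReal_add (sq_nonneg _) (sq_nonneg _), ← ENNReal.ofReal_mul (by positivity)]
        refine ENNReal.ofReal_le_ofReal ?_
        rw [envelope, mul_pow, ← sq_abs (ψ (G y + d i) - ψ (G y)),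
          ← sq_abs (ψ (G y + -d i) - ψ (G y))]
        set a := |ψ (G y + d i) - ψ (G y)|
        set b := |ψ (G y + -d i) - ψ (G y)|
        nlinarith [mul_nonneg (sq_nonneg (c i)) (sq_nonneg (a - b))]
    _ = _ := by
        have hma : Measurable fun y => ENNReal.ofReal ((ψ (G y + d i) - ψ (G y)) ^ 2) +
            ENNReal.ofReal ((ψ (G y + -d i) - ψ (G y)) ^ 2) := (hm _).add (hm _)
        rw [lintegral_const_mul _ hma, lintegral_add_left (hm _), hsq _ h1,
          hsq _ h2, ← ENNReal.ofReal_add (sq_nonneg _) (sq_nonneg _),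
          ← ENNReal.ofReal_mul (by positivity)]
        congr 1
        ring

end Moments

/-! ### Splitting the M-process into martingale and predictable parts -/

section Decomposition

theorem norm_le_sum_abs (v : EuclideanSpace ℝ (Fin p)) : ‖v‖ ≤ ∑ k, |v k| := by
  conv_lhs => rw [← (EuclideanSpace.basisFun (Fin p) ℝ).sum_repr v]
  refine (norm_sum_le _ _).trans (le_of_eq (Finset.sum_congr rfl fun k _ => ?_))
  rw [norm_smul, (EuclideanSpace.basisFun (Fin p) ℝ).norm_eq_one, mul_one, Real.norm_eq_abs]
  simp

theorem score_eq (x : ℕ → EuclideanSpace ℝ (Fin p)) (n : ℕ) (θ : EuclideanSpace ℝ (Fin p))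
    (ω : Ω) : score ψ G ε x n θ ω = ∑ i ∈ Finset.range n,
      ψ (G (shift ε ((i : ℤ) + 1) ω) + -inner ℝ (zvec x n (i + 1)) θ) • zvec x n (i + 1) := by
  rw [score, sum_Icc_one_eq_sum_range
    (fun i => ψ (err G ε i ω - inner ℝ (zvec x n i) θ) • zvec x n i)]
  refine Finset.sum_congr rfl fun i _ => ?_
  rw [err, sub_eq_add_neg]
  push_cast
  rfl

theorem IsIIDPair.Kn_apply [IsProbabilityMeasure P] (hε : IsIIDPair ε ε' P)
    (hψ : Measurable ψ) (hG : Measurable G) {r : ℝ}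
    (hi : ∀ t : ℝ, |t| ≤ r → Integrable (fun y => ψ (G y + t)) (past ε P))
    {x : ℕ → EuclideanSpace ℝ (Fin p)} {n : ℕ} {θ : EuclideanSpace ℝ (Fin p)}
    (hθ : ∀ i < n, |-inner ℝ (zvec x n (i + 1)) θ| ≤ r) (ω : Ω) (k : Fin p) :
    Kn ψ G ε P x n θ ω k = ∑ i ∈ Finset.range n, zvec x n (i + 1) k *
      (ψ (G (shift ε ((i : ℤ) + 1) ω) + -inner ℝ (zvec x n (i + 1)) θ) -
        ∫ y, psi1 ψ G ε P (-inner ℝ (zvec x n (i + 1)) θ) y ∂(past ε P)) := by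
  have hs : ∀ i < n, Integrable (fun ω =>
      ψ (G (shift ε ((i : ℤ) + 1) ω) + -inner ℝ (zvec x n (i + 1)) θ)) P := fun i hin =>
    (hε.measurePreserving_shift _).integrable_comp_of_integrable (hi _ (hθ i hin))
  have e : ∫ ω, score ψ G ε x n θ ω ∂P = ∑ i ∈ Finset.range n,
      (∫ y, psi1 ψ G ε P (-inner ℝ (zvec x n (i + 1)) θ) y ∂(past ε P)) • zvec x n (i + 1) := by
    simp_rw [score_eq]
    rw [integral_finsetSum _ fun i hin => (hs i (Finset.mem_range.1 hin)).smul_const _]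
    refine Finset.sum_congr rfl fun i hin => ?_
    rw [integral_smul_const, hε.integral_score_eq hψ hG (hi _ (hθ i (Finset.mem_range.1 hin)))]
  rw [Kn, e, score_eq, ← Finset.sum_sub_distrib]
  simp only [← sub_smul, WithLp.ofLp_sum, WithLp.ofLp_smul, Finset.sum_apply, Pi.smul_apply,
    smul_eq_mul]
  exact Finset.sum_congr rfl fun i _ => mul_comm _ _

theorem IsIIDPair.Kn_sub_apply [IsProbabilityMeasure P] (hε : IsIIDPair ε ε' P)
    (hψ : Measurable ψ) (hG : Measurable G) {r : ℝ} (hr : 0 ≤ r)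
    (hi : ∀ t : ℝ, |t| ≤ r → Integrable (fun y => ψ (G y + t)) (past ε P))
    {x : ℕ → EuclideanSpace ℝ (Fin p)} {n : ℕ} {θ : EuclideanSpace ℝ (Fin p)}
    (hθ : ∀ i < n, |-inner ℝ (zvec x n (i + 1)) θ| ≤ r) (ω : Ω) (k : Fin p) :
    (Kn ψ G ε P x n θ ω - Kn ψ G ε P x n 0 ω) k =
      ∑ i ∈ Finset.range n, zvec x n (i + 1) k *
        resid ψ G ε P ω i (-inner ℝ (zvec x n (i + 1)) θ) +
      ∑ i ∈ Finset.range n, zvec x n (i + 1) k *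
        (centered ψ G ε P ω 0 i (-inner ℝ (zvec x n (i + 1)) θ) - centered ψ G ε P ω 0 i 0) := by
  rw [PiLp.sub_apply, hε.Kn_apply hψ hG hi hθ, hε.Kn_apply hψ hG hi (θ := 0) (by simpa using
    fun _ _ => hr), ← Finset.sum_sub_distrib, ← Finset.sum_add_distrib]
  refine Finset.sum_congr rfl fun i _ => ?_
  simp only [inner_zero_right, neg_zero, add_zero, resid, centered, psiVersion_zero]
  ring

/-- The coordinates of the design, indexed by natural numbers. -/
def designCoord (z : ℕ → EuclideanSpace ℝ (Fin p)) (j i : ℕ) : ℝ :=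
  if h : j < p then z i ⟨j, h⟩ else 0

theorem abs_designCoord_le (z : ℕ → EuclideanSpace ℝ (Fin p)) (j i : ℕ) :
    |designCoord z j i| ≤ ‖z i‖ := by
  unfold designCoord
  split_ifs with h
  · rw [← Real.norm_eq_abs]
    exact PiLp.norm_apply_le (z i) _
  · simp

theorem sum_designCoord_mul (z : ℕ → EuclideanSpace ℝ (Fin p)) (θ : EuclideanSpace ℝ (Fin p))
    (i : ℕ) : ∑ j ∈ Finset.range p, designCoord z j i *
      (if h : j < p then -θ ⟨j, h⟩ else 0) = -inner ℝ (z i) θ := by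
  rw [← Fin.sum_univ_eq_sum_range (fun j => designCoord z j i *
      (if h : j < p then -θ ⟨j, h⟩ else 0)), inner_eq_sum_mul, ← Finset.sum_neg_distrib]
  refine Finset.sum_congr rfl fun j _ => ?_
  simp [designCoord]

/-- The oscillation bound for the `k`-th coordinate of the predictable part. -/
noncomputable def coordOsc (ψ : ℝ → ℝ) (G : (ℕ → ℝ) → ℝ) (ε : ℤ → Ω → ℝ) (P : Measure Ω)
    (z : ℕ → EuclideanSpace ℝ (Fin p)) (n : ℕ) (δ : ℝ) (k : Fin p) (ω : Ω) : ℝ≥0∞ :=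
  oscBound (centered ψ G ε P ω) (designCoord z) n δ p 0 (fun i => z i k) (fun _ => 0)

/-- The quantifier over θ stands inside the almost sure event, as a supremum over θ requires. The
displacement vector is -θ, padded with zeros beyond dimension `p`. -/
theorem SmoothPast.ae_enorm_sum_centered_le [IsProbabilityMeasure P] (hε : IsIIDPair ε ε' P)
    (hψ : Measurable ψ) (hG : Measurable G) {r : ℝ} {B : ℝ≥0∞} {ϑ : ℕ → ℝ≥0∞}
    (h : SmoothPast ψ G ε P p r B ϑ) :
    ∀ᵐ ω ∂P, ∀ (z : ℕ → EuclideanSpace ℝ (Fin p)) (n : ℕ) (δ : ℝ),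
      (∀ i < n, δ * (p * ‖z i‖) ≤ r) → ∀ θ : EuclideanSpace ℝ (Fin p), ‖θ‖ ≤ δ → ∀ k,
      ‖∑ i ∈ Finset.range n, z i k * (centered ψ G ε P ω 0 i (-inner ℝ (z i) θ) -
        centered ψ G ε P ω 0 i 0)‖ₑ ≤ coordOsc ψ G ε P z n δ k ω := by
  filter_upwards [ae_all_iff.2 fun i => h.exists_bound hε hψ hG i,
    ae_all_iff.2 fun i => h.centered_sub_eq_integral hε hψ hG i] with ω h1 h2 z n δ hz θ hθ k
  have hδ : 0 ≤ δ := (norm_nonneg _).trans hθ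
  have h3 := enorm_sum_sub_le_oscBound (f := centered ψ G ε P ω) (b := designCoord z) (n := n)
    (p := p) (κ := δ) (r := r)
    (fun l i => (hε.measurable_centered hψ hG l i).comp (measurable_id.prodMk measurable_const))
    (fun l hl i _ => h1 i l hl) (fun l hl i _ => h2 i l hl)
    (u := fun j => if h : j < p then -θ ⟨j, h⟩ else 0) (fun j => by
      dsimp only
      split_ifs with hj
      · rw [abs_neg, ← Real.norm_eq_abs]
        exact (PiLp.norm_apply_le θ _).trans hθ
      · simpa using hδ) p 0 (by simp) (fun i => z i k) (fun _ => 0) (fun i hi => by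
      rw [abs_zero, zero_add]
      refine le_trans (mul_le_mul_of_nonneg_left ?_ hδ) (hz i hi)
      refine (Finset.sum_le_card_nsmul _ _ ‖z i‖ fun j _ => abs_designCoord_le z j i).trans
        (le_of_eq ?_)
      rw [Finset.card_range, nsmul_eq_mul])
  simp only [sum_designCoord_mul, zero_add] at h3
  exact h3

theorem SmoothPast.lintegral_coordOsc_le [IsProbabilityMeasure P] (hε : IsIIDPair ε ε' P)
    (hψ : Measurable ψ) (hG : Measurable G) {r : ℝ} {B : ℝ≥0∞} {ϑ : ℕ → ℝ≥0∞}
    (h : SmoothPast ψ G ε P p r B ϑ) {z : ℕ → EuclideanSpace ℝ (Fin p)} {n : ℕ} {δ : ℝ}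
    (hδ : 0 ≤ δ) (hz : ∀ i < n, δ * (p * ‖z i‖) ≤ r) (hz1 : ∀ i < n, δ * ‖z i‖ ≤ 1) (k : Fin p) :
    ∫⁻ ω, coordOsc ψ G ε P z n δ k ω ∂P ≤ oscConst p * (∑' m, ϑ m) *
      ENNReal.ofReal (δ * √(∑ i ∈ Finset.range n, ‖z i‖ ^ 4)) := by
  have h1 := lintegral_oscBound_le (P := P) (f := centered ψ G ε P) (b := designCoord z)
    (c := fun i => ‖z i‖) (n := n) (p := p) (κ := δ) (r := r)
    (fun l i => hε.measurable_centered hψ hG l i)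
    (fun l hl a s hs => h.lintegral_centered_le hε hψ hG hl a s hs) hδ
    (abs_designCoord_le z) hz1 p 0 (by simp) (fun i => z i k) (fun _ => 0) (fun i hi => by
      rw [abs_zero, zero_add]; exact hz i hi)
  refine h1.trans ?_
  rw [ENNReal.ofReal_mul hδ, ← mul_assoc, ← mul_assoc, ← mul_assoc]
  refine mul_le_mul_right (ENNReal.ofReal_le_ofReal (Real.sqrt_le_sqrt ?_)) _
  refine Finset.sum_le_sum fun i _ => ?_
  have h2 : |z i k| ≤ ‖z i‖ := by
    rw [← Real.norm_eq_abs]; exact PiLp.norm_apply_le (z i) k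
  have h3 : z i k ^ 2 ≤ ‖z i‖ ^ 2 := sq_le_sq.2 (by rwa [abs_norm])
  calc (z i k * ‖z i‖) ^ 2 = z i k ^ 2 * ‖z i‖ ^ 2 := by ring
    _ ≤ ‖z i‖ ^ 2 * ‖z i‖ ^ 2 := mul_le_mul_of_nonneg_right h3 (sq_nonneg _)
    _ = ‖z i‖ ^ 4 := by ring

theorem IsIIDPair.measurable_coordOsc [IsProbabilityMeasure P] (hε : IsIIDPair ε ε' P)
    (hψ : Measurable ψ) (hG : Measurable G) (z : ℕ → EuclideanSpace ℝ (Fin p)) (n : ℕ) (δ : ℝ)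
    (k : Fin p) : Measurable (coordOsc ψ G ε P z n δ k) :=
  (measurable_oscBound (fun l i => hε.measurable_centered hψ hG l i) p 0 fun i => z i k).comp
    (measurable_const.prodMk measurable_id)

end Decomposition

/-! ### Assembly: pathwise bound, probabilities of the exceptional events, and the theorem -/

theorem IsIIDPair.norm_Kn_sub_le [IsProbabilityMeasure P] (hε : IsIIDPair ε ε' P)
    (hψ : Monotone ψ) (hG : Measurable G) {r δ M lam V : ℝ} (hr : 0 < r)
    (hi : ∀ t : ℝ, |t| ≤ r → Integrable (fun y => ψ (G y + t)) (past ε P))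
    {x : ℕ → EuclideanSpace ℝ (Fin p)} {n N : ℕ} (hN : 0 < N) (hδ : 0 < δ) (hlam : 0 ≤ lam)
    (hV : 0 ≤ V) (hzr : ∀ i < n, ‖zvec x n (i + 1)‖ * δ ≤ r) {ω : Ω}
    (hint : ∀ i : ℕ, ∀ t : ℝ, |t| ≤ r →
      Integrable (fun u => ψ (G (append u (shift ε i ω)) + t)) (innov ε P))
    (hcont : ∀ i : ℕ, ContinuousOn (fun t => psi1 ψ G ε P t (shift ε i ω)) (Set.Icc (-r) r))
    (hfin : ∀ i : ℕ, ratLip ψ G ε P r (shift ε i ω) < ∞)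
    (hosc : ∀ θ : EuclideanSpace ℝ (Fin p), ‖θ‖ ≤ δ → ∀ k,
      ‖∑ i ∈ Finset.range n, zvec x n (i + 1) k *
        (centered ψ G ε P ω 0 i (-inner ℝ (zvec x n (i + 1)) θ) -
        centered ψ G ε P ω 0 i 0)‖ₑ ≤ coordOsc ψ G ε P (fun i => zvec x n (i + 1)) n δ k ω)
    (hM : ∀ j k b b', |compSum ε P (incr ψ G (partWeight (fun i => zvec x n (i + 1)) k b)
      (bracketPoint (fun i => zvec x n (i + 1)) δ N j b')) n ω| ≤ M)
    (hLip : ∑ i ∈ Finset.range n, ENNReal.ofReal (‖zvec x n (i + 1)‖ ^ 2) *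
      ratLip ψ G ε P r (shift ε i ω) ≤ ENNReal.ofReal lam)
    (hVs : ∑ k, coordOsc ψ G ε P (fun i => zvec x n (i + 1)) n δ k ω ≤ ENNReal.ofReal V)
    {θ : EuclideanSpace ℝ (Fin p)} (hθ : ‖θ‖ ≤ δ) :
    ‖Kn ψ G ε P x n θ ω - Kn ψ G ε P x n 0 ω‖ ≤ p * (2 * M + 4 * (p * (δ / N)) * lam) + V := by
  set z : ℕ → EuclideanSpace ℝ (Fin p) := fun i => zvec x n (i + 1) with hz
  have hlamsum : ∑ i ∈ Finset.range n,
      ‖z i‖ ^ 2 * (ratLip ψ G ε P r (shift ε i ω)).toReal ≤ lam := by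
    rw [← ENNReal.ofReal_le_ofReal_iff hlam, ENNReal.ofReal_sum_of_nonneg fun i _ =>
      mul_nonneg (sq_nonneg _) ENNReal.toReal_nonneg]
    refine le_trans (le_of_eq (Finset.sum_congr rfl fun i _ => ?_)) hLip
    rw [ENNReal.ofReal_mul (sq_nonneg _), ENNReal.ofReal_toReal (hfin i).ne]
  have hq : ∀ i < n, |-inner ℝ (z i) θ| ≤ r := fun i hin => by
    rw [abs_neg]
    exact ((abs_real_inner_le_norm _ _).trans
      (mul_le_mul_of_nonneg_left hθ (norm_nonneg _))).trans (hzr i hin)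
  have hres : ∀ k, |∑ i ∈ Finset.range n, z i k * resid ψ G ε P ω i (-inner ℝ (z i) θ)| ≤
      2 * M + 4 * (p * (δ / N)) * lam := fun k =>
    (abs_sum_coord_resid_le hψ hδ hN hzr (fun i _ => hint i) (fun i => ENNReal.toReal_nonneg)
      (fun i _ s t hs ht => abs_psi1_sub_le_ratLip hr (hcont i) (hfin i) hs ht) hr.le hM hθ
        k).trans (add_le_add le_rfl (mul_le_mul_of_nonneg_left hlamsum (by positivity)))
  have hoscfin : ∀ k, coordOsc ψ G ε P z n δ k ω < ∞ := fun k =>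
    ENNReal.sum_lt_top.1 (hVs.trans_lt ENNReal.ofReal_lt_top) k (Finset.mem_univ k)
  have hcen : ∀ k, |∑ i ∈ Finset.range n, z i k *
      (centered ψ G ε P ω 0 i (-inner ℝ (z i) θ) - centered ψ G ε P ω 0 i 0)| ≤
      (coordOsc ψ G ε P z n δ k ω).toReal := fun k => by
    rw [← Real.norm_eq_abs, ← toReal_enorm]
    exact ENNReal.toReal_mono (hoscfin k).ne (hosc θ hθ k)
  refine (norm_le_sum_abs _).trans ?_
  have hk : ∀ k, |(Kn ψ G ε P x n θ ω - Kn ψ G ε P x n 0 ω) k| ≤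
      (2 * M + 4 * (p * (δ / N)) * lam) + (coordOsc ψ G ε P z n δ k ω).toReal := fun k => by
    rw [hε.Kn_sub_apply hψ.measurable hG hr.le hi hq]
    exact (abs_add_le _ _).trans (add_le_add (hres k) (hcen k))
  refine (Finset.sum_le_sum fun k _ => hk k).trans ?_
  rw [Finset.sum_add_distrib, Finset.sum_const, Finset.card_univ, Fintype.card_fin, nsmul_eq_mul]
  refine add_le_add le_rfl ?_
  rw [← ENNReal.toReal_sum fun k _ => (hoscfin k).ne]
  exact ENNReal.toReal_le_of_le_ofReal hV hVs

theorem measure_ofReal_lt_le {X : Ω → ℝ≥0∞} (hX : Measurable X) {a q : ℝ} (hq : 0 < q)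
    (h : ∫⁻ ω, X ω ∂P ≤ ENNReal.ofReal a) :
    P {ω | ENNReal.ofReal q < X ω} ≤ ENNReal.ofReal (a / q) := by
  rw [ENNReal.ofReal_div_of_pos hq]
  have hq0 : ENNReal.ofReal q ≠ 0 := by simpa using hq
  refine (measure_mono fun ω (hω : ENNReal.ofReal q < X ω) => hω.le).trans ?_
  exact (meas_ge_le_lintegral_div hX.aemeasurable hq0 ENNReal.ofReal_ne_top).trans
    (ENNReal.div_le_div_right h _)

/-- One factor 2 comes from counting realised and predicted squares, the other from (a + b)² ≤ 2(a²
+ b²) in the envelope. -/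
theorem IsIIDPair.lintegral_envVar_le_tau [IsProbabilityMeasure P] (hε : IsIIDPair ε ε' P)
    (hψ : Measurable ψ) (hG : Measurable G) {r δ : ℝ} (hδ : 0 ≤ δ)
    (hm : ∀ t : ℝ, |t| ≤ r → mFun ψ G ε P t < ∞) {x : ℕ → EuclideanSpace ℝ (Fin p)} {n : ℕ}
    (hzr : ∀ i < n, ‖zvec x n (i + 1)‖ * δ ≤ r) :
    ∫⁻ ω, envVar ε P (envelope ψ G (fun i => ‖zvec x n (i + 1)‖)
      (fun i => ‖zvec x n (i + 1)‖ * δ)) n ω ∂P ≤ ENNReal.ofReal (4 * tau ψ G ε P x n δ) := by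
  rw [hε.lintegral_envVar (measurable_envelope hψ hG _ _), tau, sum_Icc_one_eq_sum_range
    (fun i => ‖zvec x n i‖ ^ 2 * ((mFun ψ G ε P (‖zvec x n i‖ * δ)).toReal ^ 2 +
      (mFun ψ G ε P (-(‖zvec x n i‖ * δ))).toReal ^ 2))]
  have hd : ∀ i < n, |‖zvec x n (i + 1)‖ * δ| ≤ r := fun i hi => by
    rw [abs_of_nonneg (mul_nonneg (norm_nonneg _) hδ)]
    exact hzr i hi
  have e4 : ∀ a : ℝ, 4 * a = 2 * (2 * a) := fun a => by ring
  rw [e4, ENNReal.ofReal_mul two_pos.le, Finset.mul_sum (a := (2 : ℝ)),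
    ENNReal.ofReal_sum_of_nonneg fun i _ => by positivity]
  simp only [ENNReal.ofReal_ofNat]
  refine mul_le_mul_right (Finset.sum_le_sum fun i hi => ?_) _
  have hi := Finset.mem_range.1 hi
  exact hε.lintegral_envelope_sq_le hψ hG (hm _ (hd i hi)) (hm _ (by rw [abs_neg]; exact hd i hi))

theorem tau_nonneg (x : ℕ → EuclideanSpace ℝ (Fin p)) (n : ℕ) (δ : ℝ) :
    0 ≤ tau ψ G ε P x n δ :=
  Finset.sum_nonneg fun _ _ => by positivity

/-- Adding 1/n² to τ keeps the truncation level positive even when τ vanishes. The price √(log n)/n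
≤ 1/√n goes into the second term of the rate. -/
theorem sqrt_regularized_le {T δ s : ℝ} {n : ℕ} (hT : 0 ≤ T) (hn : 2 ≤ n) (hδ : 1 ≤ δ)
    (hs : 1 / √n ≤ s) : √((T + 1 / (n : ℝ) ^ 2) * Real.log n) ≤ √(T * Real.log n) + δ * s := by
  have hn0 : (0 : ℝ) < n := by positivity
  have hL0 : 0 ≤ Real.log n := Real.log_natCast_nonneg n
  have hLn : Real.log n ≤ n := (Real.log_le_sub_one_of_pos hn0).trans (by linarith)
  rw [add_mul]
  have hadd : ∀ {a b : ℝ}, 0 ≤ a → 0 ≤ b → √(a + b) ≤ √a + √b := fun {a b} ha hb => by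
    refine Real.sqrt_le_iff.2 ⟨by positivity, ?_⟩
    nlinarith [Real.sq_sqrt ha, Real.sq_sqrt hb, mul_nonneg (Real.sqrt_nonneg a) (Real.sqrt_nonneg b)]
  refine (hadd (by positivity) (by positivity)).trans (add_le_add le_rfl ?_)
  have h1 : √(1 / (n : ℝ) ^ 2 * Real.log n) ≤ 1 / √n := by
    rw [← Real.sqrt_one, ← Real.sqrt_div' _ hn0.le, Real.sqrt_one]
    refine Real.sqrt_le_sqrt ?_
    rw [div_mul_eq_mul_div, one_mul, div_le_div_iff₀ (by positivity) hn0, one_mul, sq]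
    exact mul_le_mul_of_nonneg_right hLn hn0.le
  have hs0 : 0 ≤ s := le_trans (by positivity) hs
  nlinarith

/-- The grid has at most (3pn)^p points with 4p choices of weight and bracket, against 2n^{-(p+1)}
for each: a single factor 1/n survives. -/
theorem card_mul_exp_le {n : ℕ} (hp : 0 < p) (hn : 2 ≤ n) :
    ((Fintype.card ((Fin p → Fin (2 * (p * n) + 1)) × Fin p × Bool × Bool) : ℕ) : ℝ≥0∞) *
      (2 * ENNReal.ofReal (Real.exp (-((p + 1) * Real.log n)))) ≤
      ENNReal.ofReal (8 * p * (3 * p) ^ p / n) := by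
  have hn0 : (0 : ℝ) < n := by positivity
  have hcard : Fintype.card ((Fin p → Fin (2 * (p * n) + 1)) × Fin p × Bool × Bool) =
      (2 * (p * n) + 1) ^ p * (p * 4) := by
    simp
  have hexp : Real.exp (-((p + 1) * Real.log n)) = ((n : ℝ) ^ (p + 1))⁻¹ := by
    rw [Real.exp_neg]
    congr 1
    rw [← Real.exp_log (pow_pos hn0 (p + 1)), Real.log_pow]
    push_cast
    rfl
  rw [hcard, hexp, ← ENNReal.ofReal_natCast, ← ENNReal.ofReal_ofNat 2,
    ← ENNReal.ofReal_mul (by norm_num), ← ENNReal.ofReal_mul (by positivity)]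
  refine ENNReal.ofReal_le_ofReal ?_
  have hbase : ((2 * (p * n) + 1 : ℕ) : ℝ) ≤ 3 * p * n := by
    have : 1 ≤ p * n := Nat.mul_pos hp (by omega)
    have : 2 * (p * n) + 1 ≤ 3 * p * n := by nlinarith
    exact_mod_cast this
  have hpow : (((2 * (p * n) + 1 : ℕ) : ℝ)) ^ p ≤ (3 * p * n) ^ p :=
    pow_le_pow_left₀ (by positivity) hbase p
  push_cast at hpow ⊢
  rw [le_div_iff₀ hn0, pow_succ]
  calc _ = (2 * (p * n) + 1) ^ p * ((8 * p) * ((n : ℝ) ^ p)⁻¹) := by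
        field_simp
        ring
    _ ≤ (3 * p * n) ^ p * ((8 * p) * ((n : ℝ) ^ p)⁻¹) :=
        mul_le_mul_of_nonneg_right hpow (by positivity)
    _ = 8 * p * (3 * p) ^ p := by
        rw [mul_pow _ (n : ℝ)]
        field_simp

/-- Off a null set and four small events, `IsIIDPair.norm_Kn_sub_le` bounds the supremum
deterministically. Only monotonicity and subadditivity of the outer measure are used for the
supremum, so its measurability is not needed. -/
theorem IsIIDPair.measure_oscillation_le [IsProbabilityMeasure P] (hε : IsIIDPair ε ε' P)
    (hψ : Monotone ψ) (hG : Measurable G) {r : ℝ} {B : ℝ≥0∞} {ϑ : ℕ → ℝ≥0∞}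
    (h : SmoothPast ψ G ε P p r B ϑ) (h1 : MemLp (fun ω => ψ (err G ε 1 ω)) 2 P)
    (hm : ∀ t : ℝ, |t| ≤ r → mFun ψ G ε P t < ∞) {ℓ T : ℝ} (hℓ0 : 0 ≤ ℓ) (hT0 : 0 ≤ T)
    (hℓ : ∫⁻ y, ratLip ψ G ε P r y ∂(past ε P) ≤ ENNReal.ofReal ℓ)
    (hT : oscConst p * (∑' m, ϑ m) ≤ ENNReal.ofReal T) (hp : 0 < p)
    {x : ℕ → EuclideanSpace ℝ (Fin p)} {n : ℕ} (hn : 2 ≤ n) (hx : IsUnit (gram x n).det) {δ : ℝ}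
    (hδ : 1 ≤ δ) (hz : ∀ i < n, δ * (p * ‖zvec x n (i + 1)‖) ≤ r)
    (hz1 : ∀ i < n, δ * ‖zvec x n (i + 1)‖ ≤ 1) {e : ℝ} (he : 0 < e) :
    P {ω | ENNReal.ofReal ((p * (2 * (2 * (4 / e) + p + 1) + 4 * ((p * ℓ + 1) / e)) +
        (p * T + 1) / e) * (√(tau ψ G ε P x n δ * Real.log n) + δ * √(zeta x n 4))) <
        ⨆ (θ : EuclideanSpace ℝ (Fin p)) (_ : ‖θ‖ ≤ δ),
          ‖Kn ψ G ε P x n θ ω - Kn ψ G ε P x n 0 ω‖ₑ} ≤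
      ENNReal.ofReal e + ENNReal.ofReal (8 * p * (3 * p) ^ p / n) + ENNReal.ofReal e +
        ENNReal.ofReal e := by
  have hψm := hψ.measurable
  have hn0 : (0 : ℝ) < n := by positivity
  have hp1 : (1 : ℝ) ≤ p := by exact_mod_cast hp
  have hδ0 : 0 < δ := by linarith
  have hL : 0 < Real.log n := Real.log_pos (by exact_mod_cast (by omega : 1 < n))
  set z : ℕ → EuclideanSpace ℝ (Fin p) := fun i => zvec x n (i + 1) with hzdef
  set τ := tau ψ G ε P x n δ with hτ
  have hτ0 : 0 ≤ τ := tau_nonneg x n δ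
  set s := √(zeta x n 4) with hs
  have hs1 : 1 / √n ≤ s := one_div_sqrt_le hp (by omega) hx
  have hs0 : 0 < s := lt_of_lt_of_le (by positivity) hs1
  -- These are thresholds for Markov's inequality, with expectations bounded by 4τ, pℓ and pTδs. The
  -- added 1 keeps the last two positive when ℓ or T vanishes.
  set C1 := 4 / e with hC1
  set C3 := (p * ℓ + 1) / e with hC3
  set C4 := (p * T + 1) / e with hC4
  have hC1p : 0 < C1 := by positivity
  have hC3p : 0 < C3 := by positivity
  have hC4p : 0 < C4 := by positivity
  set τ' := τ + 1 / (n : ℝ) ^ 2 with hτ'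
  have hτ'0 : 0 < τ' := by positivity
  -- This level balances the truncation error against the exponent: q/A = C1 A log n with A log n =
  -- √(τ' log n), while q/A² = C1 log n.
  set A := √(τ' / Real.log n) with hA
  have hA0 : 0 < A := Real.sqrt_pos.2 (by positivity)
  have hA2 : A ^ 2 = τ' / Real.log n := Real.sq_sqrt (by positivity)
  have hAL : A * Real.log n = √(τ' * Real.log n) := by
    rw [eq_comm, Real.sqrt_eq_iff_mul_self_eq (by positivity) (by positivity)]
    have : A * Real.log n * (A * Real.log n) = A ^ 2 * Real.log n ^ 2 := by ring
    rw [this, hA2]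
    field_simp
  have hτA : τ' = A ^ 2 * Real.log n := by rw [hA2]; field_simp
  set q := C1 * τ' with hq
  have hq0 : 0 < q := by positivity
  -- The share C1 compensates q/A²; the remaining p + 1 beats the number of grid points by one power
  -- of n.
  set K := (C1 + p + 1) * (A * Real.log n) with hK
  have hqA : q / A = C1 * (A * Real.log n) := by rw [hq, hτA]; field_simp
  have hqA2 : -(K / A) + q / A ^ 2 = -((p + 1) * Real.log n) := by
    rw [hq, hK, hτA]; field_simp; ring
  have hzr : ∀ i < n, ‖z i‖ * δ ≤ r := fun i hi => by
    refine le_trans ?_ (hz i hi)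
    rw [mul_comm]
    exact mul_le_mul_of_nonneg_left (le_mul_of_one_le_left (norm_nonneg _) hp1) hδ0.le
  have hi : ∀ t : ℝ, |t| ≤ r → Integrable (fun y => ψ (G y + t)) (past ε P) := fun t ht => by
    have := hε.isProbabilityMeasure_past
    exact (hε.memLp_score hψm hG h1 (hm t ht)).integrable one_le_two
  set D : ℕ → (ℕ → ℝ) → ℝ := envelope ψ G (fun i => ‖z i‖) (fun i => ‖z i‖ * δ) with hD
  have hDm : ∀ i, Measurable (D i) := measurable_envelope hψm hG _ _
  -- Taking N = pn makes p(δ/N) equal to δ/n. The Booleans select the sign part of the weight and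
  -- the end of the bracket.
  let J := (Fin p → Fin (2 * (p * n) + 1)) × Fin p × Bool × Bool
  let η : J → ℕ → (ℕ → ℝ) → ℝ := fun j =>
    incr ψ G (partWeight z j.2.1 j.2.2.1) (bracketPoint z δ (p * n) j.1 j.2.2.2)
  let N0 : Set Ω := {ω | ¬ ((∀ i : ℕ, ∀ t : ℝ, |t| ≤ r →
      Integrable (fun u => ψ (G (append u (shift ε i ω)) + t)) (innov ε P)) ∧
      (∀ i : ℕ, ContinuousOn (fun t => psi1 ψ G ε P t (shift ε i ω)) (Set.Icc (-r) r)) ∧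
      (∀ i : ℕ, ratLip ψ G ε P r (shift ε i ω) < ∞) ∧
      ∀ θ : EuclideanSpace ℝ (Fin p), ‖θ‖ ≤ δ → ∀ k,
        ‖∑ i ∈ Finset.range n, z i k * (centered ψ G ε P ω 0 i (-inner ℝ (z i) θ) -
          centered ψ G ε P ω 0 i 0)‖ₑ ≤ coordOsc ψ G ε P z n δ k ω)}
  let B1 : Set Ω := {ω | ENNReal.ofReal q < envVar ε P D n ω}
  let B2 : Set Ω := {ω | envVar ε P D n ω ≤ ENNReal.ofReal q ∧
    ∃ j, K + q / A < |compSum ε P (η j) n ω|}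
  let B3 : Set Ω := {ω | ENNReal.ofReal C3 < ∑ i ∈ Finset.range n,
    ENNReal.ofReal (‖z i‖ ^ 2) * ratLip ψ G ε P r (shift ε i ω)}
  let B4 : Set Ω := {ω | ENNReal.ofReal (C4 * (δ * s)) < ∑ k, coordOsc ψ G ε P z n δ k ω}
  have hratm := hε.measurable_ratLip (P := P) hψm hG r
  have hN0 : P N0 = 0 := by
    change ∀ᵐ ω ∂P, _
    have a1 := ae_all_iff.2 fun i : ℕ => hε.ae_integrable_append hψ hG hi h.pos.le i
    have a2 := ae_all_iff.2 h.continuousOn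
    have a3 : ∀ᵐ ω ∂P, ∀ i : ℕ, ratLip ψ G ε P r (shift ε i ω) < ∞ := by
      refine ae_all_iff.2 fun i => ae_lt_top (hratm.comp (hε.measurable_shift i)) ?_
      have := hε.lintegral_shift_comp i hratm.aemeasurable
      rw [this]
      exact (hℓ.trans_lt ENNReal.ofReal_lt_top).ne
    have a4 := h.ae_enorm_sum_centered_le hε hψm hG
    filter_upwards [a1, a2, a3, a4] with ω b1 b2 b3 b4
    exact ⟨b1, fun i => b2 i 0 (Nat.zero_le p), b3, b4 z n δ hz⟩
  have hB1 : P B1 ≤ ENNReal.ofReal e := by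
    refine (measure_ofReal_lt_le (hε.measurable_envVar hDm n) hq0
      (hε.lintegral_envVar_le_tau hψm hG hδ0.le hm hzr)).trans (ENNReal.ofReal_le_ofReal ?_)
    rw [div_le_iff₀ hq0, hq, hC1]
    have : e * (4 / e * τ') = 4 * τ' := by field_simp
    rw [this]
    have : 0 ≤ 1 / (n : ℝ) ^ 2 := by positivity
    linarith
  have hB2 : P B2 ≤ ENNReal.ofReal (8 * p * (3 * p) ^ p / n) := by
    have hwd : ∀ (j : J) (i : ℕ) (y : ℕ → ℝ), |η j i y| ≤ D i y := fun j i y => by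
      refine abs_incr_le_envelope hψ ?_ ?_ y
      · rw [abs_of_nonneg (partWeight_nonneg _ _ _ _)]
        exact partWeight_le _ _ _ _
      · exact abs_clip_le (mul_nonneg (norm_nonneg _) hδ0.le) _
    refine (hε.measure_exists_abs_compSum_gt_le (fun j i => measurable_incr hψm hG _ _ i) hDm hwd
      hA0 hq0.le n K).trans ?_
    rw [hqA2]
    exact card_mul_exp_le hp hn
  have hB3 : P B3 ≤ ENNReal.ofReal e := by
    have hmi : ∀ i : ℕ, Measurable fun ω => ratLip ψ G ε P r (shift ε i ω) := fun i =>
      hratm.comp (hε.measurable_shift i)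
    have hsum : ∫⁻ ω, ∑ i ∈ Finset.range n,
        ENNReal.ofReal (‖z i‖ ^ 2) * ratLip ψ G ε P r (shift ε i ω) ∂P ≤
        ENNReal.ofReal (p * ℓ) := by
      rw [lintegral_finsetSum _ fun i _ => (hmi i).const_mul _,
        ← sum_norm_zvec_sq hx, ENNReal.ofReal_mul (Finset.sum_nonneg fun _ _ => sq_nonneg _),
        ENNReal.ofReal_sum_of_nonneg fun _ _ => sq_nonneg _, Finset.sum_mul]
      refine Finset.sum_le_sum fun i _ => ?_
      rw [lintegral_const_mul _ (hmi i), hε.lintegral_shift_comp i hratm.aemeasurable]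
      exact mul_le_mul_right hℓ _
    refine (measure_ofReal_lt_le (Finset.measurable_fun_sum _ fun i _ => (hmi i).const_mul _)
      hC3p hsum).trans (ENNReal.ofReal_le_ofReal ?_)
    rw [div_le_iff₀ hC3p, hC3, mul_div_cancel₀ _ he.ne']
    linarith
  have hB4 : P B4 ≤ ENNReal.ofReal e := by
    have hpos : 0 < C4 * (δ * s) := by positivity
    have hsum : ∫⁻ ω, ∑ k, coordOsc ψ G ε P z n δ k ω ∂P ≤
        ENNReal.ofReal (p * (T * (δ * s))) := by
      rw [lintegral_finsetSum _ fun k _ => hε.measurable_coordOsc hψm hG z n δ k]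
      refine (Finset.sum_le_card_nsmul _ _ (ENNReal.ofReal (T * (δ * s))) fun k _ => ?_).trans
        (le_of_eq ?_)
      · refine (h.lintegral_coordOsc_le hε hψm hG hδ0.le hz hz1 k).trans ?_
        rw [← zeta_four_eq, ENNReal.ofReal_mul hT0]
        exact mul_le_mul_left hT _
      · rw [Finset.card_univ, Fintype.card_fin, nsmul_eq_mul,
          ENNReal.ofReal_mul (Nat.cast_nonneg p), ENNReal.ofReal_natCast]
    refine (measure_ofReal_lt_le (Finset.measurable_fun_sum _ fun k _ =>
      hε.measurable_coordOsc hψm hG z n δ k) hpos hsum).trans (ENNReal.ofReal_le_ofReal ?_)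
    rw [div_le_iff₀ hpos, hC4]
    have : e * ((p * T + 1) / e * (δ * s)) = (p * T + 1) * (δ * s) := by field_simp
    rw [this]
    have : 0 < δ * s := by positivity
    nlinarith
  have hsub : {ω | ENNReal.ofReal ((p * (2 * (2 * C1 + p + 1) + 4 * C3) + C4) *
        (√(τ * Real.log n) + δ * s)) <
        ⨆ (θ : EuclideanSpace ℝ (Fin p)) (_ : ‖θ‖ ≤ δ),
          ‖Kn ψ G ε P x n θ ω - Kn ψ G ε P x n 0 ω‖ₑ} ⊆ N0 ∪ B1 ∪ B2 ∪ B3 ∪ B4 := by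
    intro ω hω
    by_contra hcon
    simp only [Set.mem_union, not_or] at hcon
    obtain ⟨⟨⟨⟨c0, c1⟩, c2⟩, c3⟩, c4⟩ := hcon
    obtain ⟨g1, g2, g3, g4⟩ := not_not.1 c0
    have c1' : envVar ε P D n ω ≤ ENNReal.ofReal q := not_lt.1 c1
    have hM : ∀ j : J, |compSum ε P (η j) n ω| ≤ K + q / A := fun j => by
      by_contra hj
      exact c2 ⟨c1', j, not_le.1 hj⟩
    refine absurd (Set.mem_ofPred_eq.mp hω) (not_lt.2 (iSup₂_le fun θ hθ => ?_))
    have key := hε.norm_Kn_sub_le hψ hG h.pos hi (x := x) (n := n) (N := p * n)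
      (Nat.mul_pos hp (by omega)) hδ0 hC3p.le (by positivity : 0 ≤ C4 * (δ * s)) hzr g1 g2 g3 g4
      (fun j k b b' => hM (j, k, b, b')) (not_lt.1 c3) (not_lt.1 c4) hθ
    rw [← ofReal_norm]
    refine ENNReal.ofReal_le_ofReal (key.trans ?_)
    have hN : (p : ℝ) * (δ / ((p * n : ℕ) : ℝ)) = δ / n := by
      push_cast
      field_simp
    have hreg : A * Real.log n ≤ √(τ * Real.log n) + δ * s := by
      rw [hAL]
      exact sqrt_regularized_le hτ0 hn hδ hs1
    have hdn : δ / n ≤ δ * s := by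
      rw [div_eq_mul_one_div]
      refine mul_le_mul_of_nonneg_left (le_trans ?_ hs1) hδ0.le
      refine one_div_le_one_div_of_le (Real.sqrt_pos.2 hn0) ?_
      rw [Real.sqrt_le_left hn0.le]
      have : (1 : ℝ) ≤ n := by exact_mod_cast (by omega : 1 ≤ n)
      nlinarith
    rw [hN, hqA, hK]
    have hsq := Real.sqrt_nonneg (τ * Real.log n)
    have e1 : 2 * ((C1 + p + 1) * (A * Real.log n) + C1 * (A * Real.log n)) ≤
        2 * (2 * C1 + p + 1) * (√(τ * Real.log n) + δ * s) := by
      have := mul_le_mul_of_nonneg_left hreg (by positivity : 0 ≤ 2 * (2 * C1 + p + 1))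
      linarith
    have e2 : 4 * (δ / n) * C3 ≤ 4 * C3 * (√(τ * Real.log n) + δ * s) := by
      have := mul_le_mul_of_nonneg_left (hdn.trans (le_add_of_nonneg_left hsq))
        (by positivity : 0 ≤ 4 * C3)
      linarith
    have e3 : C4 * (δ * s) ≤ C4 * (√(τ * Real.log n) + δ * s) :=
      mul_le_mul_of_nonneg_left (le_add_of_nonneg_left hsq) hC4p.le
    have e4 := mul_le_mul_of_nonneg_left (add_le_add e1 e2) (by positivity : (0 : ℝ) ≤ p)
    linarith
  refine (measure_mono hsub).trans ?_
  refine (measure_union_le _ _).trans (add_le_add ?_ hB4)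
  refine (measure_union_le _ _).trans (add_le_add ?_ hB3)
  refine (measure_union_le _ _).trans (add_le_add ?_ hB2)
  refine (measure_union_le _ _).trans ?_
  rw [hN0, zero_add]
  exact hB1

end MReg

theorem theorem2 {Ω : Type*} [MeasurableSpace Ω] (P : Measure Ω) [IsProbabilityMeasure P]
    (ε ε' : ℤ → Ω → ℝ) (hε : MReg.IsIIDPair ε ε' P)
    (G : (ℕ → ℝ) → ℝ) (hG : Measurable G)
    (ρ ψ : ℝ → ℝ) (hψ : MReg.IsSubgradient ρ ψ)
    (p : ℕ) (x : ℕ → EuclideanSpace ℝ (Fin p))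
    (hx : ∀ᶠ n in atTop, IsUnit (MReg.gram x n).det)
    (h1 : MReg.A1 ρ ψ G ε P) (h2 : MReg.A2 ψ G ε P) (h3 : MReg.A3 ψ G ε P)
    (h4 : MReg.A4 x) (h5 : MReg.A5 ψ G ε P)
    (h6 : ∀ l : ℕ, l ≤ p → MReg.A6 ψ G ε ε' P l)
    (δ : ℕ → ℝ) (hδ_pos : ∀ n, 0 < δ n) (hδ_top : Tendsto δ atTop atTop)
    (hδ_r : Tendsto (fun n => δ n * MReg.rmax x n) atTop (𝓝 0)) :
    MReg.IsBigOP P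
      (fun n ω => ⨆ (θ : EuclideanSpace ℝ (Fin p)) (_ : ‖θ‖ ≤ δ n),
        ‖MReg.Kn ψ G ε P x n θ ω - MReg.Kn ψ G ε P x n 0 ω‖ₑ)
      (fun n => √(MReg.tau ψ G ε P x n (δ n) * Real.log n) + δ n * √(MReg.zeta x n 4)) := by
  intro η hη
  rcases Nat.eq_zero_or_pos p with rfl | hp
  -- In dimension zero the process vanishes. The case is separate because the lower bound on ζ_n(4)
  -- needs p > 0.
  · refine ⟨1, one_pos, Eventually.of_forall fun n => ?_⟩
    have : ∀ (v : EuclideanSpace ℝ (Fin 0)), ‖v‖ₑ = 0 := fun v => by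
      rw [Subsingleton.elim v 0, enorm_zero]
    simp [this]
  have hmono := hψ.monotone
  have hψm := hmono.measurable
  obtain ⟨r₁, B, ϑ, hS⟩ := hε.exists_smoothPast hψm hG h6
  obtain ⟨r₂, hr₂, hm⟩ := h3.exists_lt_top
  obtain ⟨r₃, hr₃, hLip⟩ := h5
  -- A common radius for smoothness of the predictions, finiteness of m, and the Lipschitz
  -- condition.
  set r := min r₁ (min r₂ r₃) with hr
  have hr0 : 0 < r := lt_min hS.pos (lt_min hr₂ hr₃)
  have hS' := hS.mono hr0 (min_le_left _ _)
  have hm' : ∀ t : ℝ, |t| ≤ r → MReg.mFun ψ G ε P t < ∞ := fun t ht =>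
    hm t (ht.trans ((min_le_right _ _).trans (min_le_left _ _)))
  have hrat : ∫⁻ y, MReg.ratLip ψ G ε P r y ∂(MReg.past ε P) < ∞ := by
    rw [← hε.lintegral_shift_comp ((0 : ℕ) : ℤ) (hε.measurable_ratLip hψm hG r).aemeasurable]
    refine lt_of_le_of_lt (lintegral_mono fun ω => ?_) (hLip 0).2
    exact MReg.ratLip_le_lipConst ((min_le_right _ _).trans (min_le_right _ _)) _
  have hTtop : (MReg.oscConst p : ℝ≥0∞) * (∑' m, ϑ m) < ∞ :=
    ENNReal.mul_lt_top ENNReal.coe_lt_top hS.tsum_lt_top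
  set ℓ := (∫⁻ y, MReg.ratLip ψ G ε P r y ∂(MReg.past ε P)).toReal
  set T := ((MReg.oscConst p : ℝ≥0∞) * (∑' m, ϑ m)).toReal
  have hℓ0 : 0 ≤ ℓ := ENNReal.toReal_nonneg
  have hT0 : 0 ≤ T := ENNReal.toReal_nonneg
  -- Three Markov events and the union bound over the grid receive η/4 each.
  have he : 0 < η / 4 := by positivity
  refine ⟨p * (2 * (2 * (4 / (η / 4)) + p + 1) + 4 * ((p * ℓ + 1) / (η / 4))) +
    (p * T + 1) / (η / 4), by positivity, ?_⟩
  have hp0 : (0 : ℝ) < p := by exact_mod_cast hp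
  have ev1 : ∀ᶠ n in atTop, δ n * MReg.rmax x n < min (r / p) 1 :=
    hδ_r.eventually_lt_const (lt_min (by positivity) one_pos)
  have ev2 : ∀ᶠ n : ℕ in atTop, 8 * (p : ℝ) * (3 * p) ^ p / n < η / 4 :=
    (tendsto_const_div_atTop_nhds_zero_nat _).eventually_lt_const he
  filter_upwards [hx, ev1, ev2, eventually_ge_atTop 2, hδ_top.eventually_ge_atTop 1]
    with n hxn h1n h2n hn hδn
  have hδ0 := hδ_pos n
  have hzb : ∀ i < n, δ n * ‖MReg.zvec x n (i + 1)‖ ≤ δ n * MReg.rmax x n := fun i hi =>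
    mul_le_mul_of_nonneg_left (MReg.norm_zvec_le_rmax hi) hδ0.le
  have hz : ∀ i < n, δ n * (p * ‖MReg.zvec x n (i + 1)‖) ≤ r := fun i hi => by
    have := (hzb i hi).trans (h1n.le.trans (min_le_left _ _))
    rw [le_div_iff₀ hp0] at this
    linarith
  have hz1 : ∀ i < n, δ n * ‖MReg.zvec x n (i + 1)‖ ≤ 1 := fun i hi =>
    (hzb i hi).trans (h1n.le.trans (min_le_right _ _))
  refine (hε.measure_oscillation_le hmono hG hS' h1.memLp hm' hℓ0 hT0
    (ENNReal.ofReal_toReal hrat.ne).ge (ENNReal.ofReal_toReal hTtop.ne).ge hp hn hxn hδn hz hz1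
    he).trans ?_
  calc _ ≤ ENNReal.ofReal (η / 4) + ENNReal.ofReal (η / 4) + ENNReal.ofReal (η / 4) +
        ENNReal.ofReal (η / 4) := by gcongr
    _ = ENNReal.ofReal η := by
        rw [← ENNReal.ofReal_add he.le he.le, ← ENNReal.ofReal_add (by positivity) he.le,
          ← ENNReal.ofReal_add (by positivity) he.le]
        congr 1
        ring
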